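/- **Setting.** There are $K$ arms with parameters $\theta^*_1,\dots,\theta^*_K\in\mathcal C\subset\mathbb R^d$, where $\mathcal C$ is a polytope with vertex set contained in a finite set $V$, $|V|\le 2d$, $\mathcal C=\mathrm{conv}(V)$, of $\ell_1$-diameter at most $D>0$. Contexts $X_s$ are drawn from a law $\mathcal P$ on $\mathcal X$, where $\|x\|_\infty\le M$ for $x\in\mathcal X$; $X_s$ is independent of everything before round $s$. Pulling arm $a_s$ gives a reward $r_s\in[-R,R]$ whose conditional mean, given the past, $X_s$ and $a_s$, is $\zeta(X_s^\top\theta^*_{a_s})$. The link satisfies $0<\mu\le\zeta'(z)\le\beta$ for $|z|\le c$, where $|x^\top\theta|\le c$ for all $x\in\mathcal X$, $\theta\in\mathcal C$. The loss is the GLM loss $f(\theta;x,r)=\int_0^{x^\top\theta}\zeta(z)\,dz-r\,x^\top\theta$, so $\nabla f(\theta;x,r)=(\zeta(x^\top\theta)-r)x$. $L$ is a bound for $\|\nabla f(\theta;x,r)\|_\infty$ over $\theta\in\mathcal C$, $x\in\mathcal X$, $|r|\le R$. **Assumptions.** $[K]=K_{\rm opt}\sqcup K_{\rm sup}$ and $h_{sub},u,\lambda,\ell,\nu>0$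 are such that: (i) arms in $K_{\rm sup}$ maximize $X^\top\theta^*_j$ with probability $0$, and $\max_k\zeta(x^\top\theta^*_k)-h_{sub}>\zeta(x^\top\theta^*_j)$ for $j\in K_{\rm sup}$, $x\in\mathcal X$; (ii) for $i\in K_{\rm opt}$ and $U_i=\{x: x^\top\theta^*_i-h_{sub}>\max_{j\ne i}x^\top\theta^*_j\}$, $\mathcal P(U_i)>u$ and $\mathbb E[XX^\top\mid X\in U_i]\succeq\lambda I_d$; (iii) (margin) whenever $\|\theta_i-\theta^*_i\|_1\le\ell$ for all $i\in K_{\rm opt}$, the gap between the largest and second largest of the numbers $X^\top\theta_i$, $i\in K_{\rm opt}$, is at most $s$ with probability at most $\nu s$, for every $s>0$. **Algorithm** (horizon $T$, warm-up length $t_0\ge1$, privacy parameters $\varepsilon>0$, $0<\delta<1$). The first $Kt_0$ rounds are forced: each arm is pulled in its own block of $t_0$ consecutive rounds, which are steps $1,\dots,t_0$ of its estimator. In round $Kt_0+k$ ($k\ge1$), put $t=t_0+k$; the action $a$ maximizes $\zeta(X^\top\theta_{t,i})$ over the pre-selected arms $\{i:\zeta(X^\top\theta_{t_0,i})>\max_j\zeta(X^\top\theta_{t_0,j})-h_{sub}/2\}$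 ($X$ the current context, any tie-breaking), and every arm makes its step $t$, with sample $(X,r)$ for the pulled arm and the synthetic sample $(0,\zeta(0))$ for the others. Step $t$ of arm $i$ with sample $z_t=(X_{t,i},r_{t,i})$ is as follows: $\theta_0=\theta_1\in\mathcal C$ is arbitrary, $\rho_t=\eta_t=\frac1{t+1}$, $d_1=\nabla f(\theta_1;z_1)$, $d_t=\nabla f(\theta_t;z_t)+(1-\rho_t)(d_{t-1}-\nabla f(\theta_{t-1};z_t))$, $v_t\in\arg\min_{v\in V}(\langle d_t,v\rangle+n^t_v)$ and $\theta_{t+1}=\theta_t+\eta_t(v_t-\theta_t)$, where the $n_v^t$ are fresh independent centred Laplace variables with scale $\frac{4D(\beta D+L)\sqrt{\log T\log(1/\delta)}}{\varepsilon\sqrt t}$. Let $\nabla F_t(\theta_t)=\mathbb E[\nabla f(\theta_{t,i};X_{t,i},r_{t,i})\mid\mathcal F_{t-1}]$, where $\mathcal F_{t-1}$ is all information (contexts, rewards, algorithmic noise) before the round of step $t$ of arm $i$, and $\Delta_t=d_t-\nabla F_t(\theta_{t,i})$. For arm $i$, let $\gamma>0$ be such that the Euclidean ball of radius $\gamma$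 around $\theta^*_i$ lies in $\mathcal C$, and let $G$ be a bound for $\|\nabla f(\theta;x,r)-\mathbb E_{X\sim\mathcal P}[(\zeta(X^\top\theta)-\zeta(X^\top\theta^*_i))X]\|_\infty$ over $\theta\in\mathcal C$, $x\in\mathcal X$, $|r|\le R$. Put $$A(\alpha)=8D(\beta D+G)\sqrt{\log\tfrac{8dT}{\alpha}}+\frac{16D(\beta D+L)\log\frac{4dT}{\alpha}\sqrt{\log T\log(1/\delta)}}{\varepsilon},\qquad C_{sc}(\alpha)=\sqrt{\frac{9(\beta D^2+A(\alpha))^2}{\gamma^2u\mu\lambda}} .$$ **Lemma.** For all $M,D,\beta>0$ and $R\ge0$ there is a constant $C>0$, depending only on $(M,D,\beta,R)$, such that in every such setting, for every $i\in K_{\rm opt}$, every $\alpha\in(0,1)$ and every step $t>t_0$ of arm $i$ made within the horizon (that is, $(K-1)t_0+t\le T$), the following holds with probability at least $1-\alpha$. If the estimators are localized up to step $t$, meaning $\|\theta_{\tau,j}-\theta^*_j\|_1\le\min\{\ell,\frac{h_{sub}}{8\beta M}\}$ for all $j\in K_{\rm opt}$, $t_0\le\tau\le t$, and $\|\theta_{t_0,j}-\theta^*_j\|_1\le\frac{h_{sub}}{8\beta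 M}$ for all $j\in[K]$, then $$\|\Delta_t\|_\infty\le C\Big[\frac\beta t\Big(MD+C_{sc}\big(\tfrac{\alpha}{2(d+t_0)}\big)\big(M+\sqrt{\log\tfrac{d+T}\alpha}\big)\sqrt{t_0}+DM\nu\sum_{\tau=t_0+1}^t\|\theta_{\tau-1,i}-\theta^*_i\|_1\Big)+\frac{(MD+\beta)\sqrt{\log\frac{d+T}\alpha}}{\sqrt t}\Big]$$ and $$\|\Delta_t\|_\infty\le C\sqrt{\log\tfrac{d+T}\alpha}\,\Big[\frac{MD+\beta}{\sqrt t}+\frac{\beta DM}t\Big(C_{sc}\big(\tfrac{\alpha}{d+t_0}\big)\sqrt{t_0}+\nu\sum_{\tau=t_0+1}^t\|\theta_{\tau-1,i}-\theta^*_i\|_1\Big)\Big].$$ -/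

import Mathlib

open MeasureTheory ProbabilityTheory

noncomputable section

namespace PrivateBandit

/-- The `ℓ₁` norm on `ℝᵈ`. The `ℓ_∞` norm is the ambient norm `‖·‖` of `Fin d → ℝ`. -/
def l1 {d : ℕ} (x : Fin d → ℝ) : ℝ := ∑ j, |x j|

/-- The centred Laplace distribution with scale `b > 0`, of density `exp (-|x| / b) / (2 b)`. -/
def laplace (b : ℝ) : Measure ℝ :=
  volume.withDensity fun x => ENNReal.ofReal (Real.exp (-|x| / b) / (2 * b))

/-! ### The loss of a generalized linear model -/

/-- GLM loss (negative log-likelihood up to a constant) with inverse link `ζ`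
at parameter `θ` and sample `z = (x, r)`. -/
def glmLoss {d : ℕ} (ζ : ℝ → ℝ) (θ : Fin d → ℝ) (z : (Fin d → ℝ) × ℝ) : ℝ :=
  (∫ s in (0 : ℝ)..(z.1 ⬝ᵥ θ), ζ s) - z.2 * (z.1 ⬝ᵥ θ)

/-- The gradient in `θ` of the GLM loss, `(ζ(xᵀθ) - r) x`. -/
def glmGrad {d : ℕ} (ζ : ℝ → ℝ) (θ : Fin d → ℝ) (z : (Fin d → ℝ) × ℝ) : Fin d → ℝ :=
  (ζ (z.1 ⬝ᵥ θ) - z.2) • z.1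

/-- `glmGrad` is indeed the gradient of `glmLoss`. -/
theorem hasDerivAt_glmLoss {d : ℕ} {ζ : ℝ → ℝ} (hζ : Continuous ζ) (θ w : Fin d → ℝ)
    (z : (Fin d → ℝ) × ℝ) :
    HasDerivAt (fun s : ℝ => glmLoss ζ (θ + s • w) z) (glmGrad ζ θ z ⬝ᵥ w) 0 := by
  have h1 : HasDerivAt (fun s : ℝ => z.1 ⬝ᵥ (θ + s • w)) (z.1 ⬝ᵥ w) 0 := by
    have h := ((hasDerivAt_id (0 : ℝ)).mul_const (z.1 ⬝ᵥ w)).const_add (z.1 ⬝ᵥ θ)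
    simpa [dotProduct_add, dotProduct_smul] using h
  have h2 : HasDerivAt (fun u : ℝ => ∫ s in (0 : ℝ)..u, ζ s) (ζ (z.1 ⬝ᵥ θ))
      (z.1 ⬝ᵥ (θ + (0 : ℝ) • w)) := by
    have h := intervalIntegral.integral_hasDerivAt_right
      (hζ.intervalIntegrable 0 (z.1 ⬝ᵥ θ))
      (hζ.stronglyMeasurableAtFilter volume _) hζ.continuousAt
    simpa using h
  have h3 := (h2.comp (0 : ℝ) h1).sub (h1.const_mul z.2)
  refine h3.congr_deriv ?_
  simp only [glmGrad, smul_dotProduct, smul_eq_mul]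
  ring

/-! ### Private polyhedral online Frank-Wolfe: iterates and recursive gradients -/

/-- Frank-Wolfe iterates: `θ₀ = θ₁ = p` and `θ_{t+1} = θ_t + η_t (v_t - θ_t)`, `η_t = 1/(t+1)`. -/
def iterate {d : ℕ} (p : Fin d → ℝ) (v : ℕ → Fin d → ℝ) : ℕ → Fin d → ℝ
  | 0 => p
  | 1 => p
  | t + 2 => iterate p v (t + 1) +
      (1 / ((t + 1 : ℕ) + 1 : ℝ)) • (v (t + 1) - iterate p v (t + 1))

/-- Recursive gradient estimator: `d₁ = ∇f(θ₁, z₁)` and, for `t ≥ 2`,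
`d_t = ∇f(θ_t, z_t) + (1 - ρ_t) (d_{t-1} - ∇f(θ_{t-1}, z_t))`, `ρ_t = 1/(t+1)`. -/
def recGrad {d : ℕ} (ζ : ℝ → ℝ) (θ : ℕ → Fin d → ℝ) (z : ℕ → (Fin d → ℝ) × ℝ) :
    ℕ → Fin d → ℝ
  | 0 => 0
  | 1 => glmGrad ζ (θ 1) (z 1)
  | t + 2 => glmGrad ζ (θ (t + 2)) (z (t + 2)) +
      (1 - 1 / ((t + 2 : ℕ) + 1 : ℝ)) •
        (recGrad ζ θ z (t + 1) - glmGrad ζ (θ (t + 1)) (z (t + 2)))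

/-- Scale of the Laplace noise at step `t`, for horizon `T`, diameter `D`, smoothness `β`,
Lipschitz constant `L` and privacy parameters `(ε, δ)`. -/
def noiseScale (D β L ε δ : ℝ) (T t : ℕ) : ℝ :=
  4 * D * (β * D + L) * √(Real.log T * Real.log (1 / δ)) / (ε * √(t : ℝ))

/-! ### The bandit instance and its assumptions -/

/-- A generalized linear bandit with `K` arms and contexts in `ℝᵈ`: the context set and the
context law, the inverse link, the arm parameters, and the vertices of the polytope over which
the estimators range. -/
structure GLMBandit (d K : ℕ) where
  ctx : Set (Fin d → ℝ)
  law : Measure (Fin d → ℝ)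
  link : ℝ → ℝ
  param : Fin K → Fin d → ℝ
  vert : Finset (Fin d → ℝ)

namespace GLMBandit

variable {d K : ℕ}

/-- The polytope `𝒞` spanned by the vertices. -/
def body (B : GLMBandit d K) : Set (Fin d → ℝ) := convexHull ℝ (B.vert : Set (Fin d → ℝ))

/-- Boundedness of contexts and of the (at most `2d`-vertex) polytope in the `ℓ_∞` and `ℓ₁`
norms, with the parameters in the polytope. -/
structure Bounded (B : GLMBandit d K) (M D : ℝ) : Prop where
  prob : IsProbabilityMeasure B.law
  mem_ctx : ∀ᵐ x ∂B.law, x ∈ B.ctx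
  ctx_le : ∀ x ∈ B.ctx, ‖x‖ ≤ M
  card_vert : B.vert.card ≤ 2 * d
  diam_le : ∀ θ ∈ B.body, ∀ θ' ∈ B.body, l1 (θ - θ') ≤ D
  param_mem : ∀ i, B.param i ∈ B.body

/-- The region `U_i` where arm `i` is the best one by more than `h`. -/
def bestRegion (B : GLMBandit d K) (h : ℝ) (i : Fin K) : Set (Fin d → ℝ) :=
  {x | ∀ j, j ≠ i → x ⬝ᵥ B.param j < x ⬝ᵥ B.param i - h}

/-- Optimal arm set condition for the partition of the arms into `Kopt` and its complement. -/
structure OptimalArms (B : GLMBandit d K) (Kopt : Finset (Fin K)) (h u : ℝ) : Prop where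
  sub_null : ∀ i ∉ Kopt, B.law {x | ∀ j, x ⬝ᵥ B.param j ≤ x ⬝ᵥ B.param i} = 0
  sub_gap : ∀ j ∉ Kopt, ∀ x ∈ B.ctx, ∃ i,
    B.link (x ⬝ᵥ B.param j) < B.link (x ⬝ᵥ B.param i) - h
  opt_prob : ∀ i ∈ Kopt, ENNReal.ofReal u < B.law (B.bestRegion h i)

/-- Eigenvalue condition `𝔼[X Xᵀ | X ∈ U_i] ⪰ lam · I` for the optimal arms. -/
def Eigenvalue (B : GLMBandit d K) (Kopt : Finset (Fin K)) (h lam : ℝ) : Prop :=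
  ∀ i ∈ Kopt, ∀ w : Fin d → ℝ,
    lam * (w ⬝ᵥ w) ≤ ∫ x, (x ⬝ᵥ w) ^ 2 ∂(cond B.law (B.bestRegion h i))

/-- Margin condition: for all `θ_i ∈ Γ_i` (the `ℓ₁` ball of radius `ell` about the true
parameter), `i ∈ Kopt`, the gap between the largest and the second largest `xᵀθ_i`
is at most `s` with probability at most `ν s`. -/
def Margin (B : GLMBandit d K) (Kopt : Finset (Fin K)) (ell ν : ℝ) : Prop :=
  ∀ θ : Fin K → Fin d → ℝ, (∀ i ∈ Kopt, l1 (θ i - B.param i) ≤ ell) →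
    ∀ s : ℝ, 0 < s →
      B.law {x | ∃ i ∈ Kopt, ∃ j ∈ Kopt, j ≠ i ∧ (∀ k ∈ Kopt, x ⬝ᵥ θ k ≤ x ⬝ᵥ θ i) ∧
        x ⬝ᵥ θ i - x ⬝ᵥ θ j ≤ s} ≤ ENNReal.ofReal (ν * s)

/-- Link condition: `m ≤ ζ' ≤ β` on `[-c, c]`, an interval containing all values `xᵀθ`. -/
structure Link (B : GLMBandit d K) (c m β : ℝ) : Prop where
  range : ∀ x ∈ B.ctx, ∀ θ ∈ B.body, |x ⬝ᵥ θ| ≤ c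
  diff : ∀ s : ℝ, |s| ≤ c → DifferentiableAt ℝ B.link s
  lower : ∀ s : ℝ, |s| ≤ c → m ≤ deriv B.link s
  upper : ∀ s : ℝ, |s| ≤ c → deriv B.link s ≤ β

/-- The parameter of arm `i` is at Euclidean distance at least `γ` from the boundary of the
polytope. -/
def Interior (B : GLMBandit d K) (i : Fin K) (γ : ℝ) : Prop :=
  ∀ w : Fin d → ℝ, (w - B.param i) ⬝ᵥ (w - B.param i) ≤ γ ^ 2 → w ∈ B.body

/-- All stochastic gradients are bounded by `L` in `ℓ_∞` norm, rewards being in `[-R, R]`. -/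
def GradLip (B : GLMBandit d K) (R L : ℝ) : Prop :=
  ∀ θ ∈ B.body, ∀ x ∈ B.ctx, ∀ r : ℝ, |r| ≤ R → ‖glmGrad B.link θ (x, r)‖ ≤ L

/-- Population gradient of the loss of arm `i` under the context law. -/
def popGrad (B : GLMBandit d K) (i : Fin K) (θ : Fin d → ℝ) : Fin d → ℝ :=
  ∫ x, glmGrad B.link θ (x, B.link (x ⬝ᵥ B.param i)) ∂B.law

/-- Stochastic gradients of arm `i` deviate by at most `G` from the population gradient. -/
def GradDev (B : GLMBandit d K) (i : Fin K) (R G : ℝ) : Prop :=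
  ∀ θ ∈ B.body, ∀ x ∈ B.ctx, ∀ r : ℝ, |r| ≤ R →
    ‖glmGrad B.link θ (x, r) - B.popGrad i θ‖ ≤ G

end GLMBandit

/-! ### Runs of the algorithm -/

/-- The random quantities of a run: contexts `X s`, rewards `r s` and actions `a s` in round
`s = 1, 2, …`; Laplace noises `N i t w` (arm `i`, step `t` of that arm, vertex `w`); and
Frank-Wolfe vertices `v i t`. -/
structure Run {d K : ℕ} (B : GLMBandit d K) (Ω : Type*) where
  init : Fin K → Fin d → ℝ
  t0 : ℕ
  X : ℕ → Ω → Fin d → ℝ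
  r : ℕ → Ω → ℝ
  a : ℕ → Ω → Fin K
  N : Fin K → ℕ → B.vert → Ω → ℝ
  v : Fin K → ℕ → Ω → B.vert

namespace Run

variable {d K : ℕ} {B : GLMBandit d K} {Ω : Type*}

/-- The round in which the estimator of arm `i` makes its `t`-th step (`t ≥ 1`): the warm-up
gives the rounds `i t₀ + 1, …, i t₀ + t₀` to arm `i = 0, …, K - 1`; afterwards all arms make
a step in each round, and step `t₀ + k` is made in round `K t₀ + k`. -/
def round (S : Run B Ω) (i : Fin K) (t : ℕ) : ℕ :=
  if t ≤ S.t0 then (i : ℕ) * S.t0 + t else (K - 1) * S.t0 + t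

/-- The estimator `θ_{t,i}`. -/
def est (S : Run B Ω) (i : Fin K) (t : ℕ) (ω : Ω) : Fin d → ℝ :=
  iterate (S.init i) (fun k => (S.v i k ω : Fin d → ℝ)) t

/-- The sample used at step `t` of arm `i`: the observed context and reward if arm `i` was pulled,
and the synthetic sample `(0, ζ(0))` otherwise. -/
def sample (S : Run B Ω) (i : Fin K) (t : ℕ) (ω : Ω) : (Fin d → ℝ) × ℝ :=
  if S.a (S.round i t) ω = i then (S.X (S.round i t) ω, S.r (S.round i t) ω)
  else (0, B.link 0)

/-- The recursive gradient `d_t` of arm `i`. -/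
def grad (S : Run B Ω) (i : Fin K) (t : ℕ) (ω : Ω) : Fin d → ℝ :=
  recGrad B.link (fun k => S.est i k ω) (fun k => S.sample i k ω) t

/-- Arm `i` is pre-selected at context `x`, according to the warm-up estimators. -/
def Preselected (S : Run B Ω) (h : ℝ) (x : Fin d → ℝ) (ω : Ω) (i : Fin K) : Prop :=
  ∀ j, B.link (x ⬝ᵥ S.est j S.t0 ω) - h / 2 < B.link (x ⬝ᵥ S.est i S.t0 ω)

/-- The noise vector of arm `i` at step `t`. -/
def armNoise (S : Run B Ω) (i : Fin K) (t : ℕ) (ω : Ω) : B.vert → ℝ := fun w => S.N i t w ω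

/-- The noise vector of all arms at step `t`. -/
def allNoise (S : Run B Ω) (t : ℕ) (ω : Ω) : Fin K × B.vert → ℝ := fun p => S.N p.1 t p.2 ω

/-- The information available when the action of round `s` is chosen: the past (everything up
to round `s - 1`) and the context of round `s`. -/
abbrev pre [MeasurableSpace Ω] (S : Run B Ω)
    (ℱ : Filtration ℕ (inferInstance : MeasurableSpace Ω)) (s : ℕ) : MeasurableSpace Ω :=
  ℱ (s - 1) ⊔ MeasurableSpace.comap (S.X s) inferInstance

/-- The run `S` follows the private high dimensional bandit algorithm with horizon `T`, gap
parameter `h` and noise scales `b t`, in the environment `B` with rewards bounded by `R`.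
Here `ℱ s` is the information (contexts, rewards, algorithmic randomness) up to round `s`. -/
structure IsDPHDB [MeasurableSpace Ω] (S : Run B Ω) (P : Measure Ω)
    (ℱ : Filtration ℕ (inferInstance : MeasurableSpace Ω))
    (T : ℕ) (h R : ℝ) (b : ℕ → ℝ) : Prop where
  init_mem : ∀ i, S.init i ∈ B.body
  -- adaptedness
  meas_X : ∀ s, 1 ≤ s → s ≤ T → Measurable[ℱ s] (S.X s)
  meas_r : ∀ s, 1 ≤ s → s ≤ T → Measurable[ℱ s] (S.r s)
  meas_a : ∀ s, 1 ≤ s → s ≤ T → Measurable[S.pre ℱ s] (S.a s)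
  meas_N : ∀ i t, 1 ≤ t → S.round i t ≤ T → Measurable[ℱ (S.round i t)] (S.armNoise i t)
  meas_v : ∀ i t, 1 ≤ t → S.round i t ≤ T → Measurable[ℱ (S.round i t)] (S.v i t)
  -- the environment: fresh contexts, bounded rewards following the generalized linear model
  law_X : ∀ s, 1 ≤ s → s ≤ T → P.map (S.X s) = B.law
  indep_X : ∀ s, 1 ≤ s → s ≤ T →
    Indep (MeasurableSpace.comap (S.X s) inferInstance) (ℱ (s - 1)) P
  bdd_r : ∀ s, 1 ≤ s → s ≤ T → ∀ᵐ ω ∂P, |S.r s ω| ≤ R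
  mean_r : ∀ s, 1 ≤ s → s ≤ T →
    P[S.r s | S.pre ℱ s] =ᵐ[P] fun ω => B.link (S.X s ω ⬝ᵥ B.param (S.a s ω))
  -- fresh independent Laplace noises
  law_warm : ∀ i t, 1 ≤ t → t ≤ S.t0 → S.round i t ≤ T →
    P.map (S.armNoise i t) = Measure.pi fun _ => laplace (b t)
  indep_warm : ∀ i t, 1 ≤ t → t ≤ S.t0 → S.round i t ≤ T →
    Indep (MeasurableSpace.comap (S.armNoise i t) inferInstance)
      (S.pre ℱ (S.round i t) ⊔ MeasurableSpace.comap (S.r (S.round i t)) inferInstance) P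
  law_greedy : ∀ t, S.t0 < t → (K - 1) * S.t0 + t ≤ T →
    P.map (S.allNoise t) = Measure.pi fun _ => laplace (b t)
  indep_greedy : ∀ t, S.t0 < t → (K - 1) * S.t0 + t ≤ T →
    Indep (MeasurableSpace.comap (S.allNoise t) inferInstance)
      (S.pre ℱ ((K - 1) * S.t0 + t) ⊔
        MeasurableSpace.comap (S.r ((K - 1) * S.t0 + t)) inferInstance) P
  -- the noisy Frank-Wolfe vertex
  argmin_v : ∀ i t, 1 ≤ t → S.round i t ≤ T → ∀ᵐ ω ∂P, ∀ w : B.vert,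
    S.grad i t ω ⬝ᵥ (S.v i t ω : Fin d → ℝ) + S.N i t (S.v i t ω) ω ≤
      S.grad i t ω ⬝ᵥ (w : Fin d → ℝ) + S.N i t w ω
  -- forced sampling, then greedy play among the pre-selected arms
  forced : ∀ i t, 1 ≤ t → t ≤ S.t0 → S.round i t ≤ T → ∀ᵐ ω ∂P, S.a (S.round i t) ω = i
  greedy_mem : ∀ t, S.t0 < t → (K - 1) * S.t0 + t ≤ T → ∀ᵐ ω ∂P,
    S.Preselected h (S.X ((K - 1) * S.t0 + t) ω) ω (S.a ((K - 1) * S.t0 + t) ω)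
  greedy_max : ∀ t, S.t0 < t → (K - 1) * S.t0 + t ≤ T → ∀ᵐ ω ∂P,
    ∀ k, S.Preselected h (S.X ((K - 1) * S.t0 + t) ω) ω k →
      B.link (S.X ((K - 1) * S.t0 + t) ω ⬝ᵥ S.est k t ω) ≤
        B.link (S.X ((K - 1) * S.t0 + t) ω ⬝ᵥ S.est (S.a ((K - 1) * S.t0 + t) ω) t ω)

/-- `∇F_t(θ_t) = 𝔼[∇f(θ_t; X_{t,i}, r_{t,i}) | ℱ_{t-1}]`, the conditional expectation of the
stochastic gradient at the current estimator given the past. -/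
def condGrad [MeasurableSpace Ω] (S : Run B Ω) (P : Measure Ω)
    (ℱ : Filtration ℕ (inferInstance : MeasurableSpace Ω)) (i : Fin K) (t : ℕ) :
    Ω → Fin d → ℝ :=
  P[fun ω => glmGrad B.link (S.est i t ω) (S.sample i t ω) | ℱ (S.round i t - 1)]

/-- The recursive gradient error `‖Δ_t‖_∞ = ‖d_t - ∇F_t(θ_t)‖_∞` of arm `i`. -/
def gradError [MeasurableSpace Ω] (S : Run B Ω) (P : Measure Ω)
    (ℱ : Filtration ℕ (inferInstance : MeasurableSpace Ω)) (i : Fin K) (t : ℕ) (ω : Ω) : ℝ :=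
  ‖S.grad i t ω - S.condGrad P ℱ i t ω‖

/-- The cumulative estimation error `∑_{τ = t₀+1}^{t} ‖θ_{τ-1,i} - θ*_i‖₁`. -/
def cumError (S : Run B Ω) (i : Fin K) (t : ℕ) (ω : Ω) : ℝ :=
  ∑ τ ∈ Finset.Icc (S.t0 + 1) t, l1 (S.est i (τ - 1) ω - B.param i)

/-- From the end of the warm-up to step `t`, the estimators of the optimal arms have stayed in
the regions `Γ_j` of the margin condition, and (with the warm-up estimators of the other
arms) they are accurate with respect to the gap parameter `h` of the pre-selection. -/
def Localized (S : Run B Ω) (Kopt : Finset (Fin K)) (M β h ell : ℝ) (t : ℕ) (ω : Ω) : Prop :=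
  (∀ j, β * M * l1 (S.est j S.t0 ω - B.param j) ≤ h / 8) ∧
  ∀ τ, S.t0 ≤ τ → τ ≤ t → ∀ j ∈ Kopt,
    l1 (S.est j τ ω - B.param j) ≤ ell ∧ β * M * l1 (S.est j τ ω - B.param j) ≤ h / 8

end Run

/-! ### The constants in the bound -/

/-- `A(α)`, for dimension `d` and horizon `T`. -/
def constA (D β G L ε δ : ℝ) (d T : ℕ) (α : ℝ) : ℝ :=
  8 * D * (β * D + G) * √(Real.log (8 * d * T / α)) +
    16 * D * (β * D + L) * Real.log (4 * d * T / α) *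
      √(Real.log T * Real.log (1 / δ)) / ε

/-- `C_sc = √(9 (β D² + A)² / (γ² u m lam))`, with `A = A(α)`. -/
def constSC (D β A γ u m lam : ℝ) : ℝ :=
  √(9 * (β * D ^ 2 + A) ^ 2 / (γ ^ 2 * u * m * lam))

end PrivateBandit

end

/-! Since `1 - ρ_t = t/(t+1)`, multiplying the recursion by `t+1` linearises it: coordinatewise,
`(t+1) Δ_t = t Δ_{t-1} + ξ_t + t b_t`. Here `ξ_t` (`martDiff`) is a martingale difference, and `b_t`
(`drift`) is the change, with `θ_{t-1}` frozen, of the conditional mean gradient from step `t-1` to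
step `t`. Summation gives `(t+1) Δ_t = 2 Δ_1 + ∑ (ξ_k + k b_k)` (`ae_gradError_eq_sum`), and each
piece has its own reason to be small.

Martingale part: iterates move by at most `D/t` in `ℓ₁`, so `ξ_t` is bounded by a constant depending
only on `M, D, β, R`, and Azuma-Hoeffding makes the sum of order `√t` up to logarithms.

Drift in the warm-up: the arm is always pulled on i.i.d. contexts, so the conditional mean is the
population gradient and `b_k = 0`.

Drift at step `t₀+1`: forced sampling turns into greedy play. Under localization the arm is pulled
exactly when it has the best estimated score (`greedy_eq_iff_mem_bestSet`), so the mean gradient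
loses the contexts outside that region. The loss is at most `M 𝔼|ζ(Xᵀθ) - ζ(Xᵀθ*)|` at `θ = θ_{t₀}`,
which cocoercivity bounds by the square root of the excess risk. That risk is of order `C_sc² / t₀`,
by the fast rate of noisy Frank-Wolfe with an interior optimum (`frankWolfe_fast_rate`,
`excess_iterate_le`); it applies because in the warm-up gradient errors and noises are of order
`1/√k`. The weight `t₀+1` then leaves `C_sc √t₀`.

Drift afterwards: the region of the arm changes only where two scores are within `2MD/k`, an event
of probability at most `2νMD/k` by the margin condition, and there the integrand is at most `βM²
‖θ_{k-1} - θ*‖₁`. The weight `k` cancels `1/k`, leaving the cumulative error.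

A union bound over coordinates, warm-up steps and vertices gives the good event; the rest is a
comparison of constants. -/

namespace PrivateBandit

/-! ### Conditioning on the past with a fresh variable -/

section Freezing

variable {Ω Θ E : Type*} {m mΩ : MeasurableSpace Ω} {P : Measure Ω} [IsProbabilityMeasure P]
  [MeasurableSpace Θ] [MeasurableSpace E]

/-- `Y ⁻¹' s ∩ A` is still an event of the past `m`, so independence of `X` survives restriction to
`A`. This allows both the test sets of a conditional expectation and the localization event to play
the role of `A`. -/
theorem map_prodMk_restrict_eq_prod (hm : m ≤ mΩ) {Y : Ω → Θ} (hY : Measurable[m] Y) {X : Ω → E}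
    (hX : Measurable X) (hind : Indep (MeasurableSpace.comap X inferInstance) m P)
    {A : Set Ω} (hA : MeasurableSet[m] A) :
    (P.restrict A).map (fun ω => (Y ω, X ω)) = ((P.restrict A).map Y).prod (P.map X) := by
  have hY' : Measurable Y := hY.mono hm le_rfl
  have : IsProbabilityMeasure (P.map X) := Measure.isProbabilityMeasure_map hX.aemeasurable
  refine (Measure.prod_eq fun s t hs ht => ?_).symm
  rw [Measure.map_apply (hY'.prodMk hX) (hs.prod ht), Measure.map_apply hY' hs,
    Measure.map_apply hX ht, Measure.restrict_apply ((hY'.prodMk hX) (hs.prod ht)),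
    Measure.restrict_apply (hY' hs)]
  have h := (Indep_iff _ _ _).1 hind (X ⁻¹' t) (Y ⁻¹' s ∩ A) ⟨t, ht, rfl⟩
    ((hY hs).inter hA)
  rw [mul_comm, ← h]
  congr 1
  ext ω
  simp only [Set.mem_inter_iff, Set.mem_preimage, Set.mem_prod]
  tauto

theorem condExp_eq_integral_fresh (hm : m ≤ mΩ) {Y : Ω → Θ} (hY : Measurable[m] Y) {X : Ω → E}
    (hX : Measurable X) (hind : Indep (MeasurableSpace.comap X inferInstance) m P)
    {Φ : Θ × E → ℝ} (hΦ : Measurable Φ) {C : ℝ} (hC : ∀ p, |Φ p| ≤ C) :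
    P[fun ω => Φ (Y ω, X ω) | m] =ᵐ[P] fun ω => ∫ x, Φ (Y ω, x) ∂(P.map X) := by
  have hY' : Measurable Y := hY.mono hm le_rfl
  have : IsProbabilityMeasure (P.map X) := Measure.isProbabilityMeasure_map hX.aemeasurable
  have hsm : StronglyMeasurable fun θ => ∫ x, Φ (θ, x) ∂(P.map X) :=
    StronglyMeasurable.integral_prod_right (f := fun θ x => Φ (θ, x)) hΦ.stronglyMeasurable
  have hb : ∀ θ, ‖∫ x, Φ (θ, x) ∂(P.map X)‖ ≤ C := fun θ => by
    simpa using norm_integral_le_of_norm_le_const (μ := P.map X) (f := fun x => Φ (θ, x))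
      (Filter.Eventually.of_forall fun x => hC (θ, x))
  symm
  refine ae_eq_condExp_of_forall_setIntegral_eq hm ?_ ?_ ?_ ?_
  · exact Integrable.of_bound (hΦ.comp (hY'.prodMk hX)).aestronglyMeasurable C
      (Filter.Eventually.of_forall fun ω => hC _)
  · intro s _ _
    exact (Integrable.of_bound (hsm.comp_measurable hY').aestronglyMeasurable C
      (Filter.Eventually.of_forall fun ω => hb _)).integrableOn
  · intro s hs _
    have h1 := map_prodMk_restrict_eq_prod hm hY hX hind hs
    have h2 : ∫ ω in s, Φ (Y ω, X ω) ∂P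
        = ∫ p, Φ p ∂((P.restrict s).map fun ω => (Y ω, X ω)) :=
      (integral_map (hY'.prodMk hX).aemeasurable hΦ.aestronglyMeasurable).symm
    rw [h2, h1, integral_prod _ (Integrable.of_bound hΦ.aestronglyMeasurable C
      (Filter.Eventually.of_forall hC)),
      integral_map hY'.aemeasurable hsm.aestronglyMeasurable]
  · exact (hsm.comp_measurable hY).aestronglyMeasurable

/-- Fubini for the restricted product law. It serves to exclude ties between scores, whose sections
are null only on a past event. -/
theorem ae_notMem_of_fresh (hm : m ≤ mΩ) {Y : Ω → Θ} (hY : Measurable[m] Y) {X : Ω → E}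
    (hX : Measurable X) (hind : Indep (MeasurableSpace.comap X inferInstance) m P)
    {A : Set Ω} (hA : MeasurableSet[m] A) {W : Set (Θ × E)} (hW : MeasurableSet W)
    (h0 : ∀ ω ∈ A, P.map X {x | (Y ω, x) ∈ W} = 0) :
    ∀ᵐ ω ∂P, ω ∈ A → (Y ω, X ω) ∉ W := by
  have hY' : Measurable Y := hY.mono hm le_rfl
  have : IsProbabilityMeasure (P.map X) := Measure.isProbabilityMeasure_map hX.aemeasurable
  have h1 : (P.restrict A).map (fun ω => (Y ω, X ω)) W = 0 := by
    rw [map_prodMk_restrict_eq_prod hm hY hX hind hA, Measure.prod_apply hW,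
      lintegral_map (measurable_measure_prodMk_left hW) hY']
    exact (setLIntegral_congr_fun (hm _ hA) fun ω hω => h0 ω hω).trans lintegral_zero
  rw [Measure.map_apply (hY'.prodMk hX) hW, Measure.restrict_apply ((hY'.prodMk hX) hW)] at h1
  filter_upwards [measure_eq_zero_iff_ae_notMem.1 h1] with ω hω hA hWω
  exact hω ⟨hWω, hA⟩

end Freezing

/-! ### The Azuma-Hoeffding inequality -/

section Azuma

/-- By convexity `exp` lies below its chord over `[-lc, lc]`. The bound is affine in `y`, so its
second term disappears under a conditional expectation. -/
theorem exp_mul_le_cosh_add {c y : ℝ} (l : ℝ) (hc : 0 < c) (hy : |y| ≤ c) :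
    Real.exp (l * y) ≤ Real.cosh (l * c) + y / c * Real.sinh (l * c) := by
  obtain ⟨h1, h2⟩ := abs_le.1 hy
  have hconv := (convexOn_exp.2 (Set.mem_univ (l * c)) (Set.mem_univ (-(l * c))) :
      ∀ ⦃a b : ℝ⦄, 0 ≤ a → 0 ≤ b → a + b = 1 → _) (a := (1 + y / c) / 2) (b := (1 - y / c) / 2)
    (by have : -1 ≤ y / c := by rw [le_div_iff₀ hc]; linarith
        linarith)
    (by have : y / c ≤ 1 := by rw [div_le_iff₀ hc]; linarith
        linarith) (by ring)
  have e : (1 + y / c) / 2 * (l * c) + (1 - y / c) / 2 * -(l * c) = l * y := by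
    field_simp
    ring
  simp only [smul_eq_mul, e] at hconv
  rw [Real.cosh_eq, Real.sinh_eq]
  linarith

variable {Ω : Type*} {mΩ : MeasurableSpace Ω} {P : Measure Ω} {𝒢 : ℕ → MeasurableSpace Ω}
  {ξ : ℕ → Ω → ℝ} {c : ℝ} {n : ℕ}

theorem ae_abs_sum_range_le (hb : ∀ k < n, ∀ᵐ ω ∂P, |ξ k ω| ≤ c) :
    ∀ᵐ ω ∂P, |∑ k ∈ Finset.range n, ξ k ω| ≤ n * c := by
  have h : ∀ᵐ ω ∂P, ∀ k ∈ Finset.range n, |ξ k ω| ≤ c :=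
    (ae_ball_iff (Finset.range n).countable_toSet).2 fun k hk => hb k (Finset.mem_range.1 hk)
  filter_upwards [h] with ω hω
  refine (Finset.abs_sum_le_sum_abs _ _).trans ((Finset.sum_le_sum hω).trans ?_)
  simp

variable [IsProbabilityMeasure P]

theorem integrable_exp_mul_sum (l : ℝ)
    (hm : ∀ k < n, StronglyMeasurable (ξ k))
    (hb : ∀ k < n, ∀ᵐ ω ∂P, |ξ k ω| ≤ c) :
    Integrable (fun ω => Real.exp (l * ∑ k ∈ Finset.range n, ξ k ω)) P := by
  refine Integrable.of_bound (C := Real.exp (|l| * (n * c))) ?_ ?_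
  · refine (Real.continuous_exp.comp_stronglyMeasurable ?_).aestronglyMeasurable
    exact (Finset.stronglyMeasurable_fun_sum _ fun k hk =>
      hm k (Finset.mem_range.1 hk)).const_mul l
  · filter_upwards [ae_abs_sum_range_le hb] with ω hω
    rw [Real.norm_eq_abs, Real.abs_exp]
    refine Real.exp_le_exp.2 ((le_abs_self _).trans ?_)
    rw [abs_mul]
    gcongr

theorem integral_exp_mul_sum_le (h𝒢 : ∀ k, 𝒢 k ≤ mΩ) (hc : 0 < c) (l : ℝ)
    (hm : ∀ k < n, StronglyMeasurable (ξ k))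
    (had : ∀ k < n, ∀ j < k, StronglyMeasurable[𝒢 k] (ξ j))
    (hb : ∀ k < n, ∀ᵐ ω ∂P, |ξ k ω| ≤ c) (h0 : ∀ k < n, P[ξ k | 𝒢 k] =ᵐ[P] 0) :
    ∫ ω, Real.exp (l * ∑ k ∈ Finset.range n, ξ k ω) ∂P ≤ Real.exp (n * ((l * c) ^ 2 / 2)) := by
  induction n with
  | zero => simp
  | succ n ih =>
    have ih' := ih (fun k hk => hm k (by omega)) (fun k hk => had k (by omega))
      (fun k hk => hb k (by omega)) (fun k hk => h0 k (by omega))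
    set Z : Ω → ℝ := fun ω => Real.exp (l * ∑ k ∈ Finset.range n, ξ k ω) with hZ
    have hZi : Integrable Z P := integrable_exp_mul_sum l (fun k hk => hm k (by omega))
      (fun k hk => hb k (by omega))
    have hZm : StronglyMeasurable[𝒢 n] Z := by
      refine Real.continuous_exp.comp_stronglyMeasurable ?_
      exact (Finset.stronglyMeasurable_fun_sum _ fun k hk =>
        had n (by omega) k (Finset.mem_range.1 hk)).const_mul l
    have hξi : Integrable (ξ n) P :=
      Integrable.of_bound (hm n (by omega)).aestronglyMeasurable c (hb n (by omega))
    have hZξ : Integrable (fun ω => Z ω * ξ n ω) P := by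
      refine hZi.mul_bdd (c := c) (hm n (by omega)).aestronglyMeasurable (hb n (by omega))
    -- `Z` is known at time `n` and `ξ n` is conditionally centred.
    have hzero : ∫ ω, Z ω * ξ n ω ∂P = 0 := by
      rw [← integral_condExp (h𝒢 n)]
      have h1 := condExp_mul_of_stronglyMeasurable_left (μ := P) (m := 𝒢 n) hZm hZξ hξi
      rw [integral_eq_zero_of_ae]
      filter_upwards [h1, h0 n (by omega)] with ω h1 h2
      have : (fun ω => Z ω * ξ n ω) = Z * ξ n := rfl
      rw [this, h1]
      simp [h2]
    have hle : ∫ ω, Real.exp (l * ∑ k ∈ Finset.range (n + 1), ξ k ω) ∂P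
        ≤ ∫ ω, (Real.cosh (l * c) * Z ω + Real.sinh (l * c) / c * (Z ω * ξ n ω)) ∂P := by
      refine integral_mono_ae (integrable_exp_mul_sum l hm hb)
        ((hZi.const_mul _).add (hZξ.const_mul _)) ?_
      filter_upwards [hb n (by omega)] with ω hω
      have h1 := exp_mul_le_cosh_add l hc hω
      simp only [Finset.sum_range_succ, mul_add, Real.exp_add]
      have h2 : 0 < Z ω := Real.exp_pos _
      have h3 := mul_le_mul_of_nonneg_left h1 h2.le
      refine h3.trans (le_of_eq ?_)
      ring
    refine hle.trans ?_
    rw [integral_add (hZi.const_mul _) (hZξ.const_mul _), integral_const_mul, integral_const_mul,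
      hzero, mul_zero, add_zero]
    have hch := Real.cosh_le_exp_half_sq (l * c)
    calc Real.cosh (l * c) * ∫ ω, Z ω ∂P
        ≤ Real.exp ((l * c) ^ 2 / 2) * Real.exp (n * ((l * c) ^ 2 / 2)) := by
          gcongr
      _ = _ := by
          rw [← Real.exp_add]
          congr 1
          push_cast
          ring

/-- Azuma-Hoeffding for sums of at most `N` martingale differences bounded by `c`. -/
theorem measure_sum_ge_le_exp_neg (h𝒢 : ∀ k, 𝒢 k ≤ mΩ) (hc : 0 < c)
    (hm : ∀ k < n, StronglyMeasurable (ξ k))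
    (had : ∀ k < n, ∀ j < k, StronglyMeasurable[𝒢 k] (ξ j))
    (hb : ∀ k < n, ∀ᵐ ω ∂P, |ξ k ω| ≤ c) (h0 : ∀ k < n, P[ξ k | 𝒢 k] =ᵐ[P] 0)
    {N : ℕ} (hnN : n ≤ N) (hN : 0 < N) {y : ℝ} (hy : 0 ≤ y) :
    P {ω | c * √(2 * N * y) ≤ ∑ k ∈ Finset.range n, ξ k ω} ≤ ENNReal.ofReal (Real.exp (-y)) := by
  have hN' : (0 : ℝ) < N := by exact_mod_cast hN
  have hnN' : (n : ℝ) ≤ N := by exact_mod_cast hnN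
  set x := c * √(2 * N * y) with hx
  set l := x / (N * c ^ 2) with hl
  have hx0 : 0 ≤ x := by positivity
  have hl0 : 0 ≤ l := by positivity
  have hxx : x ^ 2 = c ^ 2 * (2 * N * y) := by
    rw [hx, mul_pow, Real.sq_sqrt (by positivity)]
  have h1 := measure_ge_le_exp_mul_mgf (μ := P) (X := fun ω => ∑ k ∈ Finset.range n, ξ k ω) x hl0
    (integrable_exp_mul_sum l hm hb)
  have h2 := integral_exp_mul_sum_le h𝒢 hc l hm had hb h0
  rw [ENNReal.le_ofReal_iff_toReal_le (measure_ne_top _ _) (Real.exp_pos _).le]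
  refine h1.trans ?_
  calc Real.exp (-l * x) * mgf (fun ω => ∑ k ∈ Finset.range n, ξ k ω) P l
      ≤ Real.exp (-l * x) * Real.exp (N * ((l * c) ^ 2 / 2)) := by
        refine mul_le_mul_of_nonneg_left (h2.trans (Real.exp_le_exp.2 ?_)) (Real.exp_pos _).le
        gcongr
    _ = Real.exp (-y) := by
        rw [← Real.exp_add]
        congr 1
        have e1 : l * x = 2 * y := by
          rw [hl, div_mul_eq_mul_div, ← sq, hxx]
          field_simp
        have e2 : N * ((l * c) ^ 2 / 2) = y := by
          rw [hl, mul_pow, div_pow, hxx]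
          field_simp
        rw [e2, neg_mul, e1]
        ring

end Azuma

/-! ### The Laplace distribution -/

section Laplace

theorem integrable_exp_neg_abs_div {b : ℝ} (hb : 0 < b) :
    Integrable (fun x : ℝ => Real.exp (-|x| / b) / (2 * b)) := by
  have h5 : ∀ x : ℝ, Real.exp (-x / b) = Real.exp (-(1 / b) * x) := fun x => by ring_nf
  have h6 : ∀ x : ℝ, Real.exp (x / b) = Real.exp ((1 / b) * x) := fun x => by ring_nf
  refine Integrable.div_const ?_ _
  rw [← integrableOn_univ, ← Set.Iic_union_Ioi (a := (0 : ℝ))]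
  refine IntegrableOn.union ?_ ?_
  · refine (integrableOn_exp_mul_Iic (a := 1 / b) (by positivity) 0).congr_fun
      (fun x hx => ?_) measurableSet_Iic
    simp only [abs_of_nonpos (Set.mem_Iic.1 hx), neg_neg, h6]
  · refine (integrableOn_exp_mul_Ioi (a := -(1 / b)) (by simpa using hb) 0).congr_fun
      (fun x hx => ?_) measurableSet_Ioi
    simp only [abs_of_pos (Set.mem_Ioi.1 hx), h5]

/-- The density depends on `|x|` only, so the integral folds onto the half line. The case `y = 0` is
the total mass. -/
theorem laplace_setOf_lt_abs {b y : ℝ} (hb : 0 < b) (hy : 0 ≤ y) :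
    laplace b {x | b * y ≤ |x|} = ENNReal.ofReal (Real.exp (-y)) := by
  have hms : MeasurableSet {x : ℝ | b * y ≤ |x|} := measurableSet_le measurable_const
    measurable_id.abs
  rw [laplace, withDensity_apply _ hms, ← ofReal_integral_eq_lintegral_ofReal
    (integrable_exp_neg_abs_div hb).integrableOn
    (Filter.Eventually.of_forall fun x => by positivity)]
  congr 1
  rw [← integral_indicator hms]
  have e : ({x : ℝ | b * y ≤ |x|}.indicator fun x => Real.exp (-|x| / b) / (2 * b))
      = fun x => (Set.Ici (b * y)).indicator (fun x => Real.exp (-x / b) / (2 * b)) |x| := by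
    ext x
    simp only [Set.indicator_apply, Set.mem_ofPred_eq, Set.mem_Ici]
  rw [e, integral_comp_abs
    (f := (Set.Ici (b * y)).indicator (fun x => Real.exp (-x / b) / (2 * b)))]
  rw [← integral_indicator measurableSet_Ioi, Set.indicator_indicator,
    integral_indicator (measurableSet_Ioi.inter measurableSet_Ici)]
  have hby : 0 ≤ b * y := by positivity
  have h3 : ∫ x in Set.Ioi 0 ∩ Set.Ici (b * y), Real.exp (-x / b) / (2 * b)
      = ∫ x in Set.Ioi (b * y), Real.exp (-x / b) / (2 * b) := by
    refine setIntegral_congr_set ?_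
    have h4 : (Set.Ioi 0 ∩ Set.Ici (b * y) : Set ℝ) =ᵐ[volume]
        (Set.Ioi 0 ∩ Set.Ioi (b * y) : Set ℝ) :=
      Filter.EventuallyEq.rfl.inter Ioi_ae_eq_Ici.symm
    have h5 : (Set.Ioi 0 ∩ Set.Ioi (b * y) : Set ℝ) = Set.Ioi (b * y) := by
      rw [Set.Ioi_inter_Ioi, max_eq_right hby]
    rwa [h5] at h4
  rw [h3, integral_div]
  have h5 : ∀ x : ℝ, -x / b = -(1 / b) * x := fun x => by ring
  simp only [h5]
  rw [integral_exp_mul_Ioi (by simpa using hb)]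
  have h6 : -(1 / b) * (b * y) = -y := by field_simp
  rw [h6]
  field_simp

theorem isProbabilityMeasure_laplace {b : ℝ} (hb : 0 < b) : IsProbabilityMeasure (laplace b) := by
  constructor
  have h := laplace_setOf_lt_abs hb le_rfl
  simpa using h

end Laplace

/-! ### The rate of Frank-Wolfe with an interior optimum -/

section Rate

theorem sqrt_succ_bounds {t : ℕ} (ht : 1 ≤ t) :
    √((t : ℝ) + 1) ≤ 1.5 * √(t : ℝ) := by
  have h1 : (1 : ℝ) ≤ t := by exact_mod_cast ht
  rw [Real.sqrt_le_left (by positivity), mul_pow, Real.sq_sqrt (by positivity)]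
  linarith

variable {h : ℕ → ℝ} {n : ℕ} {a E B : ℝ}

/-- Multiplied by `t + 1`, the recursion telescopes: `t h t` grows by at most `(E + B)/√t`, which is
below `3 (E + B) (√(t+1) - √t)`. -/
theorem frankWolfe_slow_rate (hE : 0 ≤ E) (hB : 0 < B) (h1 : h 1 ≤ B)
    (hstep : ∀ t, 1 ≤ t → t < n →
      h (t + 1) ≤ h t - h t / (t + 1) + E / (√t * (t + 1)) + B / (t + 1) ^ 2) :
    ∀ t, 1 ≤ t → t ≤ n → t * h t ≤ 3 * (E + B) * √t := by
  intro t ht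
  induction t, ht using Nat.le_induction with
  | base =>
    intro _
    simp only [Nat.cast_one, Real.sqrt_one, mul_one, one_mul]
    linarith
  | succ t ht ih =>
    intro hn
    have ih := ih (by omega)
    have hs := hstep t ht (by omega)
    have ht1 : (1 : ℝ) ≤ t := by exact_mod_cast ht
    set q := √(t : ℝ) with hq
    set r := √((t : ℝ) + 1) with hr
    have hq1 : 1 ≤ q := by rw [hq, Real.one_le_sqrt]; exact ht1
    have hqq : q * q = t := Real.mul_self_sqrt (by positivity)
    have hrr : r * r = t + 1 := Real.mul_self_sqrt (by positivity)
    have hrq : r ≤ 1.5 * q := sqrt_succ_bounds ht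
    have hqr : q ≤ r := Real.sqrt_le_sqrt (by linarith)
    have e1 : ((t : ℝ) + 1) * (h t - h t / (t + 1) + E / (q * (t + 1)) + B / (t + 1) ^ 2)
        = t * h t + E / q + B / (t + 1) := by
      field_simp
      ring
    have h2 : ((t : ℝ) + 1) * h (t + 1) ≤ t * h t + E / q + B / (t + 1) := by
      rw [← e1]
      exact mul_le_mul_of_nonneg_left hs (by positivity)
    have h3 : B / ((t : ℝ) + 1) ≤ B / q := by
      gcongr
      nlinarith
    have h4 : (E + B) / q ≤ (E + B) * (3 * (r - q)) := by
      rw [div_eq_mul_inv]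
      gcongr
      rw [inv_le_iff_one_le_mul₀ (by linarith)]
      nlinarith
    have h5 : (E + B) / q = E / q + B / q := add_div _ _ _
    push_cast
    rw [← hr]
    nlinarith

/-- Here `q = √t`, `y = √(h t)`, and `S²` is the target for `t h t`. On `[0, S/q]` the left side is
largest at `y = S/q`, where it equals `S² + (S²/q - 5W)/q`; the last bracket is nonpositive once `q
≥ 4S/(3a)`. -/
theorem fast_rate_step {a W S q y : ℝ} (ha : 0 < a) (hW : 0 < W) (hS : 0 < S) (hq : 1 ≤ q)
    (hy : 0 ≤ y) (hyS : y * q ≤ S) (haS : a * S = 6 * W) (hSa : a ≤ S)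
    (hqS : 4 / 3 * S ≤ a * q) :
    y ^ 2 * (q ^ 2 + 1) - a * y + W / q ≤ S ^ 2 := by
  have h4 : y ^ 2 * (q ^ 2 + 1) - a * y ≤ (S / q) * ((S / q) * (q ^ 2 + 1) - a) := by
    have hyq : y ≤ S / q := by rw [le_div_iff₀ (by positivity)]; exact hyS
    have h5 : a ≤ (S / q) * (q ^ 2 + 1) := by
      rw [div_mul_eq_mul_div, le_div_iff₀ (by positivity)]
      nlinarith
    calc y ^ 2 * (q ^ 2 + 1) - a * y = y * (y * (q ^ 2 + 1) - a) := by ring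
      _ ≤ y * ((S / q) * (q ^ 2 + 1) - a) := by gcongr
      _ ≤ _ := by
        refine mul_le_mul_of_nonneg_right hyq ?_
        linarith
  have h6 : (S / q) * ((S / q) * (q ^ 2 + 1) - a) + W / q
      = S ^ 2 + (S ^ 2 / q - 5 * W) / q := by
    have : (S / q) * ((S / q) * (q ^ 2 + 1) - a) + W / q
      = S ^ 2 + (S ^ 2 / q - a * S + W) / q := by field_simp; ring
    rw [this, haS]
    ring
  have h7 : S ^ 2 / q ≤ 5 * W := by
    rw [div_le_iff₀ (by positivity)]
    have : a * S ^ 2 ≤ a * (5 * W * q) := by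
      calc a * S ^ 2 = 6 * W * S := by rw [← haS]; ring
        _ ≤ 6 * W * (3 / 4 * (a * q)) := by
          gcongr
          linarith
        _ ≤ a * (5 * W * q) := by
          have : 0 < W * a * q := by positivity
          linarith
    exact le_of_mul_le_mul_left this ha
  have h8 : (S ^ 2 / q - 5 * W) / q ≤ 0 :=
    div_nonpos_of_nonpos_of_nonneg (by linarith) (by positivity)
  linarith

theorem frankWolfe_fast_rate (ha : 0 < a) (haB : a ^ 2 ≤ B) (hE : 0 ≤ E) (hB : 0 < B)
    (h0 : ∀ t, 0 ≤ h t) (h1 : h 1 ≤ B)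
    (hstep : ∀ t, 1 ≤ t → t < n →
      h (t + 1) ≤ h t - h t / (t + 1) + E / (√t * (t + 1)) + B / (t + 1) ^ 2)
    (hstep' : ∀ t, 1 ≤ t → t < n →
      h (t + 1) ≤ h t - a * √(h t) / (t + 1) + E / (√t * (t + 1)) + B / (t + 1) ^ 2) :
    ∀ t, 1 ≤ t → t ≤ n → h t ≤ (6 * (E + B) / a) ^ 2 / t := by
  have hslow := frankWolfe_slow_rate hE hB h1 hstep
  intro t ht
  have hW : B ≤ E + B := by linarith
  generalize hWdef : E + B = W at *
  have hW0 : 0 < W := by linarith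
  set S := 6 * W / a with hS
  have haS : a * S = 6 * W := by rw [hS]; field_simp
  have hS0 : 0 < S := by positivity
  have hSa : 6 * a ≤ S := by
    rw [hS, le_div_iff₀ ha]
    nlinarith
  induction t, ht using Nat.le_induction with
  | base =>
    intro _
    simp only [Nat.cast_one, div_one]
    nlinarith
  | succ t ht ih =>
    intro hn
    have ih := ih (by omega)
    have hs := hstep' t ht (by omega)
    have hsl := hslow (t + 1) (by omega) hn
    have ht1 : (1 : ℝ) ≤ t := by exact_mod_cast ht
    push_cast at hsl ⊢
    set q := √(t : ℝ) with hq
    set r := √((t : ℝ) + 1) with hr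
    have hq1 : 1 ≤ q := by rw [hq, Real.one_le_sqrt]; exact ht1
    have hqq : q ^ 2 = t := Real.sq_sqrt (by positivity)
    have hrr : r * r = t + 1 := Real.mul_self_sqrt (by positivity)
    have hrq : r ≤ 1.5 * q := sqrt_succ_bounds ht
    have hr0 : 0 ≤ r := Real.sqrt_nonneg _
    rw [le_div_iff₀ (by positivity)]
    -- For small `t` the slow rate already gives `3 W √(t+1) ≤ S²`, because `a S = 6 W`. For larger
    -- `t`, `√(t+1) ≤ 1.5 √t` yields the lower bound on `q` required by `fast_rate_step`.
    by_cases hcase : a * r ≤ 2 * S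
    · have : 3 * W * r ≤ S ^ 2 := by
        have : a * (3 * W * r) ≤ a * S ^ 2 := by nlinarith
        exact le_of_mul_le_mul_left this ha
      linarith
    · push Not at hcase
      have hqS : 4 / 3 * S ≤ a * q := by nlinarith
      set y := √(h t) with hy
      have hyy : y ^ 2 = h t := Real.sq_sqrt (h0 t)
      have hy0 : 0 ≤ y := Real.sqrt_nonneg _
      have hyS : y * q ≤ S := by
        rw [le_div_iff₀ (by positivity), ← hqq, ← hyy, ← mul_pow] at ih
        exact (pow_le_pow_iff_left₀ (by positivity) hS0.le two_ne_zero).1 ih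
      have hWb : E / (q * ((t : ℝ) + 1)) + B / ((t : ℝ) + 1) ^ 2 ≤ W / (q * (t + 1)) := by
        rw [← hWdef, add_div]
        gcongr
        rw [sq]
        gcongr
        nlinarith
      have h2 : h (t + 1) * (t + 1) ≤ (y ^ 2 - a * y / (t + 1) + W / (q * (t + 1))) * (t + 1) := by
        rw [hyy]
        gcongr
        linarith
      refine h2.trans ?_
      have e1 : (y ^ 2 - a * y / (t + 1) + W / (q * (t + 1))) * ((t : ℝ) + 1)
          = y ^ 2 * (q ^ 2 + 1) - a * y + W / q := by
        rw [hqq]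
        field_simp
      rw [e1]
      exact fast_rate_step ha hW0 (by linarith) (by linarith) hy0 hyS haS (by linarith) hqS

end Rate

/-! ### Monotone Lipschitz links and their primitives -/

section Scalar

/-- The function `ζ` extended from `[-c, c]` by constants. -/
def clamp (ζ : ℝ → ℝ) (c s : ℝ) : ℝ := ζ (max (-c) (min c s))

theorem clamp_of_abs_le {ζ : ℝ → ℝ} {c s : ℝ} (h : |s| ≤ c) : clamp ζ c s = ζ s := by
  obtain ⟨h1, h2⟩ := abs_le.1 h
  rw [clamp, min_eq_right h2, max_eq_right h1]

section Clamp

variable {ζ : ℝ → ℝ} {c m β : ℝ}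

theorem link_mean_value (hd : ∀ s : ℝ, |s| ≤ c → DifferentiableAt ℝ ζ s)
    (hl : ∀ s : ℝ, |s| ≤ c → m ≤ deriv ζ s) (hu : ∀ s : ℝ, |s| ≤ c → deriv ζ s ≤ β)
    {s s' : ℝ} (hs : |s| ≤ c) (hs' : |s'| ≤ c) (h : s ≤ s') :
    m * (s' - s) ≤ ζ s' - ζ s ∧ ζ s' - ζ s ≤ β * (s' - s) := by
  have hI : ∀ x ∈ Set.Icc (-c) c, |x| ≤ c := fun x hx => abs_le.2 hx
  have hcont : ContinuousOn ζ (Set.Icc (-c) c) := fun x hx =>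
    (hd x (hI x hx)).continuousAt.continuousWithinAt
  have hdiff : DifferentiableOn ℝ ζ (interior (Set.Icc (-c) c)) := fun x hx =>
    (hd x (hI x (interior_subset hx))).differentiableWithinAt
  exact ⟨(convex_Icc (-c) c).mul_sub_le_image_sub_of_le_deriv hcont hdiff
      (fun x hx => hl x (hI x (interior_subset hx))) s (abs_le.1 hs) s' (abs_le.1 hs') h,
    (convex_Icc (-c) c).image_sub_le_mul_sub_of_deriv_le hcont hdiff
      (fun x hx => hu x (hI x (interior_subset hx))) s (abs_le.1 hs) s' (abs_le.1 hs') h⟩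

theorem abs_clamped_le (hc : 0 ≤ c) (s : ℝ) : |max (-c) (min c s)| ≤ c :=
  abs_le.2 ⟨le_max_left _ _, max_le (by linarith) (min_le_left _ _)⟩

/-- The link is controlled on `[-c, c]` only. Its clamped version is monotone and Lipschitz on the
whole line and agrees with it at every `x ⬝ᵥ θ` that occurs, so the convexity estimates below need
no domain restriction. -/
theorem clamp_monotone (hc : 0 ≤ c) (hm : 0 ≤ m)
    (hd : ∀ s : ℝ, |s| ≤ c → DifferentiableAt ℝ ζ s)
    (hl : ∀ s : ℝ, |s| ≤ c → m ≤ deriv ζ s) (hu : ∀ s : ℝ, |s| ≤ c → deriv ζ s ≤ β) :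
    Monotone (clamp ζ c) := by
  intro s s' h
  have h1 : max (-c) (min c s) ≤ max (-c) (min c s') := by gcongr
  have h2 := (link_mean_value hd hl hu (abs_clamped_le hc s) (abs_clamped_le hc s') h1).1
  have h3 := mul_nonneg hm (sub_nonneg.2 h1)
  simp only [clamp]
  linarith

theorem clamp_lipschitz (hc : 0 ≤ c) (hm : 0 ≤ m) (hβ : 0 ≤ β)
    (hd : ∀ s : ℝ, |s| ≤ c → DifferentiableAt ℝ ζ s)
    (hl : ∀ s : ℝ, |s| ≤ c → m ≤ deriv ζ s) (hu : ∀ s : ℝ, |s| ≤ c → deriv ζ s ≤ β)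
    (s s' : ℝ) : |clamp ζ c s - clamp ζ c s'| ≤ β * |s - s'| := by
  wlog h : s' ≤ s generalizing s s'
  · rw [abs_sub_comm, abs_sub_comm s s']
    exact this s' s (by linarith)
  have hmono := clamp_monotone hc hm hd hl hu h
  have h1 : max (-c) (min c s') ≤ max (-c) (min c s) := by gcongr
  have h2 := (link_mean_value hd hl hu (abs_clamped_le hc s') (abs_clamped_le hc s) h1).2
  rw [abs_of_nonneg (by linarith), abs_of_nonneg (by linarith)]
  refine h2.trans (mul_le_mul_of_nonneg_left ?_ hβ)
  have h3 := abs_max_sub_max_le_abs (-c) (min c s) (min c s')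
  grind

theorem link_strongly_monotone
    (hd : ∀ s : ℝ, |s| ≤ c → DifferentiableAt ℝ ζ s)
    (hl : ∀ s : ℝ, |s| ≤ c → m ≤ deriv ζ s) (hu : ∀ s : ℝ, |s| ≤ c → deriv ζ s ≤ β)
    {s s' : ℝ} (hs : |s| ≤ c) (hs' : |s'| ≤ c) :
    m * (s - s') ^ 2 ≤ (ζ s - ζ s') * (s - s') := by
  rcases le_total s s' with h | h
  · have := (link_mean_value hd hl hu hs hs' h).1
    nlinarith
  · have := (link_mean_value hd hl hu hs' hs h).1
    nlinarith

end Clamp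

variable {z : ℝ → ℝ} {β : ℝ}

/-- The tangent inequality: a primitive of a monotone function is convex. -/
theorem mul_sub_le_primitive (hc : Continuous z) (hm : Monotone z) (s s' : ℝ) :
    z s * (s' - s) ≤ (∫ y in (0 : ℝ)..s', z y) - ∫ y in (0 : ℝ)..s, z y := by
  have hi : ∀ a b, IntervalIntegrable z volume a b := fun a b => hc.intervalIntegrable a b
  rw [intervalIntegral.integral_interval_sub_left (hi _ _) (hi _ _)]
  rcases le_total s s' with h | h
  · have := intervalIntegral.integral_mono_on h (intervalIntegrable_const (c := z s)) (hi s s')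
      fun x hx => hm hx.1
    rw [intervalIntegral.integral_const, smul_eq_mul] at this
    linarith
  · have := intervalIntegral.integral_mono_on h (hi s' s) (intervalIntegrable_const (c := z s))
      fun x hx => hm hx.2
    rw [intervalIntegral.integral_const, smul_eq_mul] at this
    rw [intervalIntegral.integral_symm]
    linarith

/-- The Bregman divergence of the primitive of `z`. -/
noncomputable def bregman (z : ℝ → ℝ) (s s' : ℝ) : ℝ :=
  ((∫ y in (0 : ℝ)..s, z y) - ∫ y in (0 : ℝ)..s', z y) - z s' * (s - s')

theorem bregman_nonneg (hc : Continuous z) (hm : Monotone z) (s s' : ℝ) : 0 ≤ bregman z s s' :=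
  sub_nonneg.2 (mul_sub_le_primitive hc hm s' s)

theorem bregman_le (hc : Continuous z) (hm : Monotone z) (s s' : ℝ) :
    bregman z s s' ≤ (z s - z s') * (s - s') := by
  have := mul_sub_le_primitive hc hm s s'
  rw [bregman]
  linarith

theorem bregman_sub_le (hc : Continuous z) (hm : Monotone z)
    (hL : ∀ s s', |z s - z s'| ≤ β * |s - s'|) (s₁ s s' : ℝ) :
    bregman z s₁ s' ≤ bregman z s s' + (z s - z s') * (s₁ - s) + β * (s₁ - s) ^ 2 := by
  have h1 := mul_sub_le_primitive hc hm s₁ s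
  have h2 : (z s₁ - z s) * (s₁ - s) ≤ β * (s₁ - s) ^ 2 := by
    refine (le_abs_self _).trans ?_
    rw [abs_mul, ← sq_abs (s₁ - s), sq, ← mul_assoc]
    exact mul_le_mul_of_nonneg_right (hL _ _) (abs_nonneg _)
  rw [bregman, bregman]
  linarith

/-- Cocoercivity of a smooth convex function: a gradient step from `s` cannot bring the tilted
primitive below its minimum at `s'`. -/
theorem sq_le_bregman (hβ : 0 < β) (hc : Continuous z) (hm : Monotone z)
    (hL : ∀ s s', |z s - z s'| ≤ β * |s - s'|) (s s' : ℝ) :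
    (z s - z s') ^ 2 ≤ 4 * β * bregman z s s' := by
  set e := z s - z s' with he
  -- Half the usual step `e / β`, so that the Lipschitz bound keeps `z y - z s'` on the side of `e`
  -- with at least half its size.
  set y := s - e / (2 * β) with hy
  have h1 := mul_sub_le_primitive hc hm y s
  have h2 := mul_sub_le_primitive hc hm s' y
  have h3 : |z s - z y| ≤ |e| / 2 := by
    refine (hL s y).trans (le_of_eq ?_)
    rw [hy, sub_sub_cancel, abs_div, abs_of_pos (by positivity : 0 < 2 * β)]
    field_simp
  have h4 : s - y = e / (2 * β) := by rw [hy]; ring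
  have h5 : (z s - z y) * e ≤ e ^ 2 / 2 := by
    refine (le_abs_self _).trans ?_
    rw [abs_mul, ← sq_abs e, sq]
    nlinarith [abs_nonneg e]
  have h6 : (z y - z s') * (s - y) ≤ bregman z s s' := by
    rw [bregman]
    linarith
  rw [h4] at h6
  have h7 : e ^ 2 / 2 ≤ (z y - z s') * e := by
    have : (z y - z s') * e = e ^ 2 - (z s - z y) * e := by rw [he]; ring
    linarith
  have h8 : 2 * β * ((z y - z s') * (e / (2 * β))) = (z y - z s') * e := by
    field_simp
  nlinarith

theorem bregman_continuous (hc : Continuous z) : Continuous fun p : ℝ × ℝ => bregman z p.1 p.2 := by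
  have h1 : Continuous fun s : ℝ => ∫ y in (0 : ℝ)..s, z y :=
    intervalIntegral.continuous_primitive (fun a b => hc.intervalIntegrable a b) 0
  unfold bregman
  fun_prop

end Scalar

/-! ### The `ℓ₁` norm -/

section L1

variable {d : ℕ}

theorem l1_nonneg (x : Fin d → ℝ) : 0 ≤ l1 x := Finset.sum_nonneg fun _ _ => abs_nonneg _

theorem l1_smul (a : ℝ) (x : Fin d → ℝ) : l1 (a • x) = |a| * l1 x := by
  simp [l1, abs_mul, Finset.mul_sum]

theorem continuous_l1 : Continuous (l1 : (Fin d → ℝ) → ℝ) := by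
  unfold l1
  fun_prop

theorem abs_dotProduct_le (x w : Fin d → ℝ) : |x ⬝ᵥ w| ≤ ‖x‖ * l1 w := by
  rw [l1, Finset.mul_sum]
  refine (Finset.abs_sum_le_sum_abs _ _).trans (Finset.sum_le_sum fun j _ => ?_)
  rw [abs_mul]
  exact mul_le_mul_of_nonneg_right (norm_le_pi_norm x j) (abs_nonneg _)

theorem sq_dotProduct_le (x w : Fin d → ℝ) : (x ⬝ᵥ w) ^ 2 ≤ (x ⬝ᵥ x) * (w ⬝ᵥ w) := by
  simpa only [dotProduct, sq] using Finset.sum_mul_sq_le_sq_mul_sq Finset.univ x w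

theorem dotProduct_self_nonneg (x : Fin d → ℝ) : 0 ≤ x ⬝ᵥ x :=
  Finset.sum_nonneg fun _ _ => mul_self_nonneg _

end L1

/-! ### The excess risk under the context law -/

section Population

variable {d : ℕ} {μ : Measure (Fin d → ℝ)} {M β c m : ℝ} {z : ℝ → ℝ}

theorem integrable_of_continuous_of_ae_norm_le [IsFiniteMeasure μ] (hM : ∀ᵐ x ∂μ, ‖x‖ ≤ M)
    {f : (Fin d → ℝ) → ℝ} (hf : Continuous f) : Integrable f μ := by
  obtain ⟨C, hC⟩ := (isCompact_closedBall (0 : Fin d → ℝ) M).exists_bound_of_continuousOn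
    hf.continuousOn
  refine Integrable.of_bound hf.aestronglyMeasurable C ?_
  filter_upwards [hM] with x hx
  exact hC x (by simpa using hx)

/-- The gradient in `θ` of the population risk with link `z` and true parameter `θs`. -/
noncomputable def riskGrad (z : ℝ → ℝ) (μ : Measure (Fin d → ℝ)) (θs θ : Fin d → ℝ) :
    Fin d → ℝ :=
  fun j => ∫ x, (z (x ⬝ᵥ θ) - z (x ⬝ᵥ θs)) * x j ∂μ

/-- The excess population risk with link `z` and true parameter `θs`. -/
noncomputable def excess (z : ℝ → ℝ) (μ : Measure (Fin d → ℝ)) (θs θ : Fin d → ℝ) : ℝ :=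
  ∫ x, bregman z (x ⬝ᵥ θ) (x ⬝ᵥ θs) ∂μ

theorem continuous_dotProduct_left (w : Fin d → ℝ) : Continuous fun x : Fin d → ℝ => x ⬝ᵥ w := by
  unfold dotProduct
  fun_prop

theorem continuous_bregman_dotProduct (hc : Continuous z) (θ θs : Fin d → ℝ) :
    Continuous fun x : Fin d → ℝ => bregman z (x ⬝ᵥ θ) (x ⬝ᵥ θs) :=
  (bregman_continuous hc).comp
    ((continuous_dotProduct_left θ).prodMk (continuous_dotProduct_left θs))

theorem continuous_link_sub (hc : Continuous z) (θ θs : Fin d → ℝ) :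
    Continuous fun x : Fin d → ℝ => z (x ⬝ᵥ θ) - z (x ⬝ᵥ θs) :=
  (hc.comp (continuous_dotProduct_left θ)).sub (hc.comp (continuous_dotProduct_left θs))

theorem excess_nonneg (hc : Continuous z) (hm : Monotone z) (θs θ : Fin d → ℝ) :
    0 ≤ excess z μ θs θ := integral_nonneg fun _ => bregman_nonneg hc hm _ _

variable [IsProbabilityMeasure μ]

theorem riskGrad_dotProduct (hM : ∀ᵐ x ∂μ, ‖x‖ ≤ M) (hc : Continuous z) (θs θ w : Fin d → ℝ) :
    riskGrad z μ θs θ ⬝ᵥ w = ∫ x, (z (x ⬝ᵥ θ) - z (x ⬝ᵥ θs)) * (x ⬝ᵥ w) ∂μ := by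
  simp only [riskGrad, dotProduct, Finset.mul_sum]
  rw [integral_finsetSum]
  · refine Finset.sum_congr rfl fun j _ => ?_
    rw [← integral_mul_const]
    refine integral_congr_ae (Filter.Eventually.of_forall fun x => ?_)
    simp only
    ring
  · intro j _
    refine integrable_of_continuous_of_ae_norm_le hM ?_
    exact (continuous_link_sub hc θ θs).mul ((continuous_apply j).mul continuous_const)

theorem excess_le_riskGrad (hM : ∀ᵐ x ∂μ, ‖x‖ ≤ M) (hc : Continuous z) (hm : Monotone z)
    (θs θ : Fin d → ℝ) : excess z μ θs θ ≤ riskGrad z μ θs θ ⬝ᵥ (θ - θs) := by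
  rw [riskGrad_dotProduct hM hc]
  refine integral_mono
    (integrable_of_continuous_of_ae_norm_le hM (continuous_bregman_dotProduct hc _ _))
    (integrable_of_continuous_of_ae_norm_le hM
      ((continuous_link_sub hc _ _).mul (continuous_dotProduct_left _))) fun x => ?_
  simp only [dotProduct_sub]
  exact bregman_le hc hm _ _

/-- The descent lemma in `ℓ₁` geometry, obtained by integrating `bregman_sub_le` and using `|xᵀw| ≤
M ‖w‖₁`. -/
theorem excess_le_add (hβ : 0 ≤ β) (hM : ∀ᵐ x ∂μ, ‖x‖ ≤ M) (hc : Continuous z)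
    (hm : Monotone z) (hL : ∀ s s', |z s - z s'| ≤ β * |s - s'|) (θs θ θ' : Fin d → ℝ) :
    excess z μ θs θ' ≤ excess z μ θs θ + riskGrad z μ θs θ ⬝ᵥ (θ' - θ)
      + β * (M * l1 (θ' - θ)) ^ 2 := by
  have i1 := integrable_of_continuous_of_ae_norm_le hM (continuous_bregman_dotProduct hc θ' θs)
  have i2 := integrable_of_continuous_of_ae_norm_le hM (continuous_bregman_dotProduct hc θ θs)
  have i3 : Integrable
      (fun x : Fin d → ℝ => (z (x ⬝ᵥ θ) - z (x ⬝ᵥ θs)) * (x ⬝ᵥ (θ' - θ))) μ :=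
    integrable_of_continuous_of_ae_norm_le hM
      ((continuous_link_sub hc θ θs).mul (continuous_dotProduct_left (θ' - θ)))
  have i4 : Integrable (fun _ : Fin d → ℝ => β * (M * l1 (θ' - θ)) ^ 2) μ := integrable_const _
  rw [riskGrad_dotProduct hM hc]
  have e : β * (M * l1 (θ' - θ)) ^ 2 = ∫ _ : Fin d → ℝ, β * (M * l1 (θ' - θ)) ^ 2 ∂μ := by simp
  rw [e, excess, excess, ← integral_add i2 i3, ← integral_add (by exact i2.add i3) i4]
  refine integral_mono_ae i1 ((i2.add i3).add i4) ?_
  filter_upwards [hM] with x hx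
  have h1 := bregman_sub_le hc hm hL (x ⬝ᵥ θ') (x ⬝ᵥ θ) (x ⬝ᵥ θs)
  rw [← dotProduct_sub] at h1
  have h2 : (x ⬝ᵥ (θ' - θ)) ^ 2 ≤ (M * l1 (θ' - θ)) ^ 2 := by
    rw [← sq_abs]
    refine pow_le_pow_left₀ (abs_nonneg _) ((abs_dotProduct_le _ _).trans ?_) 2
    exact mul_le_mul_of_nonneg_right hx (l1_nonneg _)
  have h3 := mul_le_mul_of_nonneg_left h2 hβ
  linarith

theorem excess_le_sq (hβ : 0 ≤ β) (hM : ∀ᵐ x ∂μ, ‖x‖ ≤ M) (hc : Continuous z)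
    (hm : Monotone z) (hL : ∀ s s', |z s - z s'| ≤ β * |s - s'|) (θs θ : Fin d → ℝ) :
    excess z μ θs θ ≤ β * (M * l1 (θ - θs)) ^ 2 := by
  have h := excess_le_add hβ hM hc hm hL θs θs θ
  have h1 : riskGrad z μ θs θs = 0 := by ext j; simp [riskGrad]
  have h2 : excess z μ θs θs = 0 := by simp [excess, bregman]
  simpa [h1, h2] using h

theorem integral_sq_link_sub_le (hβ : 0 < β) (hM : ∀ᵐ x ∂μ, ‖x‖ ≤ M) (hc : Continuous z)
    (hm : Monotone z) (hL : ∀ s s', |z s - z s'| ≤ β * |s - s'|) (θs θ : Fin d → ℝ) :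
    ∫ x, (z (x ⬝ᵥ θ) - z (x ⬝ᵥ θs)) ^ 2 ∂μ ≤ 4 * β * excess z μ θs θ := by
  rw [excess, ← integral_const_mul]
  refine integral_mono
    (integrable_of_continuous_of_ae_norm_le hM ((continuous_link_sub hc _ _).pow 2))
    ((integrable_of_continuous_of_ae_norm_le hM
      (continuous_bregman_dotProduct hc _ _)).const_mul _) fun x => ?_
  exact sq_le_bregman hβ hc hm hL _ _

theorem integral_abs_link_sub_le (hβ : 0 < β) (hM : ∀ᵐ x ∂μ, ‖x‖ ≤ M) (hc : Continuous z)
    (hm : Monotone z) (hL : ∀ s s', |z s - z s'| ≤ β * |s - s'|) (θs θ : Fin d → ℝ) :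
    ∫ x, |z (x ⬝ᵥ θ) - z (x ⬝ᵥ θs)| ∂μ ≤ √(4 * β * excess z μ θs θ) := by
  have h1 := integral_sq_link_sub_le hβ hM hc hm hL θs θ
  set f : (Fin d → ℝ) → ℝ := fun x => z (x ⬝ᵥ θ) - z (x ⬝ᵥ θs) with hf
  have hcont : Continuous f := continuous_link_sub hc θ θs
  set A := ∫ x, |f x| ∂μ with hA
  have i1 := integrable_of_continuous_of_ae_norm_le hM hcont.abs
  have i2 : Integrable (fun x => f x ^ 2) μ :=
    integrable_of_continuous_of_ae_norm_le hM (hcont.pow 2)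
  have i3 : Integrable (fun x => 2 * A * |f x|) μ := i1.const_mul _
  have i4 : Integrable (fun _ : Fin d → ℝ => A ^ 2) μ := integrable_const _
  -- Nonnegativity of the variance of `|f|`, which gives `A² ≤ ∫ f²`.
  have h2 : 0 ≤ ∫ x, (f x ^ 2 - (2 * A * |f x| - A ^ 2)) ∂μ := by
    refine integral_nonneg fun x => ?_
    have : f x ^ 2 - (2 * A * |f x| - A ^ 2) = (|f x| - A) ^ 2 := by
      rw [sub_sq (|f x|), sq_abs]
      ring
    simp only [this]
    positivity
  rw [integral_sub i2 (by exact i3.sub i4), integral_sub i3 i4, integral_const_mul] at h2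
  simp only [integral_const, probReal_univ, one_smul] at h2
  refine Real.le_sqrt_of_sq_le ?_
  rw [← hA] at h2
  linarith

theorem mul_integral_sq_le_riskGrad (hM : ∀ᵐ x ∂μ, ‖x‖ ≤ M) (hc : Continuous z)
    {θs θ : Fin d → ℝ}
    (hs : ∀ᵐ x ∂μ, m * (x ⬝ᵥ θ - x ⬝ᵥ θs) ^ 2
      ≤ (z (x ⬝ᵥ θ) - z (x ⬝ᵥ θs)) * (x ⬝ᵥ θ - x ⬝ᵥ θs)) :
    m * ∫ x, (x ⬝ᵥ (θ - θs)) ^ 2 ∂μ ≤ riskGrad z μ θs θ ⬝ᵥ (θ - θs) := by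
  rw [riskGrad_dotProduct hM hc, ← integral_const_mul]
  refine integral_mono_ae ((integrable_of_continuous_of_ae_norm_le hM
      ((continuous_dotProduct_left _).pow 2)).const_mul _)
    (integrable_of_continuous_of_ae_norm_le hM
      ((continuous_link_sub hc _ _).mul (continuous_dotProduct_left _))) ?_
  filter_upwards [hs] with x hx
  simpa only [dotProduct_sub] using hx

end Population

/-! ### One noisy Frank-Wolfe step -/

section Step

variable {d : ℕ}

theorem dotProduct_sub_le_of_mem_convexHull {V : Set (Fin d → ℝ)} {g v : Fin d → ℝ} {e : ℝ}
    (h : ∀ w ∈ V, g ⬝ᵥ (v - w) ≤ e) {w : Fin d → ℝ} (hw : w ∈ convexHull ℝ V) :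
    g ⬝ᵥ (v - w) ≤ e := by
  have hconv : Convex ℝ {w : Fin d → ℝ | g ⬝ᵥ v - e ≤ g ⬝ᵥ w} := by
    intro x hx y hy a b ha hb hab
    simp only [Set.mem_ofPred_eq, dotProduct_add, dotProduct_smul, smul_eq_mul] at hx hy ⊢
    calc g ⬝ᵥ v - e = a * (g ⬝ᵥ v - e) + b * (g ⬝ᵥ v - e) := by rw [← add_mul, hab, one_mul]
      _ ≤ _ := by gcongr
  have hsub : V ⊆ {w : Fin d → ℝ | g ⬝ᵥ v - e ≤ g ⬝ᵥ w} := fun w hw => by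
    have := h w hw
    rw [dotProduct_sub] at this
    simp only [Set.mem_ofPred_eq]
    linarith
  have h1 := convexHull_min hsub hconv hw
  simp only [Set.mem_ofPred_eq] at h1
  rw [dotProduct_sub]
  linarith

/-- Against a vertex, replacing `g'` by `g` costs `D e₁` by Hölder, and the noise enters twice.
Linearity extends the bound to the convex hull. -/
theorem noisy_argmin_gap {V : Finset (Fin d → ℝ)} {D e₁ e₂ : ℝ}
    (hD : ∀ θ ∈ convexHull ℝ (V : Set (Fin d → ℝ)), ∀ θ' ∈ convexHull ℝ (V : Set (Fin d → ℝ)),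
      l1 (θ - θ') ≤ D)
    {g g' : Fin d → ℝ} (hg : ‖g' - g‖ ≤ e₁) {N : V → ℝ} (hN : ∀ w, |N w| ≤ e₂) {v : V}
    (hv : ∀ w : V, g' ⬝ᵥ (v : Fin d → ℝ) + N v ≤ g' ⬝ᵥ (w : Fin d → ℝ) + N w)
    {w : Fin d → ℝ} (hw : w ∈ convexHull ℝ (V : Set (Fin d → ℝ))) :
    g ⬝ᵥ ((v : Fin d → ℝ) - w) ≤ D * e₁ + 2 * e₂ := by
  refine dotProduct_sub_le_of_mem_convexHull (fun w hw => ?_) hw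
  have h1 := hv ⟨w, hw⟩
  have h2 := abs_le.1 (hN v)
  have h3 := abs_le.1 (hN ⟨w, hw⟩)
  have h4 : (g - g') ⬝ᵥ ((v : Fin d → ℝ) - w) ≤ D * e₁ := by
    refine (le_abs_self _).trans ((abs_dotProduct_le _ _).trans ?_)
    rw [norm_sub_rev, mul_comm]
    exact mul_le_mul (hD _ (subset_convexHull ℝ _ v.2) _ (subset_convexHull ℝ _ hw)) hg
      (norm_nonneg _) ((l1_nonneg _).trans
        (hD _ (subset_convexHull ℝ _ v.2) _ (subset_convexHull ℝ _ hw)))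
  rw [sub_dotProduct] at h4
  simp only [dotProduct_sub] at h4 ⊢
  linarith

/-- Near-minimality over a convex body whose Euclidean `γ`-ball about `θs` is contained in it. -/
theorem interior_gap {V : Set (Fin d → ℝ)} {g v θs : Fin d → ℝ} {e γ : ℝ}
    (hint : ∀ w : Fin d → ℝ, (w - θs) ⬝ᵥ (w - θs) ≤ γ ^ 2 → w ∈ V)
    (h : ∀ w ∈ V, g ⬝ᵥ (v - w) ≤ e) (θ : Fin d → ℝ) :
    g ⬝ᵥ (v - θ) ≤ e - g ⬝ᵥ (θ - θs) - γ * √(g ⬝ᵥ g) := by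
  set G := √(g ⬝ᵥ g) with hG
  have hgg : 0 ≤ g ⬝ᵥ g := dotProduct_self_nonneg g
  have hG2 : G ^ 2 = g ⬝ᵥ g := Real.sq_sqrt hgg
  -- The point of the `γ`-ball furthest along `-g`. If `g = 0`, then `γ / 0 = 0` and the point is
  -- `θs` itself.
  have h1 := h (θs - (γ / G) • g) (hint _ (by
    rw [sub_sub_cancel_left, neg_dotProduct_neg, smul_dotProduct, dotProduct_smul, smul_eq_mul,
      smul_eq_mul, ← hG2]
    rcases eq_or_ne G 0 with h0 | h0
    · rw [h0]
      simp [sq_nonneg]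
    · refine le_of_eq ?_
      field_simp))
  simp only [dotProduct_sub, dotProduct_smul, smul_eq_mul, ← hG2] at h1 ⊢
  have h2 : γ / G * G ^ 2 = γ * G := by
    rcases eq_or_ne G 0 with h0 | h0
    · rw [h0]
      simp
    · field_simp
  linarith

/-- Cauchy-Schwarz. With `g` the risk gradient and `w = θ - θs` this is a Polyak-Łojasiewicz
inequality; it makes the gain `γ ‖g‖₂` of `interior_gap` at least `γ √(σ h)`. -/
theorem strongly_convex_grad {g w : Fin d → ℝ} {σ : ℝ} (hσ : 0 ≤ σ)
    (h : σ * (w ⬝ᵥ w) ≤ g ⬝ᵥ w) : σ * (g ⬝ᵥ w) ≤ g ⬝ᵥ g := by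
  have h1 := sq_dotProduct_le g w
  have hgg : 0 ≤ g ⬝ᵥ g := dotProduct_self_nonneg g
  have hww : 0 ≤ w ⬝ᵥ w := dotProduct_self_nonneg w
  have hp : 0 ≤ g ⬝ᵥ w := (mul_nonneg hσ hww).trans h
  rcases hp.eq_or_lt with h0 | h0
  · rw [← h0, mul_zero]
    exact hgg
  · refine le_of_mul_le_mul_right ?_ h0
    nlinarith

end Step

/-! ### Frank-Wolfe iterates -/

section Iterates

variable {d : ℕ} {p : Fin d → ℝ} {v : ℕ → Fin d → ℝ} {V : Set (Fin d → ℝ)}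

theorem iterate_succ {t : ℕ} (ht : 1 ≤ t) :
    iterate p v (t + 1) = iterate p v t + (1 / ((t : ℝ) + 1)) • (v t - iterate p v t) := by
  obtain ⟨t, rfl⟩ := Nat.exists_eq_add_of_le' ht
  rw [iterate]

theorem iterate_mem (hV : Convex ℝ V) (hp : p ∈ V) (hv : ∀ t, v t ∈ V) (t : ℕ) :
    iterate p v t ∈ V := by
  induction t with
  | zero => exact hp
  | succ t ih =>
    rcases Nat.eq_zero_or_pos t with rfl | ht
    · exact hp
    · rw [iterate_succ ht]
      refine hV.add_smul_sub_mem ih (hv t) ⟨by positivity, ?_⟩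
      rw [div_le_one (by positivity)]
      have : (0 : ℝ) ≤ t := by positivity
      linarith

/-- The move from step `t - 1` to step `t` uses `η_{t-1} = 1/t`; for `t = 1` nothing moves, since
`θ₀ = θ₁`. -/
theorem l1_iterate_sub_le {D : ℝ} (hV : Convex ℝ V) (hp : p ∈ V) (hv : ∀ t, v t ∈ V)
    (hD : ∀ θ ∈ V, ∀ θ' ∈ V, l1 (θ - θ') ≤ D) {t : ℕ} (ht : 1 ≤ t) :
    l1 (iterate p v t - iterate p v (t - 1)) ≤ D / t := by
  obtain ⟨t, rfl⟩ := Nat.exists_eq_add_of_le' ht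
  have hD0 : 0 ≤ D := (l1_nonneg _).trans (hD p hp p hp)
  rcases Nat.eq_zero_or_pos t with rfl | ht
  · simpa [iterate, l1] using hD0
  · rw [Nat.add_sub_cancel, iterate_succ ht, add_sub_cancel_left, l1_smul,
      abs_of_nonneg (by positivity)]
    push_cast
    rw [div_mul_eq_mul_div, one_mul]
    gcongr
    exact hD _ (hv t) _ (iterate_mem hV hp hv t)

/-- The recursion of the gradient estimators, unrolled. -/
theorem recGrad_step {ζ : ℝ → ℝ} {θ : ℕ → Fin d → ℝ} {z : ℕ → (Fin d → ℝ) × ℝ} {t : ℕ}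
    (ht : 2 ≤ t) (j : Fin d) :
    ((t : ℝ) + 1) * recGrad ζ θ z t j = t * recGrad ζ θ z (t - 1) j
      + (((t : ℝ) + 1) * glmGrad ζ (θ t) (z t) j - t * glmGrad ζ (θ (t - 1)) (z t) j) := by
  obtain ⟨t, rfl⟩ := Nat.exists_eq_add_of_le' ht
  rw [recGrad]
  simp only [Pi.add_apply, Pi.smul_apply, Pi.sub_apply, smul_eq_mul]
  have : (((t + 2 : ℕ) : ℝ) + 1) ≠ 0 := by positivity
  rw [show t + 2 - 1 = t + 1 from rfl]
  field_simp
  ring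

end Iterates

/-! ### Regions of the context space -/

section Regions

variable {d K : ℕ}

/-- The contexts at which arm `i` is the best one in `Kopt` for the parameters `Θ`. -/
def bestSet (Kopt : Finset (Fin K)) (i : Fin K) (Θ : Fin K → Fin d → ℝ) : Set (Fin d → ℝ) :=
  {x | ∀ k ∈ Kopt, x ⬝ᵥ Θ k ≤ x ⬝ᵥ Θ i}

/-- The contexts at which the gap between the two best arms in `Kopt` is at most `s`. -/
def gapSet (Kopt : Finset (Fin K)) (Θ : Fin K → Fin d → ℝ) (s : ℝ) : Set (Fin d → ℝ) :=
  {x | ∃ i ∈ Kopt, ∃ j ∈ Kopt, j ≠ i ∧ (∀ k ∈ Kopt, x ⬝ᵥ Θ k ≤ x ⬝ᵥ Θ i) ∧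
    x ⬝ᵥ Θ i - x ⬝ᵥ Θ j ≤ s}

theorem measurable_dotProduct_param (k : Fin K) :
    Measurable fun p : (Fin K → Fin d → ℝ) × (Fin d → ℝ) => p.2 ⬝ᵥ p.1 k := by
  unfold dotProduct
  fun_prop

theorem measurableSet_bestSet_prod (Kopt : Finset (Fin K)) (i : Fin K) :
    MeasurableSet {p : (Fin K → Fin d → ℝ) × (Fin d → ℝ) | p.2 ∈ bestSet Kopt i p.1} := by
  have : {p : (Fin K → Fin d → ℝ) × (Fin d → ℝ) | p.2 ∈ bestSet Kopt i p.1}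
      = ⋂ k ∈ Kopt, {p | p.2 ⬝ᵥ p.1 k ≤ p.2 ⬝ᵥ p.1 i} := by
    ext p
    simp [bestSet]
  rw [this]
  exact Finset.measurableSet_biInter _ fun k _ =>
    measurableSet_le (measurable_dotProduct_param k) (measurable_dotProduct_param i)

theorem measurableSet_bestSet (Kopt : Finset (Fin K)) (i : Fin K) (Θ : Fin K → Fin d → ℝ) :
    MeasurableSet (bestSet Kopt i Θ) :=
  measurable_prodMk_left (measurableSet_bestSet_prod Kopt i)

theorem measurableSet_gapSet_prod (Kopt : Finset (Fin K)) (s : ℝ) :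
    MeasurableSet {p : (Fin K → Fin d → ℝ) × (Fin d → ℝ) | p.2 ∈ gapSet Kopt p.1 s} := by
  have : {p : (Fin K → Fin d → ℝ) × (Fin d → ℝ) | p.2 ∈ gapSet Kopt p.1 s}
      = ⋃ i ∈ Kopt, ⋃ j ∈ Kopt, {p | j ≠ i} ∩ ({p | p.2 ∈ bestSet Kopt i p.1}
        ∩ {p | p.2 ⬝ᵥ p.1 i - p.2 ⬝ᵥ p.1 j ≤ s}) := by
    ext p
    simp only [bestSet, gapSet, Set.mem_iUnion, Set.mem_inter_iff, exists_prop, Set.mem_ofPred_eq]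
  rw [this]
  exact Finset.measurableSet_biUnion _ fun i _ => Finset.measurableSet_biUnion _ fun j _ =>
    (MeasurableSet.const _).inter ((measurableSet_bestSet_prod Kopt i).inter
      (measurableSet_le ((measurable_dotProduct_param i).sub (measurable_dotProduct_param j))
        measurable_const))

/-- The region where an arm is the best one changes only inside the margin. -/
theorem symmDiff_bestSet_subset_gapSet {Kopt : Finset (Fin K)} {i : Fin K} (hi : i ∈ Kopt)
    {Θ Θ' : Fin K → Fin d → ℝ} {x : Fin d → ℝ} {s : ℝ}
    (h : ∀ k ∈ Kopt, |x ⬝ᵥ Θ' k - x ⬝ᵥ Θ k| ≤ s)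
    (hx : ¬(x ∈ bestSet Kopt i Θ ↔ x ∈ bestSet Kopt i Θ')) :
    x ∈ gapSet Kopt Θ' (2 * s) := by
  -- Two scores whose order differs between `Θ` and `Θ'` are within `2 s` of each other. The best
  -- arm for `Θ'` in the gap is `i` in one case and a maximiser `k ≠ i` in the other.
  by_cases hx' : x ∈ bestSet Kopt i Θ'
  · have h1 : x ∉ bestSet Kopt i Θ := fun h1 => hx ⟨fun _ => hx', fun _ => h1⟩
    simp only [bestSet, Set.mem_ofPred_eq, not_forall, not_le] at h1
    obtain ⟨k, hk, hlt⟩ := h1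
    refine ⟨i, hi, k, hk, ?_, hx', ?_⟩
    · rintro rfl
      exact lt_irrefl _ hlt
    · have h2 := abs_le.1 (h i hi)
      have h3 := abs_le.1 (h k hk)
      linarith
  · have h1 : x ∈ bestSet Kopt i Θ := by
      by_contra h1
      exact hx ⟨fun h => absurd h h1, fun h => absurd h hx'⟩
    obtain ⟨k, hk, hmax⟩ := Kopt.exists_max_image (fun k => x ⬝ᵥ Θ' k) ⟨i, hi⟩
    refine ⟨k, hk, i, hi, ?_, hmax, ?_⟩
    · rintro rfl
      exact hx' hmax
    · have h2 := abs_le.1 (h i hi)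
      have h3 := abs_le.1 (h k hk)
      have h4 := h1 k hk
      linarith

end Regions

/-! ### Population gradients restricted to the region of an arm -/

section RegionGrad

variable {d K : ℕ} {μ : Measure (Fin d → ℝ)} {M β : ℝ} {z : ℝ → ℝ}

/-- The population gradient of an arm that is pulled at the contexts in `A`. -/
noncomputable def regionGrad (z : ℝ → ℝ) (μ : Measure (Fin d → ℝ)) (θs : Fin d → ℝ)
    (A : Set (Fin d → ℝ)) (θ : Fin d → ℝ) : Fin d → ℝ :=
  fun j => ∫ x, A.indicator (fun x => (z (x ⬝ᵥ θ) - z (x ⬝ᵥ θs)) * x j) x ∂μ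

theorem abs_link_sub_mul_le (hM0 : 0 ≤ M) (hβ : 0 ≤ β)
    (hL : ∀ s s', |z s - z s'| ≤ β * |s - s'|) {x : Fin d → ℝ} (hx : ‖x‖ ≤ M)
    (θ θs : Fin d → ℝ) (j : Fin d) :
    |(z (x ⬝ᵥ θ) - z (x ⬝ᵥ θs)) * x j| ≤ β * M ^ 2 * l1 (θ - θs) := by
  have h1 : |z (x ⬝ᵥ θ) - z (x ⬝ᵥ θs)| ≤ β * (M * l1 (θ - θs)) := by
    refine (hL _ _).trans (mul_le_mul_of_nonneg_left ?_ hβ)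
    rw [← dotProduct_sub]
    exact (abs_dotProduct_le _ _).trans (mul_le_mul_of_nonneg_right hx (l1_nonneg _))
  have h2 : |x j| ≤ M := (norm_le_pi_norm x j).trans hx
  rw [abs_mul]
  calc _ ≤ β * (M * l1 (θ - θs)) * M := mul_le_mul h1 h2 (abs_nonneg _)
        (mul_nonneg hβ (mul_nonneg hM0 (l1_nonneg _)))
    _ = _ := by ring

variable [IsProbabilityMeasure μ]

theorem integrable_link_sub_mul (hM : ∀ᵐ x ∂μ, ‖x‖ ≤ M) (hc : Continuous z)
    (θ θs : Fin d → ℝ) (j : Fin d) :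
    Integrable (fun x : Fin d → ℝ => (z (x ⬝ᵥ θ) - z (x ⬝ᵥ θs)) * x j) μ :=
  integrable_of_continuous_of_ae_norm_le hM
    ((continuous_link_sub hc θ θs).mul (continuous_apply j))

/-- The integrands differ only on the symmetric difference, and there the gradient is proportional
to the estimation error. This product structure puts `ν ‖θ - θ*‖₁` in the final bound. -/
theorem abs_regionGrad_sub_le (hM0 : 0 ≤ M) (hβ : 0 ≤ β) (hM : ∀ᵐ x ∂μ, ‖x‖ ≤ M)
    (hc : Continuous z) (hL : ∀ s s', |z s - z s'| ≤ β * |s - s'|)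
    {A A' : Set (Fin d → ℝ)} (hA : MeasurableSet A) (hA' : MeasurableSet A')
    (θ θs : Fin d → ℝ) (j : Fin d) :
    |regionGrad z μ θs A θ j - regionGrad z μ θs A' θ j|
      ≤ β * M ^ 2 * l1 (θ - θs) * μ.real {x | ¬(x ∈ A ↔ x ∈ A')} := by
  have hi := integrable_link_sub_mul hM hc θ θs j
  have hW : MeasurableSet {x | ¬(x ∈ A ↔ x ∈ A')} := (hA.mem.iff hA'.mem).not.setOf
  rw [regionGrad, regionGrad, ← integral_sub (hi.indicator hA) (hi.indicator hA'), mul_comm,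
    ← smul_eq_mul, ← integral_indicator_const _ hW, ← Real.norm_eq_abs]
  refine norm_integral_le_of_norm_le ((integrable_const _).indicator hW) ?_
  filter_upwards [hM] with x hx
  have h1 := abs_link_sub_mul_le hM0 hβ hL hx θ θs j
  by_cases h : x ∈ A <;> by_cases h' : x ∈ A' <;> simp [h, h', Set.indicator] <;>
    simpa [abs_mul] using h1

/-- Used at the switch to greedy play, where the complement of `A` need not be small: smallness
comes from the excess risk alone. -/
theorem abs_riskGrad_sub_regionGrad_le (hM0 : 0 ≤ M) (hβ : 0 < β) (hM : ∀ᵐ x ∂μ, ‖x‖ ≤ M)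
    (hc : Continuous z) (hm : Monotone z) (hL : ∀ s s', |z s - z s'| ≤ β * |s - s'|)
    {A : Set (Fin d → ℝ)} (hA : MeasurableSet A) (θ θs : Fin d → ℝ) (j : Fin d) :
    |riskGrad z μ θs θ j - regionGrad z μ θs A θ j| ≤ M * √(4 * β * excess z μ θs θ) := by
  have hi := integrable_link_sub_mul hM hc θ θs j
  refine le_trans ?_ (mul_le_mul_of_nonneg_left
    (integral_abs_link_sub_le hβ hM hc hm hL θs θ) hM0)
  rw [regionGrad, riskGrad, ← integral_sub hi (hi.indicator hA), ← integral_const_mul,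
    ← Real.norm_eq_abs]
  refine norm_integral_le_of_norm_le ((integrable_of_continuous_of_ae_norm_le hM
    (continuous_link_sub hc _ _).abs).const_mul _) ?_
  filter_upwards [hM] with x hx
  have h2 : |x j| ≤ M := (norm_le_pi_norm x j).trans hx
  by_cases h : x ∈ A
  · simp only [Set.indicator_of_mem h, sub_self, norm_zero]
    positivity
  · simp only [Set.indicator_of_notMem h, sub_zero, Real.norm_eq_abs, abs_mul]
    rw [mul_comm]
    gcongr

end RegionGrad

namespace GLMBandit

variable {d K : ℕ} {B : GLMBandit d K} {M D β c m : ℝ}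

theorem Bounded.ae_norm_le (hB : B.Bounded M D) : ∀ᵐ x ∂B.law, ‖x‖ ≤ M :=
  hB.mem_ctx.mono fun x hx => hB.ctx_le x hx

theorem Bounded.exists_ctx (hB : B.Bounded M D) : ∃ x, x ∈ B.ctx :=
  have := hB.prob
  hB.mem_ctx.exists

theorem Link.nonneg (hl : B.Link c m β) (hB : B.Bounded M D) (i : Fin K) : 0 ≤ c := by
  obtain ⟨x, hx⟩ := hB.exists_ctx
  exact (abs_nonneg _).trans (hl.range x hx _ (hB.param_mem i))

theorem Link.clamp_eq (hl : B.Link c m β) {x θ : Fin d → ℝ} (hx : x ∈ B.ctx) (hθ : θ ∈ B.body) :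
    clamp B.link c (x ⬝ᵥ θ) = B.link (x ⬝ᵥ θ) := clamp_of_abs_le (hl.range x hx θ hθ)

theorem Link.monotone (hl : B.Link c m β) (hc : 0 ≤ c) (hm : 0 ≤ m) :
    Monotone (clamp B.link c) := clamp_monotone hc hm hl.diff hl.lower hl.upper

theorem Link.lipschitz (hl : B.Link c m β) (hc : 0 ≤ c) (hm : 0 ≤ m) (hβ : 0 ≤ β) (s s' : ℝ) :
    |clamp B.link c s - clamp B.link c s'| ≤ β * |s - s'| :=
  clamp_lipschitz hc hm hβ hl.diff hl.lower hl.upper s s'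

theorem Link.continuous (hl : B.Link c m β) (hc : 0 ≤ c) (hm : 0 ≤ m) (hβ : 0 ≤ β) :
    Continuous (clamp B.link c) :=
  (LipschitzWith.of_dist_le_mul (K := ⟨β, hβ⟩) fun s s' => by
    simp only [Real.dist_eq]
    exact hl.lipschitz hc hm hβ s s').continuous

theorem Link.lower_le_upper (hl : B.Link c m β) (hc : 0 ≤ c) : m ≤ β :=
  (hl.lower 0 (by simpa using hc)).trans (hl.upper 0 (by simpa using hc))

theorem Eigenvalue.le_integral {Kopt : Finset (Fin K)} {h u lam : ℝ} (hB : B.Bounded M D)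
    (ho : B.OptimalArms Kopt h u) (hE : B.Eigenvalue Kopt h lam) (hu : 0 ≤ u) (hlam : 0 ≤ lam)
    {i : Fin K} (hi : i ∈ Kopt) (w : Fin d → ℝ) :
    u * lam * (w ⬝ᵥ w) ≤ ∫ x, (x ⬝ᵥ w) ^ 2 ∂B.law := by
  have := hB.prob
  have h1 := hE i hi w
  have hu1 : u < B.law.real (B.bestRegion h i) :=
    (ENNReal.ofReal_lt_iff_lt_toReal hu (measure_ne_top _ _)).1 (ho.opt_prob i hi)
  set U := B.bestRegion h i
  have hint : Integrable (fun x : Fin d → ℝ => (x ⬝ᵥ w) ^ 2) B.law :=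
    integrable_of_continuous_of_ae_norm_le hB.ae_norm_le ((continuous_dotProduct_left w).pow 2)
  rw [ProbabilityTheory.cond, integral_smul_measure, smul_eq_mul, ENNReal.toReal_inv] at h1
  change _ ≤ (B.law.real U)⁻¹ * _ at h1
  have h2 : ∫ x in U, (x ⬝ᵥ w) ^ 2 ∂B.law ≤ ∫ x, (x ⬝ᵥ w) ^ 2 ∂B.law :=
    setIntegral_le_integral hint (Filter.Eventually.of_forall fun x => sq_nonneg _)
  have hU : 0 < B.law.real U := hu.trans_lt hu1
  rw [← div_eq_inv_mul, le_div_iff₀ hU] at h1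
  have h3 : 0 ≤ lam * (w ⬝ᵥ w) := mul_nonneg hlam (dotProduct_self_nonneg w)
  have h4 := mul_le_mul_of_nonneg_left hu1.le h3
  linarith

theorem Bounded.dim_pos (hB : B.Bounded M D) (i : Fin K) : 0 < d := by
  have h1 : B.body.Nonempty := ⟨_, hB.param_mem i⟩
  rw [body, convexHull_nonempty_iff, Finset.coe_nonempty, ← Finset.card_pos] at h1
  have := hB.card_vert
  omega

/-- The condition `a² ≤ B` of `frankWolfe_fast_rate`. A coordinate vector of length `γ` stays in the
body, so its `ℓ₁` norm is at most `D`; testing the eigenvalue bound on it gives the inequality. -/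
theorem Interior.sq_mul_le {i : Fin K} {γ σ : ℝ} (hB : B.Bounded M D)
    (hI : B.Interior i γ) (hl : B.Link c m β) (hm : 0 ≤ m) (hM : 0 ≤ M)
    (hσ : ∀ w : Fin d → ℝ, σ * (w ⬝ᵥ w) ≤ m * ∫ x, (x ⬝ᵥ w) ^ 2 ∂B.law) :
    γ ^ 2 * σ ≤ β * (M * D) ^ 2 := by
  have := hB.prob
  have hc := hl.nonneg hB i
  set e : Fin d → ℝ := Pi.single ⟨0, hB.dim_pos i⟩ γ with he
  have hee : e ⬝ᵥ e = γ ^ 2 := by simp [he, sq]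
  have hmem : B.param i + e ∈ B.body := hI _ (by rw [add_sub_cancel_left, hee])
  have hle : l1 e ≤ D := by
    simpa using hB.diam_le _ hmem _ (hB.param_mem i)
  have h1 := hσ e
  rw [hee] at h1
  have h2 : ∫ x, (x ⬝ᵥ e) ^ 2 ∂B.law ≤ ∫ _, (M * D) ^ 2 ∂B.law := by
    refine integral_mono_ae (integrable_of_continuous_of_ae_norm_le hB.ae_norm_le
      ((continuous_dotProduct_left e).pow 2)) (integrable_const _) ?_
    filter_upwards [hB.ae_norm_le] with x hx
    rw [← sq_abs]
    refine pow_le_pow_left₀ (abs_nonneg _) ((abs_dotProduct_le _ _).trans ?_) 2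
    exact mul_le_mul hx hle (l1_nonneg _) hM
  simp only [integral_const, probReal_univ, one_smul] at h2
  calc γ ^ 2 * σ = σ * γ ^ 2 := mul_comm _ _
    _ ≤ m * (M * D) ^ 2 := h1.trans (mul_le_mul_of_nonneg_left h2 hm)
    _ ≤ _ := mul_le_mul_of_nonneg_right (hl.lower_le_upper hc) (sq_nonneg _)

/-- Rate of the noisy Frank-Wolfe iterates for the excess risk of arm `i`, when gradient errors
and noises are of order `1 / √t`. -/
theorem excess_iterate_le {i : Fin K} {γ σ e₁ e₂ : ℝ} (hB : B.Bounded M D)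
    (hI : B.Interior i γ) (hl : B.Link c m β) (hm : 0 < m) (hβ : 0 < β) (hM : 0 < M) (hD : 0 < D)
    (hγ : 0 < γ) (hσ0 : 0 < σ)
    (hσ : ∀ w : Fin d → ℝ, σ * (w ⬝ᵥ w) ≤ m * ∫ x, (x ⬝ᵥ w) ^ 2 ∂B.law)
    (he₁ : 0 ≤ e₁) (he₂ : 0 ≤ e₂) {p : Fin d → ℝ} (hp : p ∈ B.body) (v : ℕ → B.vert)
    (N : ℕ → B.vert → ℝ) (g : ℕ → Fin d → ℝ) {n : ℕ} (hn : 1 ≤ n)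
    (hN : ∀ t, 1 ≤ t → t < n → ∀ w, |N t w| ≤ e₂ / √t)
    (hg : ∀ t, 1 ≤ t → t < n → ‖g t - riskGrad (clamp B.link c) B.law (B.param i)
      (iterate p (fun k => (v k : Fin d → ℝ)) t)‖ ≤ e₁ / √t)
    (hv : ∀ t, 1 ≤ t → t < n → ∀ w : B.vert, g t ⬝ᵥ (v t : Fin d → ℝ) + N t (v t)
      ≤ g t ⬝ᵥ (w : Fin d → ℝ) + N t w) :
    excess (clamp B.link c) B.law (B.param i) (iterate p (fun k => (v k : Fin d → ℝ)) n)
      ≤ (6 * (D * e₁ + 2 * e₂ + β * (M * D) ^ 2) / (γ * √σ)) ^ 2 / n := by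
  have := hB.prob
  have hc := hl.nonneg hB i
  have hMae := hB.ae_norm_le
  set z := clamp B.link c with hz
  have hzc : Continuous z := hl.continuous hc hm.le hβ.le
  have hzm : Monotone z := hl.monotone hc hm.le
  have hzL : ∀ s s', |z s - z s'| ≤ β * |s - s'| := hl.lipschitz hc hm.le hβ.le
  have hconv : Convex ℝ B.body := convex_convexHull ℝ _
  have hvb : ∀ t, (v t : Fin d → ℝ) ∈ B.body := fun t => subset_convexHull ℝ _ (v t).2
  set θ := iterate p (fun k => (v k : Fin d → ℝ)) with hθ
  have hθb : ∀ t, θ t ∈ B.body := iterate_mem hconv hp hvb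
  set θs := B.param i with hθs
  set H : ℕ → ℝ := fun t => excess z B.law θs (θ t) with hH
  have hH0 : ∀ t, 0 ≤ H t := fun t => excess_nonneg hzc hzm _ _
  have hgap : ∀ t, 1 ≤ t → t < n → ∀ w ∈ B.body,
      riskGrad z B.law θs (θ t) ⬝ᵥ ((v t : Fin d → ℝ) - w) ≤ (D * e₁ + 2 * e₂) / √t := by
    intro t ht htn w hw
    have := noisy_argmin_gap hB.diam_le (hg t ht htn) (hN t ht htn) (hv t ht htn) hw
    refine this.trans (le_of_eq ?_)
    ring
  -- One descent step with guaranteed gain `y`. Below, `y = H t` comes from convexity and `y = γ √σ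
  -- √(H t)` from the interior optimum.
  have hdesc : ∀ t, 1 ≤ t → ∀ y,
      riskGrad z B.law θs (θ t) ⬝ᵥ ((v t : Fin d → ℝ) - θ t) ≤ (D * e₁ + 2 * e₂) / √t - y →
      H (t + 1) ≤ H t - y / (t + 1) + (D * e₁ + 2 * e₂) / (√t * (t + 1))
        + β * (M * D) ^ 2 / (t + 1) ^ 2 := by
    intro t ht y hy
    have h1 := excess_le_add hβ.le hMae hzc hzm hzL θs (θ t) (θ (t + 1))
    have h2 : θ (t + 1) - θ t = (1 / ((t : ℝ) + 1)) • ((v t : Fin d → ℝ) - θ t) := by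
      rw [hθ, iterate_succ ht, add_sub_cancel_left]
    rw [h2, l1_smul, dotProduct_smul, smul_eq_mul, abs_of_nonneg (by positivity)] at h1
    have h3 : l1 ((v t : Fin d → ℝ) - θ t) ≤ D := hB.diam_le _ (hvb t) _ (hθb t)
    have h4 : β * (M * (1 / ((t : ℝ) + 1) * l1 ((v t : Fin d → ℝ) - θ t))) ^ 2
        ≤ β * (M * (1 / ((t : ℝ) + 1) * D)) ^ 2 := by
      have := l1_nonneg ((v t : Fin d → ℝ) - θ t)
      gcongr
    have h5 := mul_le_mul_of_nonneg_left hy (by positivity : 0 ≤ 1 / ((t : ℝ) + 1))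
    have h6 : β * (M * (1 / ((t : ℝ) + 1) * D)) ^ 2 = β * (M * D) ^ 2 / (t + 1) ^ 2 := by
      field_simp
    have h7 : 1 / ((t : ℝ) + 1) * ((D * e₁ + 2 * e₂) / √t - y)
        = - (y / (t + 1)) + (D * e₁ + 2 * e₂) / (√t * (t + 1)) := by
      have : √(t : ℝ) ≠ 0 := by positivity
      field_simp
      ring
    simp only [hH]
    linarith
  have hsc : ∀ t, σ * (riskGrad z B.law θs (θ t) ⬝ᵥ (θ t - θs))
      ≤ riskGrad z B.law θs (θ t) ⬝ᵥ riskGrad z B.law θs (θ t) := by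
    intro t
    refine strongly_convex_grad hσ0.le ((hσ _).trans ?_)
    refine mul_integral_sq_le_riskGrad hMae hzc ?_
    filter_upwards [hB.mem_ctx] with x hx
    rw [hz, hl.clamp_eq hx (hθb t), hl.clamp_eq hx (hB.param_mem i)]
    exact link_strongly_monotone hl.diff hl.lower hl.upper (hl.range x hx _ (hθb t))
      (hl.range x hx _ (hB.param_mem i))
  have hHp : ∀ t, H t ≤ riskGrad z B.law θs (θ t) ⬝ᵥ (θ t - θs) := fun t =>
    excess_le_riskGrad hMae hzc hzm θs (θ t)
  refine frankWolfe_fast_rate (h := H) (n := n) (by positivity) ?_ (by positivity) (by positivity)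
    hH0 ?_ ?_ ?_ n hn le_rfl
  · rw [mul_pow, Real.sq_sqrt hσ0.le]
    exact Interior.sq_mul_le hB hI hl hm.le hM.le hσ
  · refine (excess_le_sq hβ.le hMae hzc hzm hzL θs (θ 1)).trans ?_
    have h1 : l1 (θ 1 - θs) ≤ D := hB.diam_le _ (hθb 1) _ (hB.param_mem i)
    have := l1_nonneg (θ 1 - θs)
    gcongr
  · intro t ht htn
    refine hdesc t ht _ ?_
    have h1 := hgap t ht htn θs (hB.param_mem i)
    have h2 := hHp t
    simp only [dotProduct_sub] at h1 h2 ⊢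
    linarith
  · intro t ht htn
    refine hdesc t ht _ ?_
    have h1 := interior_gap hI (hgap t ht htn) (θ t)
    have h2 : √σ * √(H t)
        ≤ √(riskGrad z B.law θs (θ t) ⬝ᵥ riskGrad z B.law θs (θ t)) := by
      rw [← Real.sqrt_mul hσ0.le]
      exact Real.sqrt_le_sqrt ((mul_le_mul_of_nonneg_left (hHp t) hσ0.le).trans (hsc t))
    have h3 := mul_le_mul_of_nonneg_left h2 hγ.le
    have h4 := hHp t
    have h5 := hH0 t
    linarith

/-! ### Greedy play under localization -/

/-- If the estimators are localized, a greedy arm among the pre-selected ones is the best arm of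
`Kopt`, unless the context is tied. -/
theorem greedy_eq_iff_mem_bestSet {Kopt : Finset (Fin K)} {h u : ℝ} (hh : 0 < h) (hm : 0 < m)
    (hβ : 0 ≤ β) (hB : B.Bounded M D) (ho : B.OptimalArms Kopt h u) (hl : B.Link c m β)
    {x : Fin d → ℝ} (hx : x ∈ B.ctx) {Θ₀ Θ : Fin K → Fin d → ℝ} (hΘ₀ : ∀ j, Θ₀ j ∈ B.body)
    (hΘ : ∀ j, Θ j ∈ B.body) (hloc₀ : ∀ j, β * M * l1 (Θ₀ j - B.param j) ≤ h / 8)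
    (hloc : ∀ j ∈ Kopt, β * M * l1 (Θ j - B.param j) ≤ h / 8) {a : Fin K}
    (ha : ∀ j, B.link (x ⬝ᵥ Θ₀ j) - h / 2 < B.link (x ⬝ᵥ Θ₀ a))
    (hmax : ∀ k, (∀ j, B.link (x ⬝ᵥ Θ₀ j) - h / 2 < B.link (x ⬝ᵥ Θ₀ k)) →
      B.link (x ⬝ᵥ Θ k) ≤ B.link (x ⬝ᵥ Θ a))
    (htie : x ∉ gapSet Kopt Θ 0) {i : Fin K} (hi : i ∈ Kopt) :
    a = i ↔ x ∈ bestSet Kopt i Θ := by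
  have hc := hl.nonneg hB i
  have hclose : ∀ θ ∈ B.body, ∀ j, β * M * l1 (θ - B.param j) ≤ h / 8 →
      |B.link (x ⬝ᵥ θ) - B.link (x ⬝ᵥ B.param j)| ≤ h / 8 := by
    intro θ hθ j hj
    rw [← hl.clamp_eq hx hθ, ← hl.clamp_eq hx (hB.param_mem j)]
    refine (hl.lipschitz hc hm.le hβ _ _).trans (le_trans ?_ hj)
    rw [← dotProduct_sub, mul_assoc]
    exact mul_le_mul_of_nonneg_left ((abs_dotProduct_le _ _).trans
      (mul_le_mul_of_nonneg_right (hB.ctx_le x hx) (l1_nonneg _))) hβ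
  have h0 : ∀ j, |B.link (x ⬝ᵥ Θ₀ j) - B.link (x ⬝ᵥ B.param j)| ≤ h / 8 := fun j =>
    hclose _ (hΘ₀ j) j (hloc₀ j)
  have h1 : ∀ j ∈ Kopt, |B.link (x ⬝ᵥ Θ j) - B.link (x ⬝ᵥ B.param j)| ≤ h / 8 := fun j hj =>
    hclose _ (hΘ j) j (hloc j hj)
  have hord : ∀ j k, B.link (x ⬝ᵥ Θ j) ≤ B.link (x ⬝ᵥ Θ k) → x ⬝ᵥ Θ j ≤ x ⬝ᵥ Θ k := by
    intro j k hjk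
    by_contra hlt
    push Not at hlt
    have := (link_mean_value hl.diff hl.lower hl.upper (hl.range x hx _ (hΘ k))
      (hl.range x hx _ (hΘ j)) hlt.le).1
    have h2 : 0 < m * (x ⬝ᵥ Θ j - x ⬝ᵥ Θ k) := mul_pos hm (by linarith)
    linarith
  -- A suboptimal arm trails by more than `h`; two errors of `h/8` leave more than `h/2`.
  have hsel : ∀ k, (∀ j, B.link (x ⬝ᵥ Θ₀ j) - h / 2 < B.link (x ⬝ᵥ Θ₀ k)) → k ∈ Kopt := by
    intro k hk
    by_contra hkK
    obtain ⟨j, hj⟩ := ho.sub_gap k hkK x hx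
    have h2 := abs_le.1 (h0 k)
    have h3 := abs_le.1 (h0 j)
    have h4 := hk j
    linarith
  -- If `k` were discarded, the warm-up leader `J` would beat it by at least `h/2` under `Θ₀`. Four
  -- errors of `h/8` use this up exactly, so under `Θ` arm `J` at least ties with `k`, which `htie`
  -- excludes.
  have hbest : ∀ k ∈ Kopt, x ∈ bestSet Kopt k Θ →
      ∀ j, B.link (x ⬝ᵥ Θ₀ j) - h / 2 < B.link (x ⬝ᵥ Θ₀ k) := by
    intro k hk hkmax
    by_contra hcon
    push Not at hcon
    obtain ⟨j, hj⟩ := hcon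
    obtain ⟨J, -, hJ⟩ := Finset.univ.exists_max_image (fun j => B.link (x ⬝ᵥ Θ₀ j)) ⟨i, by simp⟩
    have hJK : J ∈ Kopt := hsel J fun j => by
      have := hJ j (Finset.mem_univ j)
      linarith
    have hjJ := hJ j (Finset.mem_univ j)
    have h2 := abs_le.1 (h0 k)
    have h3 := abs_le.1 (h0 J)
    have h4 := abs_le.1 (h1 k hk)
    have h5 := abs_le.1 (h1 J hJK)
    refine htie ⟨k, hk, J, hJK, ?_, hkmax, ?_⟩
    · rintro rfl
      linarith
    · exact sub_nonpos.2 (hord _ _ (by linarith))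
  have haK := hsel a ha
  constructor
  · rintro rfl
    obtain ⟨k, hk, hkmax⟩ := Kopt.exists_max_image (fun k => x ⬝ᵥ Θ k) ⟨a, hi⟩
    have hka := hord _ _ (hmax k (hbest k hk hkmax))
    exact fun l hl => (hkmax l hl).trans hka
  · intro hib
    by_contra hai
    have := hord _ _ (hmax i (hbest i hi hib))
    exact htie ⟨i, hi, a, haK, hai, hib, sub_nonpos.2 this⟩

/-- Let `s` tend to `0` in the margin condition. -/
theorem Margin.law_gapSet_zero {Kopt : Finset (Fin K)} {ell ν : ℝ} (hmar : B.Margin Kopt ell ν)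
    {Θ : Fin K → Fin d → ℝ} (hΘ : ∀ i ∈ Kopt, l1 (Θ i - B.param i) ≤ ell) :
    B.law (gapSet Kopt Θ 0) = 0 := by
  have h1 : ∀ s : ℝ, 0 < s → B.law (gapSet Kopt Θ 0) ≤ ENNReal.ofReal (ν * s) := by
    intro s hs
    refine (measure_mono ?_).trans (hmar Θ hΘ s hs)
    rintro x ⟨i, hi, j, hj, hji, hx, hgap⟩
    exact ⟨i, hi, j, hj, hji, hx, hgap.trans hs.le⟩
  have h2 : Filter.Tendsto (fun s : ℝ => ENNReal.ofReal (ν * s)) (nhdsWithin 0 (Set.Ioi 0))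
      (nhds 0) := by
    have : Continuous fun s : ℝ => ENNReal.ofReal (ν * s) :=
      ENNReal.continuous_ofReal.comp (continuous_const.mul continuous_id)
    have h3 := (this.tendsto 0).mono_left (nhdsWithin_le_nhds (s := Set.Ioi 0))
    simpa using h3
  refine le_antisymm (ge_of_tendsto h2 ?_) zero_le
  filter_upwards [self_mem_nhdsWithin] with s hs
  exact h1 s hs

end GLMBandit

/-! ### Conditional expectation of the gradient in one round -/

section OneRound

variable {d K : ℕ} {Ω : Type*} {m m' mΩ : MeasurableSpace Ω} {P : Measure Ω}
  {z : ℝ → ℝ} {M R Z : ℝ} {θs : Fin d → ℝ}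

/-- Coordinate `j` of the gradient at `θ` for the sample of a round with context `X`, reward `r`
and action `a`, as seen by arm `i`. -/
noncomputable def pulledGrad (z : ℝ → ℝ) (i : Fin K) (X : Ω → Fin d → ℝ) (r : Ω → ℝ)
    (a : Ω → Fin K) (j : Fin d) (θ : Ω → Fin d → ℝ) (ω : Ω) : ℝ :=
  if a ω = i then (z (X ω ⬝ᵥ θ ω) - r ω) * X ω j else 0

theorem measurable_dotProduct' {f g : Ω → Fin d → ℝ} (hf : Measurable[m] f)
    (hg : Measurable[m] g) : Measurable[m] fun ω => f ω ⬝ᵥ g ω := by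
  have h : Continuous fun p : (Fin d → ℝ) × (Fin d → ℝ) => p.1 ⬝ᵥ p.2 := by
    unfold dotProduct
    fun_prop
  exact h.measurable.comp (hf.prodMk hg)

theorem measurableSet_eq_arm {a : Ω → Fin K} (ha : Measurable[m] a) (i : Fin K) :
    MeasurableSet[m] {ω | a ω = i} := ha (measurableSet_singleton i)

theorem measurable_pulledGrad (hz : Continuous z) {i : Fin K} {X : Ω → Fin d → ℝ} {r : Ω → ℝ}
    {a : Ω → Fin K} {θ : Ω → Fin d → ℝ} (hX : Measurable[m] X) (hr : Measurable[m] r)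
    (ha : Measurable[m] a) (hθ : Measurable[m] θ) (j : Fin d) :
    Measurable[m] (pulledGrad z i X r a j θ) :=
  Measurable.ite (measurableSet_eq_arm ha i)
    (((hz.measurable.comp (measurable_dotProduct' hX hθ)).sub hr).mul
      ((measurable_pi_apply j).comp hX)) measurable_const

/-- The indicator of a past event passes through the conditional expectation. Identities that hold
only under localization are transferred this way. -/
theorem condExp_congr_on {f g : Ω → ℝ} (hf : Integrable f P) (hg : Integrable g P)
    {A : Set Ω} (hA : MeasurableSet[m] A) (h : ∀ᵐ ω ∂P, ω ∈ A → f ω = g ω) :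
    ∀ᵐ ω ∂P, ω ∈ A → (P[f | m]) ω = (P[g | m]) ω := by
  have h1 := condExp_indicator (m := m) hf hA
  have h2 := condExp_indicator (m := m) hg hA
  have h3 : P[A.indicator f | m] =ᵐ[P] P[A.indicator g | m] := by
    refine condExp_congr_ae ?_
    filter_upwards [h] with ω hω
    by_cases hA : ω ∈ A <;> simp [hA, hω]
  filter_upwards [h1, h2, h3] with ω h1 h2 h3 hω
  rw [h1, h2, Set.indicator_of_mem hω, Set.indicator_of_mem hω] at h3
  exact h3

variable [IsProbabilityMeasure P]

/-- Tower property through `m'`, the past together with the context. Everything but the reward is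
`m'`-measurable, so the reward is replaced by its conditional mean. -/
theorem condExp_pulledGrad (hm : m ≤ m') (hm' : m' ≤ mΩ) (hz : Continuous z) (hZ : ∀ s, |z s| ≤ Z)
    {i : Fin K} {X : Ω → Fin d → ℝ} {r : Ω → ℝ} {a : Ω → Fin K} {θ : Ω → Fin d → ℝ}
    (hX : Measurable[m'] X) (hr : Measurable r) (ha : Measurable[m'] a) (hθ : Measurable[m] θ)
    (hXM : ∀ᵐ ω ∂P, ‖X ω‖ ≤ M) (hrR : ∀ᵐ ω ∂P, |r ω| ≤ R)
    (hmean : ∀ᵐ ω ∂P, a ω = i → (P[r | m']) ω = z (X ω ⬝ᵥ θs)) (j : Fin d) :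
    P[pulledGrad z i X r a j θ | m] =ᵐ[P]
      P[fun ω => if a ω = i then (z (X ω ⬝ᵥ θ ω) - z (X ω ⬝ᵥ θs)) * X ω j else 0 | m] := by
  set f : Ω → ℝ := fun ω => if a ω = i then z (X ω ⬝ᵥ θ ω) * X ω j else 0 with hf
  set g : Ω → ℝ := fun ω => if a ω = i then X ω j else 0 with hg
  have hfm : StronglyMeasurable[m'] f :=
    (Measurable.ite (measurableSet_eq_arm ha i)
      ((hz.measurable.comp (measurable_dotProduct' hX (hθ.mono hm le_rfl))).mul
        ((measurable_pi_apply j).comp hX)) measurable_const).stronglyMeasurable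
  have hgm : StronglyMeasurable[m'] g :=
    (Measurable.ite (measurableSet_eq_arm ha i)
        ((measurable_pi_apply j).comp hX) measurable_const).stronglyMeasurable
  have hgb : ∀ᵐ ω ∂P, ‖g ω‖ ≤ M := by
    filter_upwards [hXM] with ω hω
    have h1 : ‖X ω j‖ ≤ M := (norm_le_pi_norm (X ω) j).trans hω
    by_cases h : a ω = i
    · simpa [hg, h] using h1
    · simpa [hg, h] using (norm_nonneg _).trans hω
  have hfi : Integrable f P := by
    refine Integrable.of_bound (hfm.mono hm').aestronglyMeasurable (Z * M) ?_
    filter_upwards [hgb] with ω hω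
    have hZ0 : 0 ≤ Z := (abs_nonneg _).trans (hZ 0)
    have : f ω = z (X ω ⬝ᵥ θ ω) * g ω := by
      by_cases h : a ω = i <;> simp [hf, hg, h]
    rw [this, norm_mul]
    exact mul_le_mul (hZ _) hω (norm_nonneg _) hZ0
  have hri : Integrable r P := Integrable.of_bound hr.aestronglyMeasurable R hrR
  have hgr : Integrable (g * r) P := by
    refine hri.bdd_mul (c := M) (hgm.mono hm').aestronglyMeasurable hgb
  have e : pulledGrad z i X r a j θ = f - g * r := by
    ext ω
    by_cases h : a ω = i
    · simp only [pulledGrad, hf, hg, h, if_true, Pi.sub_apply, Pi.mul_apply]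
      ring
    · simp [pulledGrad, hf, hg, h]
  refine (condExp_condExp_of_le (f := pulledGrad z i X r a j θ) hm hm').symm.trans
    (condExp_congr_ae ?_)
  rw [e]
  have h1 := condExp_sub hfi hgr m' (μ := P)
  have h2 := condExp_mul_of_stronglyMeasurable_left (μ := P) hgm hgr hri
  filter_upwards [h1, h2, hmean] with ω h1 h2 h3
  rw [h1, Pi.sub_apply, h2, condExp_of_stronglyMeasurable hm' hfm hfi, Pi.mul_apply]
  by_cases h : a ω = i
  · simp only [hf, hg, h, if_true, h3 h]
    ring
  · simp [hf, hg, h]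

theorem condExp_region (hm : m ≤ mΩ) (hz : Continuous z) (hZ : ∀ s, |z s| ≤ Z)
    {X : Ω → Fin d → ℝ} {θ : Ω → Fin d → ℝ} {Θ : Ω → Fin K → Fin d → ℝ} (hX : Measurable X)
    (hind : Indep (MeasurableSpace.comap X inferInstance) m P)
    (hθ : Measurable[m] θ) (hΘ : Measurable[m] Θ) (hM0 : 0 ≤ M) (hXM : ∀ᵐ ω ∂P, ‖X ω‖ ≤ M)
    {W : Set ((Fin K → Fin d → ℝ) × (Fin d → ℝ))} (hW : MeasurableSet W) (j : Fin d) :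
    P[fun ω => {x | (Θ ω, x) ∈ W}.indicator
        (fun x => (z (x ⬝ᵥ θ ω) - z (x ⬝ᵥ θs)) * x j) (X ω) | m] =ᵐ[P]
      fun ω => regionGrad z (P.map X) θs {x | (Θ ω, x) ∈ W} (θ ω) j := by
  classical
  -- Truncating `x j` to `[-M, M]` makes `Φ` bounded everywhere, as the freezing lemma requires;
  -- almost surely it changes nothing.
  set Φ : ((Fin d → ℝ) × (Fin K → Fin d → ℝ)) × (Fin d → ℝ) → ℝ := fun p =>
    if (p.1.2, p.2) ∈ W then
      (z (p.2 ⬝ᵥ p.1.1) - z (p.2 ⬝ᵥ θs)) * max (-M) (min M (p.2 j)) else 0 with hΦ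
  have hΦm : Measurable Φ := by
    refine Measurable.ite ?_ ?_ measurable_const
    · exact (measurable_fst.snd.prodMk measurable_snd) hW
    · refine ((hz.measurable.comp (measurable_dotProduct' measurable_snd measurable_fst.fst)).sub
        (hz.measurable.comp (measurable_dotProduct' measurable_snd measurable_const))).mul ?_
      exact measurable_const.max (measurable_const.min ((measurable_pi_apply j).comp measurable_snd))
  have hZ0 : 0 ≤ Z := (abs_nonneg _).trans (hZ 0)
  have hΦb : ∀ p, |Φ p| ≤ (Z + Z) * M := by
    intro p
    by_cases h : (p.1.2, p.2) ∈ W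
    · simp only [hΦ, h, if_true, abs_mul]
      exact mul_le_mul ((abs_sub _ _).trans (add_le_add (hZ _) (hZ _)))
        (abs_clamped_le hM0 _) (abs_nonneg _) (by linarith)
    · simp only [hΦ, h, if_false, abs_zero]
      positivity
  have hcl : ∀ x : Fin d → ℝ, ‖x‖ ≤ M → ∀ (θ : Fin d → ℝ) (Θ : Fin K → Fin d → ℝ),
      Φ ((θ, Θ), x) = {x | (Θ, x) ∈ W}.indicator
        (fun x => (z (x ⬝ᵥ θ) - z (x ⬝ᵥ θs)) * x j) x := by
    intro x hx θ Θ
    have h2 := abs_le.1 ((norm_le_pi_norm x j).trans hx)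
    simp only [hΦ, Set.indicator_apply, Set.mem_ofPred_eq, min_eq_right h2.2, max_eq_right h2.1]
  have hXM' : ∀ᵐ x ∂(P.map X), ‖x‖ ≤ M :=
    (ae_map_iff hX.aemeasurable (measurableSet_le measurable_norm measurable_const)).2 hXM
  have h1 := condExp_eq_integral_fresh hm (hθ.prodMk hΘ) hX hind hΦm hΦb
  refine (condExp_congr_ae ?_).trans (h1.trans (Filter.Eventually.of_forall fun ω => ?_))
  · filter_upwards [hXM] with ω hω
    exact (hcl _ hω _ _).symm
  · refine integral_congr_ae ?_
    filter_upwards [hXM'] with x hx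
    exact hcl x hx _ _

theorem regionGrad_univ (z : ℝ → ℝ) (μ : Measure (Fin d → ℝ)) (θs θ : Fin d → ℝ) :
    regionGrad z μ θs Set.univ θ = riskGrad z μ θs θ := by
  ext j
  simp [regionGrad, riskGrad]

end OneRound

namespace Run

variable {d K : ℕ} {B : GLMBandit d K} {Ω : Type*}

/-! ### Rounds and steps -/

section Rounds

variable (S : Run B Ω)

theorem round_of_lt {i : Fin K} {t : ℕ} (h : S.t0 < t) : S.round i t = (K - 1) * S.t0 + t :=
  if_neg h.not_ge

theorem arm_mul_le (i : Fin K) : (i : ℕ) * S.t0 ≤ (K - 1) * S.t0 :=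
  Nat.mul_le_mul_right _ (Nat.le_sub_one_of_lt i.2)

theorem round_lt_round_self (i : Fin K) {k t : ℕ} (h : k < t) : S.round i k < S.round i t := by
  have := S.arm_mul_le i
  unfold round
  split_ifs <;> omega

/-- After the warm-up all arms step together, so the estimators of every arm at step `t` belong to
the past. Inside the warm-up blocks this fails for distinct arms. -/
theorem round_lt_round (i j : Fin K) {k t : ℕ} (h : k < t) (ht : S.t0 < t) :
    S.round j k < S.round i t := by
  have := S.arm_mul_le i
  have := S.arm_mul_le j
  unfold round
  split_ifs <;> omega

theorem round_le_of_le {i : Fin K} {k t n : ℕ} (hk : k ≤ t) (hn : S.round i t ≤ n) :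
    S.round i k ≤ n := by
  rcases hk.eq_or_lt with rfl | h1
  · exact hn
  · exact (S.round_lt_round_self i h1).le.trans hn

theorem one_le_round (i : Fin K) {t : ℕ} (h : 1 ≤ t) : 1 ≤ S.round i t := by
  unfold round
  split_ifs <;> omega

end Rounds

variable {S : Run B Ω} {T : ℕ} {h R : ℝ} {b : ℕ → ℝ} {M D β c m : ℝ}

theorem est_mem (hinit : ∀ i, S.init i ∈ B.body) (j : Fin K) (t : ℕ) (ω : Ω) :
    S.est j t ω ∈ B.body :=
  iterate_mem (convex_convexHull ℝ _) (hinit j) (fun k => subset_convexHull ℝ _ (S.v j k ω).2) t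

theorem l1_est_sub_le (hB : B.Bounded M D) (hinit : ∀ i, S.init i ∈ B.body) (j : Fin K) {t : ℕ}
    (ht : 1 ≤ t) (ω : Ω) : l1 (S.est j t ω - S.est j (t - 1) ω) ≤ D / t :=
  l1_iterate_sub_le (convex_convexHull ℝ _) (hinit j)
    (fun k => subset_convexHull ℝ _ (S.v j k ω).2) hB.diam_le ht

theorem measurable_est {m : MeasurableSpace Ω} (j : Fin K) (t : ℕ)
    (hv : ∀ k, 1 ≤ k → k < t → Measurable[m] (S.v j k)) : Measurable[m] (S.est j t) := by
  induction t with
  | zero => exact measurable_const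
  | succ t ih =>
    rcases Nat.eq_zero_or_pos t with rfl | ht
    · exact measurable_const
    · have h1 : S.est j (t + 1) = fun ω => S.est j t ω
          + (1 / ((t : ℝ) + 1)) • ((S.v j t ω : Fin d → ℝ) - S.est j t ω) := by
        funext ω
        exact iterate_succ ht
      have h2 := ih fun k hk hkt => hv k hk (by omega)
      have h3 : Measurable[m] fun ω => (S.v j t ω : Fin d → ℝ) :=
        measurable_subtype_coe.comp (hv t ht (by omega))
      rw [h1]
      have h4 : Measurable[m] fun ω => (S.v j t ω : Fin d → ℝ) - S.est j t ω := h3.sub h2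
      have h5 : Measurable fun x : Fin d → ℝ => (1 / ((t : ℝ) + 1)) • x :=
        measurable_const_smul _
      exact h2.add (h5.comp h4)

variable [MeasurableSpace Ω] {P : Measure Ω}
  {ℱ : Filtration ℕ (inferInstance : MeasurableSpace Ω)}

namespace IsDPHDB

theorem measurable_est_self (hS : S.IsDPHDB P ℱ T h R b) (i : Fin K) {k t : ℕ} (hk : k ≤ t)
    (ht : S.round i t ≤ T) : Measurable[ℱ (S.round i t - 1)] (S.est i k) := by
  refine measurable_est i k fun l hl hlk => ?_
  have h1 := S.round_lt_round_self i (lt_of_lt_of_le hlk hk)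
  exact (hS.meas_v i l hl (by omega)).mono (ℱ.mono (by omega)) le_rfl

theorem measurable_est_all (hS : S.IsDPHDB P ℱ T h R b) (i j : Fin K) {k t : ℕ} (hk : k ≤ t)
    (ht0 : S.t0 < t) (ht : S.round i t ≤ T) : Measurable[ℱ (S.round i t - 1)] (S.est j k) := by
  refine measurable_est j k fun l hl hlk => ?_
  have h1 := S.round_lt_round i j (lt_of_lt_of_le hlk hk) ht0
  exact (hS.meas_v j l hl (by omega)).mono (ℱ.mono (by omega)) le_rfl

theorem pre_le (hS : S.IsDPHDB P ℱ T h R b) {s : ℕ} (h1 : 1 ≤ s) (hT : s ≤ T) :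
    S.pre ℱ s ≤ ℱ s :=
  sup_le (ℱ.mono (by omega)) (hS.meas_X s h1 hT).comap_le

theorem ae_ctx (hS : S.IsDPHDB P ℱ T h R b) (hB : B.Bounded M D) {s : ℕ} (h1 : 1 ≤ s)
    (hT : s ≤ T) : ∀ᵐ ω ∂P, S.X s ω ∈ B.ctx := by
  have hm := (hS.meas_X s h1 hT).mono (ℱ.le s) le_rfl
  have h2 := hB.mem_ctx
  rw [← hS.law_X s h1 hT] at h2
  exact ae_of_ae_map hm.aemeasurable h2

end IsDPHDB

end Run

/-! ### The standing assumptions -/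

/-- The assumptions on the bandit and the run, apart from those that only concern the warm-up. -/
structure Setting {d K : ℕ} {B : GLMBandit d K} {Ω : Type*} [MeasurableSpace Ω] (S : Run B Ω)
    (P : Measure Ω) (ℱ : Filtration ℕ (inferInstance : MeasurableSpace Ω)) (T : ℕ)
    (Kopt : Finset (Fin K)) (M D β R h u ell ν c m : ℝ) (b : ℕ → ℝ) : Prop where
  M_pos : 0 < M
  D_pos : 0 < D
  β_pos : 0 < β
  R_nonneg : 0 ≤ R
  h_pos : 0 < h
  ν_pos : 0 < ν
  m_pos : 0 < m
  bounded : B.Bounded M D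
  optimal : B.OptimalArms Kopt h u
  margin : B.Margin Kopt ell ν
  link : B.Link c m β
  t0_pos : 1 ≤ S.t0
  run : S.IsDPHDB P ℱ T h R b

namespace Setting

variable {d K : ℕ} {B : GLMBandit d K} {Ω : Type*} [MeasurableSpace Ω] {S : Run B Ω}
  {P : Measure Ω} {ℱ : Filtration ℕ (inferInstance : MeasurableSpace Ω)}
  {T : ℕ} {Kopt : Finset (Fin K)} {M D β R h u ell ν c m : ℝ} {b : ℕ → ℝ}
  (H : Setting S P ℱ T Kopt M D β R h u ell ν c m b)

include H

theorem link_lipschitz (i : Fin K) (s s' : ℝ) :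
    |clamp B.link c s - clamp B.link c s'| ≤ β * |s - s'| :=
  H.link.lipschitz (H.link.nonneg H.bounded i) H.m_pos.le H.β_pos.le s s'

theorem link_continuous (i : Fin K) : Continuous (clamp B.link c) :=
  H.link.continuous (H.link.nonneg H.bounded i) H.m_pos.le H.β_pos.le

theorem link_monotone (i : Fin K) : Monotone (clamp B.link c) :=
  H.link.monotone (H.link.nonneg H.bounded i) H.m_pos.le

theorem abs_link_le (i : Fin K) (s : ℝ) : |clamp B.link c s| ≤ |clamp B.link c 0| + β * c := by
  have hc := H.link.nonneg H.bounded i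
  have hs := abs_clamped_le hc s
  have h1 := H.link_lipschitz i (max (-c) (min c s)) 0
  rw [sub_zero] at h1
  have h2 : clamp B.link c s = clamp B.link c (max (-c) (min c s)) := (clamp_of_abs_le hs).symm
  have h3 := mul_le_mul_of_nonneg_left hs H.β_pos.le
  rw [h2]
  have h4 := abs_sub_abs_le_abs_sub (clamp B.link c (max (-c) (min c s))) (clamp B.link c 0)
  linarith

theorem measurable_X {s : ℕ} (h1 : 1 ≤ s) (hT : s ≤ T) : Measurable (S.X s) :=
  (H.run.meas_X s h1 hT).mono (ℱ.le s) le_rfl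

theorem measurable_r {s : ℕ} (h1 : 1 ≤ s) (hT : s ≤ T) : Measurable (S.r s) :=
  (H.run.meas_r s h1 hT).mono (ℱ.le s) le_rfl

theorem ae_norm_X_le {s : ℕ} (h1 : 1 ≤ s) (hT : s ≤ T) : ∀ᵐ ω ∂P, ‖S.X s ω‖ ≤ M :=
  (H.run.ae_ctx H.bounded h1 hT).mono fun _ hω => H.bounded.ctx_le _ hω

theorem est_mem (j : Fin K) (t : ℕ) (ω : Ω) : S.est j t ω ∈ B.body :=
  Run.est_mem H.run.init_mem j t ω

theorem ae_mean_eq (i : Fin K) {s : ℕ} (h1 : 1 ≤ s) (hT : s ≤ T) :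
    ∀ᵐ ω ∂P, S.a s ω = i →
      (P[S.r s | S.pre ℱ s]) ω = clamp B.link c (S.X s ω ⬝ᵥ B.param i) := by
  filter_upwards [H.run.mean_r s h1 hT, H.run.ae_ctx H.bounded h1 hT] with ω h2 h3 h4
  rw [h2, h4, H.link.clamp_eq h3 (H.bounded.param_mem i)]

end Setting

/-- Coordinate `j` of the gradient at `θ` for the sample used by arm `i` at its step `t`. -/
noncomputable def Run.armGrad {d K : ℕ} {B : GLMBandit d K} {Ω : Type*} (S : Run B Ω) (c : ℝ)
    (i : Fin K) (t : ℕ) (j : Fin d) (θ : Ω → Fin d → ℝ) : Ω → ℝ :=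
  pulledGrad (clamp B.link c) i (S.X (S.round i t)) (S.r (S.round i t)) (S.a (S.round i t)) j θ

/-! ### Conditional mean of the gradient in warm-up and greedy rounds -/

namespace Setting

variable {d K : ℕ} {B : GLMBandit d K} {Ω : Type*} [MeasurableSpace Ω] {S : Run B Ω}
  {P : Measure Ω} {ℱ : Filtration ℕ (inferInstance : MeasurableSpace Ω)}
  {T : ℕ} {Kopt : Finset (Fin K)} {M D β R h u ell ν c m : ℝ} {b : ℕ → ℝ}
  (H : Setting S P ℱ T Kopt M D β R h u ell ν c m b)
  {i : Fin K} {t : ℕ} (ht : 1 ≤ t) (hT : S.round i t ≤ T) {θ θ' : Ω → Fin d → ℝ}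

include H ht hT

theorem measurable_armGrad (hθ : Measurable[ℱ (S.round i t - 1)] θ) (j : Fin d) :
    Measurable[ℱ (S.round i t)] (S.armGrad c i t j θ) :=
  have h1 := S.one_le_round i ht
  measurable_pulledGrad (H.link_continuous i) (H.run.meas_X _ h1 hT) (H.run.meas_r _ h1 hT)
    ((H.run.meas_a _ h1 hT).mono (H.run.pre_le h1 hT) le_rfl)
    (hθ.mono (ℱ.mono (by omega)) le_rfl) j

/-- The synthetic sample has context `0`, hence zero gradient. -/
theorem ae_glmGrad_eq (hb : ∀ ω, θ ω ∈ B.body) :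
    ∀ᵐ ω ∂P, ∀ j, glmGrad B.link (θ ω) (S.sample i t ω) j = S.armGrad c i t j θ ω := by
  filter_upwards [H.run.ae_ctx H.bounded (S.one_le_round i ht) hT] with ω hω j
  by_cases h : S.a (S.round i t) ω = i
  · simp only [glmGrad, Run.sample, Run.armGrad, pulledGrad, h, if_true, Pi.smul_apply,
      smul_eq_mul, H.link.clamp_eq hω (hb ω)]
  · simp [glmGrad, Run.sample, Run.armGrad, pulledGrad, h]

theorem ae_abs_armGrad_sub_le (j : Fin d) :
    ∀ᵐ ω ∂P, |S.armGrad c i t j θ ω - S.armGrad c i t j θ' ω|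
      ≤ β * M ^ 2 * l1 (θ ω - θ' ω) := by
  filter_upwards [H.ae_norm_X_le (S.one_le_round i ht) hT] with ω hω
  have h1 := abs_link_sub_mul_le H.M_pos.le H.β_pos.le (H.link_lipschitz i) hω (θ ω) (θ' ω) j
  by_cases h : S.a (S.round i t) ω = i
  · simp only [Run.armGrad, pulledGrad, h, if_true]
    refine le_trans (le_of_eq ?_) h1
    congr 1
    ring
  · simp only [Run.armGrad, pulledGrad, h, if_false, sub_self, abs_zero]
    exact (abs_nonneg _).trans h1

/-- When the arm is pulled, `ζ(Xᵀθ*)` is the conditional mean of a reward bounded by `R`, so it is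
bounded by `R` too. This avoids `L` and keeps the final constant dependent on `M, D, β, R` only. -/
theorem ae_abs_armGrad_le (hb : ∀ ω, θ ω ∈ B.body) (j : Fin d) :
    ∀ᵐ ω ∂P, |S.armGrad c i t j θ ω| ≤ M * (β * M * D + 2 * R) := by
  have h1 := S.one_le_round i ht
  have hR := ae_bdd_abs_condExp_of_ae_bdd_abs (m := S.pre ℱ (S.round i t))
    (H.run.bdd_r _ h1 hT)
  have hM := H.M_pos
  have hβ := H.β_pos
  have hD := H.D_pos
  have hR0 := H.R_nonneg
  filter_upwards [H.ae_norm_X_le h1 hT, H.run.bdd_r _ h1 hT, hR, H.ae_mean_eq i h1 hT]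
    with ω hX hr hc hmean
  by_cases h : S.a (S.round i t) ω = i
  · rw [hmean h] at hc
    have hc' : |clamp B.link c (S.X (S.round i t) ω ⬝ᵥ B.param i)| ≤ R := hc
    have h2 := H.link_lipschitz i (S.X (S.round i t) ω ⬝ᵥ θ ω)
      (S.X (S.round i t) ω ⬝ᵥ B.param i)
    rw [← dotProduct_sub] at h2
    have h3 : |S.X (S.round i t) ω ⬝ᵥ (θ ω - B.param i)| ≤ M * D :=
      (abs_dotProduct_le _ _).trans (mul_le_mul hX
        (H.bounded.diam_le _ (hb ω) _ (H.bounded.param_mem i)) (l1_nonneg _) hM.le)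
    have h4 := mul_le_mul_of_nonneg_left h3 hβ.le
    have h5 : |S.X (S.round i t) ω j| ≤ M := (norm_le_pi_norm _ j).trans hX
    simp only [Run.armGrad, pulledGrad, h, if_true, abs_mul]
    rw [mul_comm]
    refine mul_le_mul h5 ?_ (abs_nonneg _) hM.le
    rw [abs_le] at *
    constructor <;> linarith
  · simp only [Run.armGrad, pulledGrad, h, if_false, abs_zero]
    positivity

variable [IsProbabilityMeasure P]

theorem integrable_armGrad (hθ : Measurable[ℱ (S.round i t - 1)] θ)
    (hb : ∀ ω, θ ω ∈ B.body) (j : Fin d) : Integrable (S.armGrad c i t j θ) P :=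
  Integrable.of_bound ((H.measurable_armGrad ht hT hθ j).mono (ℱ.le _) le_rfl).aestronglyMeasurable
    _ (H.ae_abs_armGrad_le ht hT hb j)

theorem condExp_armGrad (hθ : Measurable[ℱ (S.round i t - 1)] θ) (j : Fin d) :
    P[S.armGrad c i t j θ | ℱ (S.round i t - 1)] =ᵐ[P]
      P[fun ω => if S.a (S.round i t) ω = i then
          (clamp B.link c (S.X (S.round i t) ω ⬝ᵥ θ ω)
            - clamp B.link c (S.X (S.round i t) ω ⬝ᵥ B.param i)) * S.X (S.round i t) ω j
        else 0 | ℱ (S.round i t - 1)] := by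
  have h1 := S.one_le_round i ht
  exact condExp_pulledGrad (m' := S.pre ℱ (S.round i t)) le_sup_left
    ((H.run.pre_le h1 hT).trans (ℱ.le _)) (H.link_continuous i) (H.abs_link_le i)
    ((comap_measurable _).mono le_sup_right le_rfl) (H.measurable_r h1 hT)
    (H.run.meas_a _ h1 hT) hθ (H.ae_norm_X_le h1 hT) (H.run.bdd_r _ h1 hT)
    (H.ae_mean_eq i h1 hT) j

/-- During the warm-up, the conditional mean of the gradient is the population gradient. -/
theorem condExp_armGrad_warm (htt : t ≤ S.t0) (hθ : Measurable[ℱ (S.round i t - 1)] θ)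
    (j : Fin d) :
    P[S.armGrad c i t j θ | ℱ (S.round i t - 1)] =ᵐ[P]
      fun ω => riskGrad (clamp B.link c) B.law (B.param i) (θ ω) j := by
  have h1 := S.one_le_round i ht
  refine (H.condExp_armGrad ht hT hθ j).trans ?_
  have h2 := condExp_region (P := P) (θs := B.param i)
    (Θ := fun (_ : Ω) (_ : Fin K) => (0 : Fin d → ℝ)) (ℱ.le _)
    (H.link_continuous i) (H.abs_link_le i) (H.measurable_X h1 hT) (H.run.indep_X _ h1 hT) hθ
    measurable_const H.M_pos.le (H.ae_norm_X_le h1 hT) MeasurableSet.univ j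
  simp only [Set.mem_univ, Set.ofPred_true, Set.indicator_univ, regionGrad_univ,
    H.run.law_X _ h1 hT] at h2
  refine (condExp_congr_ae ?_).trans h2
  filter_upwards [H.run.forced i t ht htt hT] with ω hω
  simp [hω]

omit ht in
/-- After the warm-up and under localization, the conditional mean of the gradient is the
population gradient restricted to the region where the arm is the best one. -/
theorem condExp_armGrad_greedy (hi : i ∈ Kopt) (htt : S.t0 < t)
    (hθ : Measurable[ℱ (S.round i t - 1)] θ) (hb : ∀ ω, θ ω ∈ B.body) (j : Fin d) :
    ∀ᵐ ω ∂P, S.Localized Kopt M β h ell t ω →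
      (P[S.armGrad c i t j θ | ℱ (S.round i t - 1)]) ω
        = regionGrad (clamp B.link c) B.law (B.param i)
            (bestSet Kopt i fun k => S.est k t ω) (θ ω) j := by
  have ht : 1 ≤ t := by omega
  have h1 := S.one_le_round i ht
  have hmem := fun k => H.run.measurable_est_all i k le_rfl htt hT
  have hmem0 := fun k => H.run.measurable_est_all i k htt.le htt hT
  have hl1 : ∀ k, Measurable[ℱ (S.round i t - 1)] fun ω => l1 (S.est k t ω - B.param k) :=
    fun k => continuous_l1.measurable.comp ((hmem k).sub measurable_const)
  have hl10 : ∀ k, Measurable[ℱ (S.round i t - 1)] fun ω => l1 (S.est k S.t0 ω - B.param k) :=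
    fun k => continuous_l1.measurable.comp ((hmem0 k).sub measurable_const)
  -- The part of localization at steps `t₀` and `t`: an event of the past, as conditioning demands,
  -- and sufficient for the greedy rule.
  set A : Set Ω := (⋂ k, {ω | β * M * l1 (S.est k S.t0 ω - B.param k) ≤ h / 8}) ∩
    ⋂ k ∈ Kopt, ({ω | l1 (S.est k t ω - B.param k) ≤ ell} ∩
      {ω | β * M * l1 (S.est k t ω - B.param k) ≤ h / 8}) with hA
  have hAm : MeasurableSet[ℱ (S.round i t - 1)] A :=
    (MeasurableSet.iInter fun k => measurableSet_le ((hl10 k).const_mul _) measurable_const).inter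
      (MeasurableSet.biInter Kopt.countable_toSet fun k _ =>
        (measurableSet_le (hl1 k) measurable_const).inter
          (measurableSet_le ((hl1 k).const_mul _) measurable_const))
  have hmA : ∀ ω, ω ∈ A ↔ (∀ k, β * M * l1 (S.est k S.t0 ω - B.param k) ≤ h / 8) ∧
      ∀ k ∈ Kopt, l1 (S.est k t ω - B.param k) ≤ ell ∧
        β * M * l1 (S.est k t ω - B.param k) ≤ h / 8 := by
    intro ω
    simp [hA]
  have hLA : ∀ ω, S.Localized Kopt M β h ell t ω → ω ∈ A := fun ω hω =>
    (hmA ω).2 ⟨hω.1, hω.2 t htt.le le_rfl⟩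
  have hΘ : Measurable[ℱ (S.round i t - 1)] fun ω k => S.est k t ω :=
    @measurable_pi_lambda _ _ _ (ℱ (S.round i t - 1)) _ _ hmem
  have htie := ae_notMem_of_fresh (P := P) (ℱ.le _) hΘ (H.measurable_X h1 hT)
    (H.run.indep_X _ h1 hT) hAm (measurableSet_gapSet_prod (d := d) Kopt 0) (fun ω hω => by
      rw [H.run.law_X _ h1 hT]
      exact H.margin.law_gapSet_zero fun k hk => (((hmA ω).1 hω).2 k hk).1)
  have h2 := condExp_region (P := P) (θs := B.param i) (ℱ.le _)
    (H.link_continuous i) (H.abs_link_le i) (H.measurable_X h1 hT) (H.run.indep_X _ h1 hT) hθ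
    hΘ H.M_pos.le (H.ae_norm_X_le h1 hT) (measurableSet_bestSet_prod Kopt i) j
  have hround := S.round_of_lt (i := i) htt
  have hsel := H.run.greedy_mem t htt (hround ▸ hT)
  have hmax := H.run.greedy_max t htt (hround ▸ hT)
  rw [← hround] at hsel hmax
  have hctx := H.run.ae_ctx H.bounded h1 hT
  have hiff : ∀ᵐ ω ∂P, ω ∈ A → (S.a (S.round i t) ω = i ↔
      S.X (S.round i t) ω ∈ bestSet Kopt i fun k => S.est k t ω) := by
    filter_upwards [hsel, hmax, hctx, htie] with ω hsel hmax hctx htie hωA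
    have h3 := (hmA ω).1 hωA
    exact GLMBandit.greedy_eq_iff_mem_bestSet H.h_pos H.m_pos H.β_pos.le H.bounded H.optimal
      H.link hctx (fun k => H.est_mem k S.t0 ω) (fun k => H.est_mem k t ω) h3.1
      (fun k hk => (h3.2 k hk).2) hsel hmax (htie hωA) hi
  have hbd : ∀ᵐ ω ∂P, |(clamp B.link c (S.X (S.round i t) ω ⬝ᵥ θ ω)
      - clamp B.link c (S.X (S.round i t) ω ⬝ᵥ B.param i)) * S.X (S.round i t) ω j|
      ≤ β * M ^ 2 * D := by
    filter_upwards [H.ae_norm_X_le h1 hT] with ω hω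
    refine (abs_link_sub_mul_le H.M_pos.le H.β_pos.le (H.link_lipschitz i) hω _ _ j).trans ?_
    have := H.β_pos
    have := H.bounded.diam_le _ (hb ω) _ (H.bounded.param_mem i)
    gcongr
  have hqm : Measurable fun ω => (clamp B.link c (S.X (S.round i t) ω ⬝ᵥ θ ω)
      - clamp B.link c (S.X (S.round i t) ω ⬝ᵥ B.param i)) * S.X (S.round i t) ω j := by
    have hX := H.measurable_X h1 hT
    have hz := (H.link_continuous i).measurable
    exact ((hz.comp (measurable_dotProduct' hX (hθ.mono (ℱ.le _) le_rfl))).sub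
      (hz.comp (measurable_dotProduct' hX measurable_const))).mul ((measurable_pi_apply j).comp hX)
  have hbD : 0 ≤ β * M ^ 2 * D := by
    have := H.β_pos
    have := H.D_pos
    positivity
  have ham : Measurable (S.a (S.round i t)) :=
    (H.run.meas_a _ h1 hT).mono ((H.run.pre_le h1 hT).trans (ℱ.le _)) le_rfl
  have hmeas2 : MeasurableSet {ω | S.X (S.round i t) ω ∈ bestSet Kopt i fun k => S.est k t ω} :=
    ((hΘ.mono (ℱ.le _) le_rfl).prodMk (H.measurable_X h1 hT)) (measurableSet_bestSet_prod Kopt i)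
  have h5 := condExp_congr_on (P := P) (m := ℱ (S.round i t - 1))
    (f := fun ω => if S.a (S.round i t) ω = i then
          (clamp B.link c (S.X (S.round i t) ω ⬝ᵥ θ ω)
            - clamp B.link c (S.X (S.round i t) ω ⬝ᵥ B.param i)) * S.X (S.round i t) ω j
        else 0)
    (g := fun ω => (bestSet Kopt i fun k => S.est k t ω).indicator
        (fun x => (clamp B.link c (x ⬝ᵥ θ ω) - clamp B.link c (x ⬝ᵥ B.param i)) * x j)
        (S.X (S.round i t) ω))
    (by
      refine Integrable.of_bound (Measurable.ite (measurableSet_eq_arm ham i) hqm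
        measurable_const).aestronglyMeasurable (β * M ^ 2 * D) ?_
      filter_upwards [hbd] with ω hω
      split_ifs
      · exact hω
      · simpa using hbD)
    (by
      refine Integrable.of_bound (hqm.indicator hmeas2).aestronglyMeasurable (β * M ^ 2 * D) ?_
      filter_upwards [hbd] with ω hω
      by_cases h : S.X (S.round i t) ω ∈ bestSet Kopt i fun k => S.est k t ω
      · simpa [Set.indicator, h] using hω
      · simpa [Set.indicator, h] using hbD)
    hAm
    (by
      filter_upwards [hiff] with ω hω hωA
      by_cases h : S.X (S.round i t) ω ∈ bestSet Kopt i fun k => S.est k t ω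
      · simp [h, (hω hωA).2 h]
      · simp [h, mt (hω hωA).1 h])
  rw [H.run.law_X _ h1 hT] at h2
  filter_upwards [H.condExp_armGrad ht hT hθ j, h5, h2] with ω h3 h4 h6 hloc
  rw [h3, h4 (hLA ω hloc)]
  exact h6

/-- Coordinates of the conditional gradient. -/
theorem ae_condGrad_eq :
    ∀ᵐ ω ∂P, ∀ j, S.condGrad P ℱ i t ω j
      = (P[S.armGrad c i t j (S.est i t) | ℱ (S.round i t - 1)]) ω := by
  have hθ := H.run.measurable_est_self i le_rfl hT
  have hb := fun ω => H.est_mem i t ω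
  set V : Ω → Fin d → ℝ := fun ω j => S.armGrad c i t j (S.est i t) ω with hV
  have h1 : S.condGrad P ℱ i t =ᵐ[P] P[V | ℱ (S.round i t - 1)] := by
    refine condExp_congr_ae ?_
    filter_upwards [H.ae_glmGrad_eq ht hT hb] with ω hω
    ext j
    exact hω j
  have hVi : Integrable V P := by
    refine Integrable.of_eval fun j => ?_
    exact H.integrable_armGrad ht hT hθ hb j
  have h2 : ∀ j, ∀ᵐ ω ∂P, (P[V | ℱ (S.round i t - 1)]) ω j
      = (P[S.armGrad c i t j (S.est i t) | ℱ (S.round i t - 1)]) ω := fun j =>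
    (ContinuousLinearMap.proj (R := ℝ) (φ := fun _ : Fin d => ℝ) j).comp_condExp_comm hVi
  filter_upwards [h1, ae_all_iff.2 h2] with ω h1 h2 j
  rw [h1, h2]

end Setting

/-! ### Martingale and drift decomposition of the scaled gradient error -/

namespace Run

variable {d K : ℕ} {B : GLMBandit d K} {Ω : Type*}

theorem Localized.mono {S : Run B Ω} {Kopt : Finset (Fin K)} {M β h ell : ℝ} {t t' : ℕ} {ω : Ω}
    (hloc : S.Localized Kopt M β h ell t ω) (h' : t' ≤ t) : S.Localized Kopt M β h ell t' ω :=
  ⟨hloc.1, fun τ h1 h2 => hloc.2 τ h1 (h2.trans h')⟩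

variable [MeasurableSpace Ω]

/-- The increment `(t + 1) ∇f(θ_t; z_t) - t ∇f(θ_{t-1}; z_t)` of the scaled recursive gradient. -/
noncomputable def scaledStep (S : Run B Ω) (c : ℝ) (i : Fin K) (j : Fin d) (t : ℕ) : Ω → ℝ :=
  fun ω => ((t : ℝ) + 1) * S.armGrad c i t j (S.est i t) ω
    - t * S.armGrad c i t j (S.est i (t - 1)) ω

/-- The martingale part of the scaled recursive gradient error. -/
noncomputable def martDiff (S : Run B Ω) (P : Measure Ω)
    (ℱ : Filtration ℕ (inferInstance : MeasurableSpace Ω)) (c : ℝ) (i : Fin K) (j : Fin d)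
    (t : ℕ) : Ω → ℝ :=
  S.scaledStep c i j t - P[S.scaledStep c i j t | ℱ (S.round i t - 1)]

/-- The change of the conditional gradient at `θ_{t-1}` between steps `t - 1` and `t`. -/
noncomputable def drift (S : Run B Ω) (P : Measure Ω)
    (ℱ : Filtration ℕ (inferInstance : MeasurableSpace Ω)) (c : ℝ) (i : Fin K) (j : Fin d)
    (t : ℕ) (ω : Ω) : ℝ :=
  (P[S.armGrad c i (t - 1) j (S.est i (t - 1)) | ℱ (S.round i (t - 1) - 1)]) ω
    - (P[S.armGrad c i t j (S.est i (t - 1)) | ℱ (S.round i t - 1)]) ω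

end Run

namespace Setting

variable {d K : ℕ} {B : GLMBandit d K} {Ω : Type*} [MeasurableSpace Ω] {S : Run B Ω}
  {P : Measure Ω} {ℱ : Filtration ℕ (inferInstance : MeasurableSpace Ω)}
  {T : ℕ} {Kopt : Finset (Fin K)} {M D β R h u ell ν c m : ℝ} {b : ℕ → ℝ}
  (H : Setting S P ℱ T Kopt M D β R h u ell ν c m b)
  {i : Fin K} {t : ℕ}

include H

section MartDiff

variable (ht : 1 ≤ t) (hT : S.round i t ≤ T)

include ht hT

theorem measurable_scaledStep (j : Fin d) :
    Measurable[ℱ (S.round i t)] (S.scaledStep c i j t) := by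
  have h1 := H.measurable_armGrad ht hT (H.run.measurable_est_self i le_rfl hT) j
  have h2 := H.measurable_armGrad ht hT (H.run.measurable_est_self i (Nat.sub_le t 1) hT) j
  exact (h1.const_mul _).sub (h2.const_mul _)

/-- The increment is `t` times a difference of gradients at consecutive iterates plus one gradient.
The factor `t` cancels against the displacement `D/t`, so the bound does not grow with `t`. -/
theorem ae_abs_scaledStep_le (j : Fin d) :
    ∀ᵐ ω ∂P, |S.scaledStep c i j t ω| ≤ β * M ^ 2 * D + M * (β * M * D + 2 * R) := by
  filter_upwards [H.ae_abs_armGrad_sub_le ht hT (θ := S.est i t) (θ' := S.est i (t - 1)) j,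
    H.ae_abs_armGrad_le ht hT (θ := S.est i t) (H.est_mem i t) j] with ω h1 h2
  have h3 := Run.l1_est_sub_le H.bounded H.run.init_mem i ht ω
  have ht' : (0 : ℝ) < t := by exact_mod_cast ht
  have hβ := H.β_pos
  rw [le_div_iff₀ ht'] at h3
  have h4 : (t : ℝ) * |S.armGrad c i t j (S.est i t) ω - S.armGrad c i t j (S.est i (t - 1)) ω|
      ≤ β * M ^ 2 * D := by
    calc _ ≤ (t : ℝ) * (β * M ^ 2 * l1 (S.est i t ω - S.est i (t - 1) ω)) := by gcongr
      _ = β * M ^ 2 * (l1 (S.est i t ω - S.est i (t - 1) ω) * t) := by ring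
      _ ≤ _ := by gcongr
  have e : S.scaledStep c i j t ω = t * (S.armGrad c i t j (S.est i t) ω
      - S.armGrad c i t j (S.est i (t - 1)) ω) + S.armGrad c i t j (S.est i t) ω := by
    rw [Run.scaledStep]
    ring
  rw [e]
  refine (abs_add_le _ _).trans (add_le_add ?_ h2)
  rwa [abs_mul, abs_of_pos ht']

theorem stronglyMeasurable_martDiff (j : Fin d) :
    StronglyMeasurable[ℱ (S.round i t)] (S.martDiff P ℱ c i j t) :=
  (H.measurable_scaledStep ht hT j).stronglyMeasurable.sub
    (stronglyMeasurable_condExp.mono (ℱ.mono (Nat.sub_le _ _)))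

theorem ae_abs_martDiff_le (j : Fin d) :
    ∀ᵐ ω ∂P, |S.martDiff P ℱ c i j t ω|
      ≤ 2 * (β * M ^ 2 * D + M * (β * M * D + 2 * R)) := by
  have h1 := H.ae_abs_scaledStep_le ht hT j
  filter_upwards [h1, ae_bdd_abs_condExp_of_ae_bdd_abs (m := ℱ (S.round i t - 1)) h1]
    with ω h1 h2
  rw [Run.martDiff, Pi.sub_apply, two_mul]
  exact (abs_sub _ _).trans (add_le_add h1 h2)

variable [IsProbabilityMeasure P]

theorem integrable_scaledStep (j : Fin d) : Integrable (S.scaledStep c i j t) P :=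
  Integrable.of_bound ((H.measurable_scaledStep ht hT j).mono (ℱ.le _) le_rfl).aestronglyMeasurable
    _ (H.ae_abs_scaledStep_le ht hT j)

theorem condExp_martDiff (j : Fin d) :
    P[S.martDiff P ℱ c i j t | ℱ (S.round i t - 1)] =ᵐ[P] 0 := by
  have h1 := condExp_sub (H.integrable_scaledStep ht hT j) integrable_condExp
    (ℱ (S.round i t - 1)) (μ := P) (g := P[S.scaledStep c i j t | ℱ (S.round i t - 1)])
  refine h1.trans ?_
  rw [condExp_of_stronglyMeasurable (ℱ.le _) stronglyMeasurable_condExp integrable_condExp,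
    sub_self]

/-- Concentration of the martingale part of the recursive gradient error. -/
theorem measure_abs_sum_martDiff_ge (j : Fin d) {y : ℝ} (hy : 0 ≤ y) :
    P {ω | 2 * (β * M ^ 2 * D + M * (β * M * D + 2 * R)) * √(2 * t * y)
        ≤ |∑ k ∈ Finset.range (t - 1), S.martDiff P ℱ c i j (k + 2) ω|}
      ≤ ENNReal.ofReal (2 * Real.exp (-y)) := by
  have hM := H.M_pos
  have hD := H.D_pos
  have hβ := H.β_pos
  have hR := H.R_nonneg
  have hround : ∀ k < t - 1, S.round i (k + 2) ≤ T := by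
    intro k hk
    rcases (show k + 2 ≤ t by omega).eq_or_lt with h1 | h1
    · rwa [h1]
    · exact (S.round_lt_round_self i h1).le.trans hT
  have had : ∀ k < t - 1, ∀ l < k,
      StronglyMeasurable[ℱ (S.round i (k + 2) - 1)] (S.martDiff P ℱ c i j (l + 2)) := by
    intro k hk l hl
    refine (H.stronglyMeasurable_martDiff (by omega) (hround l (by omega)) j).mono (ℱ.mono ?_)
    have := S.round_lt_round_self i (show l + 2 < k + 2 by omega)
    omega
  have hm : ∀ k < t - 1, StronglyMeasurable (S.martDiff P ℱ c i j (k + 2)) := fun k hk =>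
    (H.stronglyMeasurable_martDiff (by omega) (hround k hk) j).mono (ℱ.le _)
  have hc : 0 < 2 * (β * M ^ 2 * D + M * (β * M * D + 2 * R)) := by positivity
  -- Index `k` stands for step `k + 2`: the differences start at step 2, since `d₁` is not
  -- recursive.
  have hpos := measure_sum_ge_le_exp_neg (P := P) (𝒢 := fun k => ℱ (S.round i (k + 2) - 1))
    (ξ := fun k => S.martDiff P ℱ c i j (k + 2)) (fun k => ℱ.le _) hc hm had
    (fun k hk => H.ae_abs_martDiff_le (by omega) (hround k hk) j)
    (fun k hk => H.condExp_martDiff (by omega) (hround k hk) j) (Nat.sub_le t 1) ht hy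
  have hneg := measure_sum_ge_le_exp_neg (P := P) (𝒢 := fun k => ℱ (S.round i (k + 2) - 1))
    (ξ := fun k => -S.martDiff P ℱ c i j (k + 2)) (fun k => ℱ.le _) hc
    (fun k hk => (hm k hk).neg) (fun k hk l hl => (had k hk l hl).neg)
    (fun k hk => by
      simpa only [Pi.neg_apply, abs_neg] using H.ae_abs_martDiff_le (by omega) (hround k hk) j)
    (fun k hk => by
      refine (condExp_neg _ _).trans ?_
      filter_upwards [H.condExp_martDiff (by omega) (hround k hk) j] with ω hω
      simp [hω]) (Nat.sub_le t 1) ht hy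
  have hsub : {ω | 2 * (β * M ^ 2 * D + M * (β * M * D + 2 * R)) * √(2 * t * y)
        ≤ |∑ k ∈ Finset.range (t - 1), S.martDiff P ℱ c i j (k + 2) ω|}
      ⊆ {ω | 2 * (β * M ^ 2 * D + M * (β * M * D + 2 * R)) * √(2 * t * y)
        ≤ ∑ k ∈ Finset.range (t - 1), S.martDiff P ℱ c i j (k + 2) ω} ∪
        {ω | 2 * (β * M ^ 2 * D + M * (β * M * D + 2 * R)) * √(2 * t * y)
        ≤ ∑ k ∈ Finset.range (t - 1), (-S.martDiff P ℱ c i j (k + 2)) ω} := by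
    intro ω hω
    simp only [Set.mem_union, Set.mem_ofPred_eq, Pi.neg_apply, Finset.sum_neg_distrib] at hω ⊢
    exact le_abs.1 hω
  rw [two_mul (Real.exp (-y)), ENNReal.ofReal_add (Real.exp_pos _).le (Real.exp_pos _).le]
  exact (measure_mono hsub).trans ((measure_union_le _ _).trans (add_le_add hpos hneg))

end MartDiff

section Decomposition

variable [IsProbabilityMeasure P]

/-- Subtract `(t + 1) ∇F_t(θ_t)` from the scaled recursion and centre the increment. What remains is
`t` times the conditional mean at `θ_{t-1}` in step `t - 1` minus that in step `t`. -/
theorem ae_gradError_step (ht : 2 ≤ t) (hT : S.round i t ≤ T) :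
    ∀ᵐ ω ∂P, ∀ j, ((t : ℝ) + 1) * (S.grad i t ω j - S.condGrad P ℱ i t ω j)
      = t * (S.grad i (t - 1) ω j - S.condGrad P ℱ i (t - 1) ω j)
        + (S.martDiff P ℱ c i j t ω + t * S.drift P ℱ c i j t ω) := by
  have ht1 : 1 ≤ t := by omega
  have hT' : S.round i (t - 1) ≤ T := S.round_le_of_le (Nat.sub_le t 1) hT
  have hm := H.run.measurable_est_self i le_rfl hT
  have hm' := H.run.measurable_est_self i (Nat.sub_le t 1) hT
  have hce : ∀ᵐ ω ∂P, ∀ j, (P[S.scaledStep c i j t | ℱ (S.round i t - 1)]) ω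
      = ((t : ℝ) + 1) * (P[S.armGrad c i t j (S.est i t) | ℱ (S.round i t - 1)]) ω
        - t * (P[S.armGrad c i t j (S.est i (t - 1)) | ℱ (S.round i t - 1)]) ω := by
    refine ae_all_iff.2 fun j => ?_
    have i1 := H.integrable_armGrad ht1 hT hm (H.est_mem i t) j
    have i2 := H.integrable_armGrad ht1 hT hm' (H.est_mem i (t - 1)) j
    have e : S.scaledStep c i j t = ((t : ℝ) + 1) • S.armGrad c i t j (S.est i t)
        - (t : ℝ) • S.armGrad c i t j (S.est i (t - 1)) := rfl
    rw [e]
    filter_upwards [condExp_sub (i1.smul ((t : ℝ) + 1)) (i2.smul (t : ℝ)) (ℱ (S.round i t - 1)),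
      condExp_smul (μ := P) ((t : ℝ) + 1) (S.armGrad c i t j (S.est i t)) (ℱ (S.round i t - 1)),
      condExp_smul (μ := P) (t : ℝ) (S.armGrad c i t j (S.est i (t - 1))) (ℱ (S.round i t - 1))]
      with ω h1 h2 h3
    rw [h1, Pi.sub_apply, h2, h3]
    rfl
  filter_upwards [hce, H.ae_condGrad_eq ht1 hT, H.ae_condGrad_eq (by omega) hT',
    H.ae_glmGrad_eq ht1 hT (H.est_mem i t), H.ae_glmGrad_eq ht1 hT (H.est_mem i (t - 1))]
    with ω h1 h2 h3 h4 h5 j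
  have h6 := recGrad_step (ζ := B.link) (θ := fun k => S.est i k ω)
    (z := fun k => S.sample i k ω) ht j
  simp only [h4, h5] at h6
  simp only [Run.grad, Run.martDiff, Run.drift, Run.scaledStep, Pi.sub_apply, h1, h2, h3] at h6 ⊢
  linear_combination h6

theorem ae_gradError_eq_sum (ht : 1 ≤ t) (hT : S.round i t ≤ T) :
    ∀ᵐ ω ∂P, ∀ j, ((t : ℝ) + 1) * (S.grad i t ω j - S.condGrad P ℱ i t ω j)
      = 2 * (S.grad i 1 ω j - S.condGrad P ℱ i 1 ω j)
        + ∑ k ∈ Finset.range (t - 1),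
          (S.martDiff P ℱ c i j (k + 2) ω + (k + 2 : ℕ) * S.drift P ℱ c i j (k + 2) ω) := by
  induction t, ht using Nat.le_induction with
  | base =>
    refine Filter.Eventually.of_forall fun ω j => ?_
    simp
    left
    norm_num
  | succ t ht ih =>
    filter_upwards [ih (S.round_le_of_le (Nat.le_succ t) hT),
      H.ae_gradError_step (by omega) hT] with ω h1 h2 j
    obtain ⟨n, rfl⟩ := Nat.exists_eq_add_of_le' ht
    have h1 := h1 j
    simp only [Nat.add_sub_cancel] at h1 h2 ⊢
    rw [h2 j, Finset.sum_range_succ, ← add_assoc (2 * _), ← h1]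
    push_cast
    ring

theorem ae_abs_gradError_one_le (hT : S.round i 1 ≤ T) :
    ∀ᵐ ω ∂P, ∀ j, |S.grad i 1 ω j - S.condGrad P ℱ i 1 ω j|
      ≤ 2 * (M * (β * M * D + 2 * R)) := by
  have hb := fun j => H.ae_abs_armGrad_le le_rfl hT (H.est_mem i 1) j
  have hb' := fun j => ae_bdd_abs_condExp_of_ae_bdd_abs (m := ℱ (S.round i 1 - 1)) (hb j)
  filter_upwards [H.ae_condGrad_eq le_rfl hT, H.ae_glmGrad_eq le_rfl hT (H.est_mem i 1),
    ae_all_iff.2 hb, ae_all_iff.2 hb'] with ω h1 h2 h3 h4 j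
  have h5 : S.grad i 1 ω j = S.armGrad c i 1 j (S.est i 1) ω := h2 j
  rw [h1, h5, two_mul]
  exact (abs_sub _ _).trans (add_le_add (h3 j) (h4 j))

theorem ae_drift_eq_zero (ht : 2 ≤ t) (ht0 : t ≤ S.t0) (hT : S.round i t ≤ T) (j : Fin d) :
    ∀ᵐ ω ∂P, S.drift P ℱ c i j t ω = 0 := by
  have hT' : S.round i (t - 1) ≤ T := S.round_le_of_le (Nat.sub_le t 1) hT
  filter_upwards [H.condExp_armGrad_warm (by omega) hT ht0
      (H.run.measurable_est_self i (Nat.sub_le t 1) hT) j,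
    H.condExp_armGrad_warm (by omega) hT' (by omega)
      (H.run.measurable_est_self i le_rfl hT') j] with ω h1 h2
  rw [Run.drift, h1, h2, sub_self]

theorem ae_abs_drift_succ_t0_le (hi : i ∈ Kopt) (ht : t = S.t0 + 1) (hT : S.round i t ≤ T)
    (j : Fin d) :
    ∀ᵐ ω ∂P, S.Localized Kopt M β h ell t ω → |S.drift P ℱ c i j t ω|
      ≤ M * √(4 * β * excess (clamp B.link c) B.law (B.param i) (S.est i S.t0 ω)) := by
  have hT' : S.round i (t - 1) ≤ T := S.round_le_of_le (Nat.sub_le t 1) hT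
  have ht0 := H.t0_pos
  have hprob := H.bounded.prob
  filter_upwards [H.condExp_armGrad_greedy hT hi (by omega)
      (H.run.measurable_est_self i (Nat.sub_le t 1) hT) (H.est_mem i (t - 1)) j,
    H.condExp_armGrad_warm (by omega) hT' (by omega)
      (H.run.measurable_est_self i le_rfl hT') j] with ω h1 h2 hloc
  rw [Run.drift, h1 hloc, h2]
  have e : t - 1 = S.t0 := by omega
  rw [e]
  exact abs_riskGrad_sub_regionGrad_le H.M_pos.le H.β_pos H.bounded.ae_norm_le
    (H.link_continuous i) (H.link_monotone i) (H.link_lipschitz i)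
    (measurableSet_bestSet _ _ _) _ _ _

/-- Both steps are greedy, so only the region of the arm changes. Scores move by at most `M D / t`,
hence by the margin condition the symmetric difference has probability at most `2 ν M D / t`. -/
theorem ae_abs_drift_le (hi : i ∈ Kopt) (ht : S.t0 + 2 ≤ t) (hT : S.round i t ≤ T)
    (j : Fin d) :
    ∀ᵐ ω ∂P, S.Localized Kopt M β h ell t ω → t * |S.drift P ℱ c i j t ω|
      ≤ 2 * β * M ^ 3 * D * ν * l1 (S.est i (t - 1) ω - B.param i) := by
  have hT' : S.round i (t - 1) ≤ T := S.round_le_of_le (Nat.sub_le t 1) hT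
  have hM := H.M_pos
  have hD := H.D_pos
  have hβ := H.β_pos
  have hν := H.ν_pos
  have hprob := H.bounded.prob
  have ht' : (0 : ℝ) < t := by exact_mod_cast (by omega : 0 < t)
  filter_upwards [H.condExp_armGrad_greedy hT hi (by omega)
      (H.run.measurable_est_self i (Nat.sub_le t 1) hT) (H.est_mem i (t - 1)) j,
    H.condExp_armGrad_greedy hT' hi (by omega)
      (H.run.measurable_est_self i le_rfl hT') (H.est_mem i (t - 1)) j] with ω h1 h2 hloc
  rw [Run.drift, h1 hloc, h2 (hloc.mono (Nat.sub_le t 1))]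
  have h3 := abs_regionGrad_sub_le (j := j) hM.le hβ.le H.bounded.ae_norm_le (H.link_continuous i)
    (H.link_lipschitz i) (measurableSet_bestSet Kopt i fun k => S.est k (t - 1) ω)
    (measurableSet_bestSet Kopt i fun k => S.est k t ω) (S.est i (t - 1) ω) (B.param i)
  have h4 : B.law.real {x | ¬(x ∈ (bestSet Kopt i fun k => S.est k (t - 1) ω) ↔
      x ∈ bestSet Kopt i fun k => S.est k t ω)} ≤ ν * (2 * (M * (D / t))) := by
    refine ENNReal.toReal_le_of_le_ofReal (by positivity) ?_
    refine le_trans (measure_mono_ae ?_) (H.margin (fun k => S.est k t ω)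
      (fun k hk => (hloc.2 t (by omega) le_rfl k hk).1) (2 * (M * (D / t))) (by positivity))
    filter_upwards [H.bounded.ae_norm_le] with x hx hxW
    refine symmDiff_bestSet_subset_gapSet hi (fun k _ => ?_) hxW
    rw [← dotProduct_sub]
    refine (abs_dotProduct_le _ _).trans (mul_le_mul hx ?_ (l1_nonneg _) hM.le)
    exact Run.l1_est_sub_le H.bounded H.run.init_mem k (by omega) ω
  have h5 : 0 ≤ β * M ^ 2 * l1 (S.est i (t - 1) ω - B.param i) := by
    have := l1_nonneg (S.est i (t - 1) ω - B.param i)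
    positivity
  calc _ ≤ (t : ℝ) * (β * M ^ 2 * l1 (S.est i (t - 1) ω - B.param i)
        * (ν * (2 * (M * (D / t))))) :=
        mul_le_mul_of_nonneg_left (h3.trans (mul_le_mul_of_nonneg_left h4 h5)) ht'.le
    _ = _ := by
        field_simp

/-- The recursive gradient error during the warm-up. -/
theorem ae_abs_gradError_warm_le (ht : 1 ≤ t) (ht0 : t ≤ S.t0) (hT : S.round i t ≤ T) :
    ∀ᵐ ω ∂P, ∀ j, ((t : ℝ) + 1) * |S.grad i t ω j - S.condGrad P ℱ i t ω j|
      ≤ 4 * (M * (β * M * D + 2 * R))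
        + |∑ k ∈ Finset.range (t - 1), S.martDiff P ℱ c i j (k + 2) ω| := by
  have h0 : ∀ᵐ ω ∂P, ∀ j, ∀ k, k + 2 ≤ t → S.drift P ℱ c i j (k + 2) ω = 0 := by
    refine ae_all_iff.2 fun j => ae_all_iff.2 fun k => ?_
    by_cases hk : k + 2 ≤ t
    · filter_upwards [H.ae_drift_eq_zero (by omega) (by omega) (S.round_le_of_le hk hT) j] with ω h _
      exact h
    · exact Filter.Eventually.of_forall fun ω h => absurd h hk
  filter_upwards [H.ae_gradError_eq_sum ht hT, H.ae_abs_gradError_one_le (S.round_le_of_le ht hT),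
    h0] with ω h1 h2 h3 j
  have e : ((t : ℝ) + 1) * |S.grad i t ω j - S.condGrad P ℱ i t ω j|
      = |((t : ℝ) + 1) * (S.grad i t ω j - S.condGrad P ℱ i t ω j)| := by
    rw [abs_mul, abs_of_pos (by positivity : (0 : ℝ) < t + 1)]
  have e2 : ∑ k ∈ Finset.range (t - 1),
      (S.martDiff P ℱ c i j (k + 2) ω + (k + 2 : ℕ) * S.drift P ℱ c i j (k + 2) ω)
      = ∑ k ∈ Finset.range (t - 1), S.martDiff P ℱ c i j (k + 2) ω := by
    refine Finset.sum_congr rfl fun k hk => ?_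
    rw [Finset.mem_range] at hk
    rw [h3 j k (by omega), mul_zero, add_zero]
  rw [e, h1 j, e2]
  refine (abs_add_le _ _).trans (add_le_add_left ?_ _)
  rw [abs_mul, abs_two]
  linarith [h2 j]

/-- The recursive gradient error after the warm-up. -/
theorem ae_abs_gradError_le (hi : i ∈ Kopt) (ht0 : S.t0 < t) (hT : S.round i t ≤ T) :
    ∀ᵐ ω ∂P, S.Localized Kopt M β h ell t ω → ∀ j,
      ((t : ℝ) + 1) * |S.grad i t ω j - S.condGrad P ℱ i t ω j|
      ≤ 4 * (M * (β * M * D + 2 * R))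
        + |∑ k ∈ Finset.range (t - 1), S.martDiff P ℱ c i j (k + 2) ω|
        + ((S.t0 : ℝ) + 1) * (M * √(4 * β * excess (clamp B.link c) B.law (B.param i)
            (S.est i S.t0 ω)))
        + 2 * β * M ^ 3 * D * ν * S.cumError i t ω := by
  have hM := H.M_pos
  have hD := H.D_pos
  have hβ := H.β_pos
  have hν := H.ν_pos
  have ht0p := H.t0_pos
  set q : Ω → ℝ := fun ω => M * √(4 * β * excess (clamp B.link c) B.law (B.param i)
    (S.est i S.t0 ω)) with hq
  have hq0 : ∀ ω, 0 ≤ q ω := fun ω => by positivity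
  -- Step `t₀ + 1` receives the second summand as well, though it does not need it, so that these
  -- summands add up to the full `cumError`.
  have hdr : ∀ᵐ ω ∂P, S.Localized Kopt M β h ell t ω → ∀ j, ∀ k, k + 2 ≤ t →
      ((k + 2 : ℕ) : ℝ) * |S.drift P ℱ c i j (k + 2) ω| ≤
        (if k + 2 = S.t0 + 1 then ((S.t0 : ℝ) + 1) * q ω else 0) +
        (if S.t0 + 1 ≤ k + 2 then 2 * β * M ^ 3 * D * ν * l1 (S.est i (k + 2 - 1) ω - B.param i)
          else 0) := by
    have : ∀ j k, ∀ᵐ ω ∂P, S.Localized Kopt M β h ell t ω → k + 2 ≤ t →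
      ((k + 2 : ℕ) : ℝ) * |S.drift P ℱ c i j (k + 2) ω| ≤
        (if k + 2 = S.t0 + 1 then ((S.t0 : ℝ) + 1) * q ω else 0) +
        (if S.t0 + 1 ≤ k + 2 then 2 * β * M ^ 3 * D * ν * l1 (S.est i (k + 2 - 1) ω - B.param i)
          else 0) := by
      intro j k
      by_cases hk : k + 2 ≤ t
      · have hTk := S.round_le_of_le hk hT
        rcases lt_trichotomy (k + 2) (S.t0 + 1) with hc | hc | hc
        · filter_upwards [H.ae_drift_eq_zero (by omega) (by omega) hTk j] with ω h1 _ _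
          rw [h1, if_neg hc.ne, if_neg hc.not_ge]
          simp
        · filter_upwards [H.ae_abs_drift_succ_t0_le hi hc hTk j] with ω h1 hloc _
          have h2 : |S.drift P ℱ c i j (k + 2) ω| ≤ q ω := h1 (hloc.mono hk)
          rw [if_pos hc, if_pos hc.ge, hc]
          rw [hc] at h2
          have h3 : 0 ≤ 2 * β * M ^ 3 * D * ν * l1 (S.est i (S.t0 + 1 - 1) ω - B.param i) := by
            have := l1_nonneg (S.est i (S.t0 + 1 - 1) ω - B.param i)
            positivity
          simp only [Nat.add_sub_cancel] at h3
          push_cast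
          have h4 := mul_le_mul_of_nonneg_left h2 (by positivity : (0 : ℝ) ≤ (S.t0 : ℝ) + 1)
          linarith
        · filter_upwards [H.ae_abs_drift_le hi (by omega) hTk j] with ω h1 hloc _
          have h2 := h1 (hloc.mono hk)
          rw [if_neg hc.ne', if_pos hc.le, zero_add]
          exact h2
      · exact Filter.Eventually.of_forall fun ω _ h => absurd h hk
    filter_upwards [ae_all_iff.2 fun j => ae_all_iff.2 (this j)] with ω h1 hloc j k
    exact h1 j k hloc
  filter_upwards [H.ae_gradError_eq_sum (by omega) hT,
    H.ae_abs_gradError_one_le (S.round_le_of_le (by omega) hT), hdr] with ω h1 h2 h3 hloc j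
  have e : ((t : ℝ) + 1) * |S.grad i t ω j - S.condGrad P ℱ i t ω j|
      = |((t : ℝ) + 1) * (S.grad i t ω j - S.condGrad P ℱ i t ω j)| := by
    rw [abs_mul, abs_of_pos (by positivity : (0 : ℝ) < t + 1)]
  have hsum : |∑ k ∈ Finset.range (t - 1), ((k + 2 : ℕ) : ℝ) * S.drift P ℱ c i j (k + 2) ω|
      ≤ ((S.t0 : ℝ) + 1) * q ω + 2 * β * M ^ 3 * D * ν * S.cumError i t ω := by
    refine (Finset.abs_sum_le_sum_abs _ _).trans ?_
    have h4 : ∀ k ∈ Finset.range (t - 1),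
        |((k + 2 : ℕ) : ℝ) * S.drift P ℱ c i j (k + 2) ω| ≤
        (if k + 2 = S.t0 + 1 then ((S.t0 : ℝ) + 1) * q ω else 0) +
        (if S.t0 + 1 ≤ k + 2 then 2 * β * M ^ 3 * D * ν * l1 (S.est i (k + 2 - 1) ω - B.param i)
          else 0) := by
      intro k hk
      rw [Finset.mem_range] at hk
      rw [abs_mul, Nat.abs_cast]
      exact h3 hloc j k (by omega)
    refine (Finset.sum_le_sum h4).trans ?_
    rw [Finset.sum_add_distrib]
    refine add_le_add ?_ (le_of_eq ?_)
    · have e1 : ∀ k, (k + 2 = S.t0 + 1) ↔ (k = S.t0 - 1) := fun k => by omega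
      simp only [e1, Finset.sum_ite_eq']
      split_ifs
      · exact le_rfl
      · have := hq0 ω
        positivity
    · rw [Run.cumError, Finset.mul_sum, ← Finset.sum_filter]
      refine Finset.sum_bij (fun k _ => k + 2) ?_ ?_ ?_ ?_
      · intro k hk
        simp only [Finset.mem_filter, Finset.mem_range, Finset.mem_Icc] at hk ⊢
        omega
      · intro k _ l _ hkl
        omega
      · intro l hl
        simp only [Finset.mem_Icc] at hl
        refine ⟨l - 2, ?_, by omega⟩
        simp only [Finset.mem_filter, Finset.mem_range]
        omega
      · intro k _
        rfl
  rw [e, h1 j, Finset.sum_add_distrib]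
  have h5 := h2 j
  have h6 := abs_add_le (2 * (S.grad i 1 ω j - S.condGrad P ℱ i 1 ω j))
    (∑ k ∈ Finset.range (t - 1), S.martDiff P ℱ c i j (k + 2) ω
      + ∑ k ∈ Finset.range (t - 1), ((k + 2 : ℕ) : ℝ) * S.drift P ℱ c i j (k + 2) ω)
  have h7 := abs_add_le (∑ k ∈ Finset.range (t - 1), S.martDiff P ℱ c i j (k + 2) ω)
    (∑ k ∈ Finset.range (t - 1), ((k + 2 : ℕ) : ℝ) * S.drift P ℱ c i j (k + 2) ω)
  rw [abs_mul, abs_two] at h6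
  linarith

end Decomposition

end Setting

/-! ### Good event and accuracy at the end of the warm-up -/

section UnionBound

theorem measure_biUnion_le_ofReal {Ω ι : Type*} [MeasurableSpace Ω] {P : Measure Ω}
    (s : Finset ι) (f : ι → Set Ω) {p : ℝ} (h : ∀ k ∈ s, P (f k) ≤ ENNReal.ofReal p) :
    P (⋃ k ∈ s, f k) ≤ ENNReal.ofReal (s.card * p) := by
  refine (measure_biUnion_finset_le s f).trans ((Finset.sum_le_card_nsmul _ _ _ h).trans ?_)
  rw [ENNReal.ofReal_mul (by positivity), ENNReal.ofReal_natCast, nsmul_eq_mul]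

end UnionBound

namespace Setting

variable {d K : ℕ} {B : GLMBandit d K} {Ω : Type*} [MeasurableSpace Ω] {S : Run B Ω}
  {P : Measure Ω} {ℱ : Filtration ℕ (inferInstance : MeasurableSpace Ω)}
  {T : ℕ} {Kopt : Finset (Fin K)} {M D β R h u ell ν c m : ℝ} {b : ℕ → ℝ}
  (H : Setting S P ℱ T Kopt M D β R h u ell ν c m b)
  {i : Fin K} {t : ℕ}

include H

theorem measure_noise_ge {n : ℕ} (hn : 1 ≤ n) (hn0 : n ≤ S.t0) (hT : S.round i n ≤ T)
    (hb : 0 < b n) (w : B.vert) {y : ℝ} (hy : 0 ≤ y) :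
    P {ω | b n * y ≤ |S.N i n w ω|} ≤ ENNReal.ofReal (Real.exp (-y)) := by
  have hp := isProbabilityMeasure_laplace hb
  have hm : Measurable (S.armNoise i n) := (H.run.meas_N i n hn hT).mono (ℱ.le _) le_rfl
  have hms : MeasurableSet {x : ℝ | b n * y ≤ |x|} :=
    measurableSet_le measurable_const measurable_id.abs
  have h1 : P {ω | b n * y ≤ |S.N i n w ω|}
      = (P.map (S.armNoise i n)) (Function.eval w ⁻¹' {x : ℝ | b n * y ≤ |x|}) := by
    rw [Measure.map_apply hm ((measurable_pi_apply w) hms)]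
    rfl
  rw [h1, H.run.law_warm i n hn hn0 hT,
    (measurePreserving_eval (fun _ : B.vert => laplace (b n)) w).measure_preimage
      hms.nullMeasurableSet, laplace_setOf_lt_abs hb hy]

variable [IsProbabilityMeasure P]

/-- With probability at least `1 - α`, the martingale parts and the noises of the warm-up, and the
martingale part at step `t`, are all small. -/
theorem exists_good_event {α : ℝ} (hα : 0 < α) (hα1 : α < 1) (ht0 : S.t0 < t)
    (hT : S.round i t ≤ T) (hb : ∀ n, 1 ≤ n → 0 < b n) :
    ∃ bad : Set Ω, P bad ≤ ENNReal.ofReal α ∧ ∀ ω ∉ bad,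
      (∀ n, 1 ≤ n → n ≤ S.t0 → ∀ j,
        |∑ k ∈ Finset.range (n - 1), S.martDiff P ℱ c i j (k + 2) ω|
          ≤ 2 * (β * M ^ 2 * D + M * (β * M * D + 2 * R))
            * √(2 * n * Real.log (8 * d * S.t0 / α))) ∧
      (∀ n, 1 ≤ n → n ≤ S.t0 → ∀ w, |S.N i n w ω| ≤ b n * Real.log (8 * d * S.t0 / α)) ∧
      ∀ j, |∑ k ∈ Finset.range (t - 1), S.martDiff P ℱ c i j (k + 2) ω|
          ≤ 2 * (β * M ^ 2 * D + M * (β * M * D + 2 * R)) * √(2 * t * Real.log (8 * d / α)) := by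
  have hd : (1 : ℝ) ≤ d := by exact_mod_cast H.bounded.dim_pos i
  have ht0p : (1 : ℝ) ≤ S.t0 := by exact_mod_cast H.t0_pos
  -- Each of the three unions below then costs at most `α/4`: `t₀ d` two-sided martingale tails, at
  -- most `2 d t₀` noise tails, and `d` two-sided tails at step `t`.
  set y := Real.log (8 * d * S.t0 / α) with hy
  set y' := Real.log (8 * d / α) with hy'
  have h8 : 1 ≤ 8 * d * S.t0 / α := by
    rw [le_div_iff₀ hα]
    nlinarith
  have h8' : 1 ≤ 8 * d / α := by
    rw [le_div_iff₀ hα]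
    linarith
  have hy0 : 0 ≤ y := Real.log_nonneg h8
  have hy0' : 0 ≤ y' := Real.log_nonneg h8'
  have hexp : Real.exp (-y) = α / (8 * d * S.t0) := by
    rw [hy, Real.exp_neg, Real.exp_log (by linarith), inv_div]
  have hexp' : Real.exp (-y') = α / (8 * d) := by
    rw [hy', Real.exp_neg, Real.exp_log (by linarith), inv_div]
  have hTn : ∀ n, n ≤ S.t0 → S.round i n ≤ T := fun n hn =>
    S.round_le_of_le (hn.trans ht0.le) hT
  set κ := 2 * (β * M ^ 2 * D + M * (β * M * D + 2 * R)) with hκ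
  set A₁ : Set Ω := ⋃ p ∈ Finset.Icc 1 S.t0 ×ˢ (Finset.univ : Finset (Fin d)),
    {ω | κ * √(2 * (p.1 : ℕ) * y)
      ≤ |∑ k ∈ Finset.range (p.1 - 1), S.martDiff P ℱ c i p.2 (k + 2) ω|} with hA₁
  set A₂ : Set Ω := ⋃ p ∈ Finset.Icc 1 S.t0 ×ˢ (Finset.univ : Finset B.vert),
    {ω | b p.1 * y ≤ |S.N i p.1 p.2 ω|} with hA₂
  set A₃ : Set Ω := ⋃ j ∈ (Finset.univ : Finset (Fin d)),
    {ω | κ * √(2 * t * y') ≤ |∑ k ∈ Finset.range (t - 1), S.martDiff P ℱ c i j (k + 2) ω|} with hA₃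
  have h1 : P A₁ ≤ ENNReal.ofReal (α / 4) := by
    refine (measure_biUnion_le_ofReal _ _ (p := 2 * Real.exp (-y)) fun p hp => ?_).trans
      (ENNReal.ofReal_le_ofReal ?_)
    · simp only [Finset.mem_product, Finset.mem_Icc] at hp
      exact H.measure_abs_sum_martDiff_ge hp.1.1 (hTn _ hp.1.2) p.2 hy0
    · rw [hexp, Finset.card_product, Nat.card_Icc, Finset.card_univ, Fintype.card_fin]
      push_cast [Nat.add_sub_cancel]
      refine le_of_eq ?_
      field_simp
      ring
  have h2 : P A₂ ≤ ENNReal.ofReal (α / 4) := by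
    refine (measure_biUnion_le_ofReal _ _ (p := Real.exp (-y)) fun p hp => ?_).trans
      (ENNReal.ofReal_le_ofReal ?_)
    · simp only [Finset.mem_product, Finset.mem_Icc] at hp
      exact H.measure_noise_ge hp.1.1 hp.1.2 (hTn _ hp.1.2) (hb _ hp.1.1) p.2 hy0
    · rw [hexp, Finset.card_product, Nat.card_Icc, Finset.card_univ, Fintype.card_coe]
      have hV : (B.vert.card : ℝ) ≤ 2 * d := by exact_mod_cast H.bounded.card_vert
      push_cast [Nat.add_sub_cancel]
      calc (S.t0 : ℝ) * B.vert.card * (α / (8 * d * S.t0))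
          ≤ S.t0 * (2 * d) * (α / (8 * d * S.t0)) := by gcongr
        _ = α / 4 := by
          field_simp
          ring
  have h3 : P A₃ ≤ ENNReal.ofReal (α / 4) := by
    refine (measure_biUnion_le_ofReal _ _ (p := 2 * Real.exp (-y')) fun j _ => ?_).trans
      (ENNReal.ofReal_le_ofReal ?_)
    · exact H.measure_abs_sum_martDiff_ge (by omega) hT j hy0'
    · rw [hexp', Finset.card_univ, Fintype.card_fin]
      refine le_of_eq ?_
      field_simp
      ring
  refine ⟨A₁ ∪ A₂ ∪ A₃, ?_, fun ω hω => ?_⟩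
  · refine (measure_union_le _ _).trans ((add_le_add ((measure_union_le _ _).trans
      (add_le_add h1 h2)) h3).trans ?_)
    rw [← ENNReal.ofReal_add (by positivity) (by positivity),
      ← ENNReal.ofReal_add (by positivity) (by positivity)]
    exact ENNReal.ofReal_le_ofReal (by linarith)
  · simp only [Set.mem_union, not_or, hA₁, hA₂, hA₃, Set.mem_iUnion, not_exists] at hω
    obtain ⟨⟨hω1, hω2⟩, hω3⟩ := hω
    refine ⟨fun n hn hn0 j => ?_, fun n hn hn0 w => ?_, fun j => ?_⟩
    · have := hω1 (n, j) (by simp [hn, hn0])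
      exact (not_le.1 this).le
    · have := hω2 (n, w) (by simp [hn, hn0])
      exact (not_le.1 this).le
    · have := hω3 j (Finset.mem_univ j)
      exact (not_le.1 this).le

/-- Accuracy of the estimator at the end of the warm-up. -/
theorem ae_excess_t0_le {γ σ y Q : ℝ} (hI : B.Interior i γ) (hγ : 0 < γ) (hσ0 : 0 < σ)
    (hσ : ∀ w : Fin d → ℝ, σ * (w ⬝ᵥ w) ≤ m * ∫ x, (x ⬝ᵥ w) ^ 2 ∂B.law) (hy : 0 ≤ y) (hQ : 0 ≤ Q)
    (hb : ∀ n : ℕ, b n = Q / √(n : ℝ)) (hT : S.round i S.t0 ≤ T) :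
    ∀ᵐ ω ∂P,
      (∀ n, 1 ≤ n → n ≤ S.t0 → ∀ j,
        |∑ k ∈ Finset.range (n - 1), S.martDiff P ℱ c i j (k + 2) ω|
          ≤ 2 * (β * M ^ 2 * D + M * (β * M * D + 2 * R)) * √(2 * n * y)) →
      (∀ n, 1 ≤ n → n ≤ S.t0 → ∀ w, |S.N i n w ω| ≤ b n * y) →
      excess (clamp B.link c) B.law (B.param i) (S.est i S.t0 ω)
        ≤ (6 * (D * (4 * (M * (β * M * D + 2 * R))
            + 2 * (β * M ^ 2 * D + M * (β * M * D + 2 * R)) * √(2 * y)) + 2 * (Q * y)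
            + β * (M * D) ^ 2) / (γ * √σ)) ^ 2 / S.t0 := by
  have hM := H.M_pos
  have hD := H.D_pos
  have hβ := H.β_pos
  have hR := H.R_nonneg
  have hTn : ∀ n, n ≤ S.t0 → S.round i n ≤ T := fun n hn => S.round_le_of_le hn hT
  have h1 : ∀ᵐ ω ∂P, ∀ n, 1 ≤ n → n ≤ S.t0 → ∀ j,
      ((n : ℝ) + 1) * |S.grad i n ω j - S.condGrad P ℱ i n ω j|
      ≤ 4 * (M * (β * M * D + 2 * R))
        + |∑ k ∈ Finset.range (n - 1), S.martDiff P ℱ c i j (k + 2) ω| := by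
    refine ae_all_iff.2 fun n => ?_
    by_cases hn : 1 ≤ n ∧ n ≤ S.t0
    · filter_upwards [H.ae_abs_gradError_warm_le hn.1 hn.2 (hTn n hn.2)] with ω h _ _
      exact h
    · exact Filter.Eventually.of_forall fun ω h h' => absurd ⟨h, h'⟩ hn
  have h2 : ∀ᵐ ω ∂P, ∀ n, 1 ≤ n → n ≤ S.t0 → ∀ j, S.condGrad P ℱ i n ω j
      = riskGrad (clamp B.link c) B.law (B.param i) (S.est i n ω) j := by
    refine ae_all_iff.2 fun n => ?_
    by_cases hn : 1 ≤ n ∧ n ≤ S.t0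
    · have h3 := fun j => H.condExp_armGrad_warm hn.1 (hTn n hn.2) hn.2
        (H.run.measurable_est_self i le_rfl (hTn n hn.2)) j
      filter_upwards [H.ae_condGrad_eq hn.1 (hTn n hn.2), ae_all_iff.2 h3] with ω h4 h5 _ _ j
      rw [h4, h5]
    · exact Filter.Eventually.of_forall fun ω h h' => absurd ⟨h, h'⟩ hn
  have h3 : ∀ᵐ ω ∂P, ∀ n, 1 ≤ n → n ≤ S.t0 → ∀ w : B.vert,
      S.grad i n ω ⬝ᵥ (S.v i n ω : Fin d → ℝ) + S.N i n (S.v i n ω) ω ≤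
        S.grad i n ω ⬝ᵥ (w : Fin d → ℝ) + S.N i n w ω := by
    refine ae_all_iff.2 fun n => ?_
    by_cases hn : 1 ≤ n ∧ n ≤ S.t0
    · filter_upwards [H.run.argmin_v i n hn.1 (hTn n hn.2)] with ω h _ _
      exact h
    · exact Filter.Eventually.of_forall fun ω h h' => absurd ⟨h, h'⟩ hn
  filter_upwards [h1, h2, h3] with ω h1 h2 h3 hmart hnoise
  -- The warm-up conditional gradient is the population gradient, so `Δ_n` is the gradient error of
  -- a noisy Frank-Wolfe method; dividing its scaled bound by `n` leaves order `1/√n`.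
  refine GLMBandit.excess_iterate_le H.bounded hI H.link H.m_pos hβ hM hD hγ hσ0 hσ
    (by positivity) (by positivity) (H.run.init_mem i) (fun k => S.v i k ω)
    (fun k w => S.N i k w ω) (fun k => S.grad i k ω) H.t0_pos ?_ ?_ ?_
  · intro n hn hn0 w
    refine (hnoise n hn hn0.le w).trans (le_of_eq ?_)
    rw [hb]
    ring
  · intro n hn hn0
    have hn' : (1 : ℝ) ≤ n := by exact_mod_cast hn
    rw [pi_norm_le_iff_of_nonneg (by positivity)]
    intro j
    have h4 := h1 n hn hn0.le j
    have h5 := hmart n hn hn0.le j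
    rw [h2 n hn hn0.le j] at h4
    rw [Pi.sub_apply, Real.norm_eq_abs, le_div_iff₀ (by positivity)]
    change |S.grad i n ω j - riskGrad (clamp B.link c) B.law (B.param i) (S.est i n ω) j| * _ ≤ _
    have h6 : √(2 * n * y) = √(2 * y) * √(n : ℝ) := by
      rw [← Real.sqrt_mul (by positivity)]
      ring_nf
    rw [h6] at h5
    set x := |S.grad i n ω j - riskGrad (clamp B.link c) B.law (B.param i) (S.est i n ω) j|
    set q := √(n : ℝ) with hq
    have hq1 : 1 ≤ q := by rw [hq, Real.one_le_sqrt]; exact hn'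
    have hqq : q * q = n := Real.mul_self_sqrt (by positivity)
    have hx : 0 ≤ x := abs_nonneg _
    refine le_of_mul_le_mul_right ?_ (lt_of_lt_of_le one_pos hq1)
    have h7 : 4 * (M * (β * M * D + 2 * R)) ≤ 4 * (M * (β * M * D + 2 * R)) * q :=
      le_mul_of_one_le_right (by positivity) hq1
    calc x * q * q = n * x := by rw [mul_assoc, hqq, mul_comm]
      _ ≤ ((n : ℝ) + 1) * x := by linarith
      _ ≤ _ := by linarith
  · intro n hn hn0
    exact h3 n hn hn0.le

end Setting

/-! ### Comparison of constants -/

section Constants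

theorem noiseScale_eq (D β L ε δ : ℝ) (T n : ℕ) :
    noiseScale D β L ε δ T n
      = 4 * D * (β * D + L) * √(Real.log T * Real.log (1 / δ)) / ε / √(n : ℝ) := by
  rw [noiseScale, div_div]

variable {D β G L ε δ α : ℝ} {d T t₀ : ℕ}

theorem one_le_log_of_three_le {x : ℝ} (hx : 3 ≤ x) : 1 ≤ Real.log x := by
  rw [Real.le_log_iff_exp_le (by linarith)]
  have := Real.exp_one_lt_d9
  linarith

theorem log_le_log_div (hd : 1 ≤ d) (ht₀ : 1 ≤ t₀) (hT : 2 ≤ T) (hα : 0 < α) :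
    Real.log (8 * d * t₀ / α) ≤ Real.log (4 * d * T / (α / (d + t₀))) := by
  have hd' : (1 : ℝ) ≤ d := by exact_mod_cast hd
  have ht' : (1 : ℝ) ≤ t₀ := by exact_mod_cast ht₀
  have hT' : (2 : ℝ) ≤ T := by exact_mod_cast hT
  refine Real.log_le_log (by positivity) ?_
  rw [div_div_eq_mul_div]
  refine div_le_div_of_nonneg_right ?_ hα.le
  calc 8 * (d : ℝ) * t₀ = 4 * d * 2 * t₀ := by ring
    _ ≤ 4 * d * T * (d + t₀) := by
      gcongr
      linarith

theorem constA_nonneg (hD : 0 < D) (hβ : 0 < β) (hG : 0 ≤ G) (hL : 0 ≤ L) (hε : 0 < ε)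
    {x : ℝ} (h : 0 ≤ Real.log (4 * d * T / x)) : 0 ≤ constA D β G L ε δ d T x := by
  unfold constA
  positivity

theorem constA_anti (hD : 0 < D) (hβ : 0 < β) (hG : 0 ≤ G) (hL : 0 ≤ L) (hε : 0 < ε)
    (hd : 1 ≤ d) (hT : 1 ≤ T) {x y : ℝ} (hx : 0 < x) (hxy : x ≤ y) :
    constA D β G L ε δ d T y ≤ constA D β G L ε δ d T x := by
  have hd' : (1 : ℝ) ≤ d := by exact_mod_cast hd
  have hT' : (1 : ℝ) ≤ T := by exact_mod_cast hT
  have hy : 0 < y := hx.trans_le hxy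
  unfold constA
  gcongr

/-- The warm-up errors are dominated by `β D² + A`. -/
theorem warmup_error_le {M c₁ L₀ : ℝ} (hD : 0 < D) (hβ : 0 < β) (hG : 0 ≤ G) (hL : 0 ≤ L)
    (hε : 0 < ε) (hL₀ : 0 ≤ L₀) (hc₁ : 0 ≤ c₁) (hd : 1 ≤ d) (ht₀ : 1 ≤ t₀) (hT : 2 ≤ T)
    (hα : 0 < α) (hα1 : α < 1) :
    D * (4 * L₀ + c₁ * √(2 * Real.log (8 * d * t₀ / α)))
        + 2 * (4 * D * (β * D + L) * √(Real.log T * Real.log (1 / δ)) / ε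
          * Real.log (8 * d * t₀ / α)) + β * (M * D) ^ 2
      ≤ (1 + (4 * L₀ + 2 * c₁) / (8 * β * D) + M ^ 2)
        * (β * D ^ 2 + constA D β G L ε δ d T (α / (d + t₀))) := by
  have hd' : (1 : ℝ) ≤ d := by exact_mod_cast hd
  have ht' : (1 : ℝ) ≤ t₀ := by exact_mod_cast ht₀
  have hT' : (2 : ℝ) ≤ T := by exact_mod_cast hT
  have h42 := log_le_log_div hd ht₀ hT hα
  have hy1 : 1 ≤ Real.log (8 * d * t₀ / α) := by
    refine one_le_log_of_three_le ?_
    rw [le_div_iff₀ hα]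
    nlinarith
  have h48 : Real.log (4 * d * T / (α / (d + t₀))) ≤ Real.log (8 * d * T / (α / (d + t₀))) := by
    refine Real.log_le_log (by positivity) ?_
    gcongr
    norm_num
  rw [constA]
  set y := Real.log (8 * d * t₀ / α)
  set Y₂ := Real.log (4 * d * T / (α / (d + t₀)))
  set Y₁ := Real.log (8 * d * T / (α / (d + t₀)))
  set r := √(Real.log T * Real.log (1 / δ))
  set κ := (4 * L₀ + 2 * c₁) / (8 * β * D) with hκ
  have hr : 0 ≤ r := Real.sqrt_nonneg _
  have hκ0 : 0 ≤ κ := by positivity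
  have hs1 : 1 ≤ √Y₁ := by rw [Real.one_le_sqrt]; linarith
  have hs2 : √(2 * y) ≤ 2 * √Y₁ := by
    rw [Real.sqrt_le_left (by positivity), mul_pow, Real.sq_sqrt (by linarith)]
    linarith
  -- `κ` is the ratio for which `8 D · β D` alone absorbs the gradient error. The noise term is
  -- absorbed by the second summand of `A`, and `β (M D)²` by `M² · β D²`.
  have a1 : D * (4 * L₀ + c₁ * √(2 * y)) ≤ κ * (8 * D * (β * D + G) * √Y₁) := by
    have a0 : 4 * L₀ ≤ 4 * L₀ * √Y₁ := le_mul_of_one_le_right (by positivity) hs1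
    calc D * (4 * L₀ + c₁ * √(2 * y)) ≤ D * (4 * L₀ * √Y₁ + c₁ * (2 * √Y₁)) :=
          mul_le_mul_of_nonneg_left (add_le_add a0 (mul_le_mul_of_nonneg_left hs2 hc₁)) hD.le
      _ = κ * (8 * D * (β * D) * √Y₁) := by
          rw [hκ]
          field_simp
      _ ≤ _ := by
          gcongr
          linarith
  have a2 : 2 * (4 * D * (β * D + L) * r / ε * y) ≤ 16 * D * (β * D + L) * Y₂ * r / ε := by
    have h0 : 0 ≤ D * (β * D + L) * r / ε := by positivity
    have e1 : 2 * (4 * D * (β * D + L) * r / ε * y) = D * (β * D + L) * r / ε * (8 * y) := by ring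
    have e2 : 16 * D * (β * D + L) * Y₂ * r / ε = D * (β * D + L) * r / ε * (16 * Y₂) := by ring
    rw [e1, e2]
    exact mul_le_mul_of_nonneg_left (by linarith) h0
  set A₁ := 8 * D * (β * D + G) * √Y₁ with hA₁
  set A₂ := 16 * D * (β * D + L) * Y₂ * r / ε with hA₂
  have hA₁0 : 0 ≤ A₁ := by positivity
  have hA₂0 : 0 ≤ A₂ := by
    have : 0 ≤ Y₂ := by linarith
    positivity
  have hBD : 0 ≤ β * D ^ 2 := by positivity
  have hM2 : 0 ≤ M ^ 2 := sq_nonneg M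
  have e3 : (1 + κ + M ^ 2) * (β * D ^ 2 + (A₁ + A₂))
      = κ * A₁ + A₂ + β * (M * D) ^ 2 + (A₁ + M ^ 2 * (A₁ + A₂) + κ * A₂ + β * D ^ 2
        + κ * (β * D ^ 2)) := by ring
  rw [e3]
  have : 0 ≤ A₁ + M ^ 2 * (A₁ + A₂) + κ * A₂ + β * D ^ 2 + κ * (β * D ^ 2) := by positivity
  linarith

theorem constSC_eq {A γ u m lam : ℝ} (hA : 0 ≤ β * D ^ 2 + A) (hγ : 0 < γ) (hσ : 0 < u * m * lam) :
    constSC D β A γ u m lam = 3 * (β * D ^ 2 + A) / (γ * √(u * m * lam)) := by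
  rw [constSC]
  have e : 9 * (β * D ^ 2 + A) ^ 2 / (γ ^ 2 * u * m * lam)
      = (3 * (β * D ^ 2 + A) / (γ * √(u * m * lam))) ^ 2 := by
    rw [div_pow, mul_pow, mul_pow, Real.sq_sqrt hσ.le]
    ring
  rw [e, Real.sqrt_sq (by positivity)]

/-- The last step of the comparison with the two bounds of the theorem. -/
theorem bounds_of_scaled_bound {M L₀ c₁ κ x e cum ν s₁ s₂ y Λ t t₀ C : ℝ} (hM : 0 < M) (hD : 0 < D)
    (hβ : 0 < β) (hL₀ : 0 ≤ L₀) (hc₁ : 0 ≤ c₁) (hκ : 0 ≤ κ) (hx0 : 0 ≤ x) (hcum : 0 ≤ cum)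
    (hν : 0 < ν) (hs₂ : 0 ≤ s₂) (hs : s₂ ≤ s₁) (hy : y ≤ 4 * Λ) (hΛ : 1 ≤ Λ) (ht : 1 ≤ t)
    (ht₀ : 1 ≤ t₀)
    (hC : C = (4 * L₀ + 3 * c₁) / (M * D + β) + 8 * M * κ / √β + 8 * κ / (√β * D)
      + 2 * M ^ 2 + 1)
    (he : e ≤ (2 * κ * s₂) ^ 2 / t₀)
    (hx : (t + 1) * x ≤ 4 * L₀ + c₁ * √(2 * t * y) + (t₀ + 1) * (M * √(4 * β * e))
      + 2 * β * M ^ 3 * D * ν * cum) :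
    x ≤ C * (β / t * (M * D + s₁ * (M + √Λ) * √t₀ + D * M * ν * cum)
        + (M * D + β) * √Λ / √t) ∧
      x ≤ C * (√Λ * ((M * D + β) / √t + β * D * M / t * (s₂ * √t₀ + ν * cum))) := by
  have ht0 : 0 < t := by linarith
  have ht00 : 0 < t₀ := by linarith
  set b := √β with hb
  have hb0 : 0 < b := Real.sqrt_pos.2 hβ
  have hbb : b * b = β := Real.mul_self_sqrt hβ.le
  set q := √t with hq
  set q₀ := √t₀ with hq₀
  set l := √Λ with hl
  have hq1 : 1 ≤ q := by rw [hq, Real.one_le_sqrt]; exact ht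
  have hl1 : 1 ≤ l := by rw [hl, Real.one_le_sqrt]; exact hΛ
  have hqq : q * q = t := Real.mul_self_sqrt ht0.le
  have hq₀0 : 0 < q₀ := Real.sqrt_pos.2 ht00
  have hqq₀ : q₀ * q₀ = t₀ := Real.mul_self_sqrt ht00.le
  have h1 : √(2 * t * y) ≤ 3 * q * l := by
    calc √(2 * t * y) ≤ √((3 * q * l) ^ 2) := by
          refine Real.sqrt_le_sqrt ?_
          rw [mul_pow, mul_pow, Real.sq_sqrt ht0.le, Real.sq_sqrt (by linarith)]
          nlinarith
      _ = _ := Real.sqrt_sq (by positivity)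
  have h2 : √(4 * β * e) ≤ 4 * b * κ * s₂ / q₀ := by
    calc √(4 * β * e) ≤ √((4 * b * κ * s₂ / q₀) ^ 2) := by
          refine Real.sqrt_le_sqrt ?_
          calc 4 * β * e ≤ 4 * β * ((2 * κ * s₂) ^ 2 / t₀) := by gcongr
            _ = _ := by
              rw [← hbb, ← hqq₀]
              field_simp
              ring
      _ = _ := Real.sqrt_sq (by positivity)
  have h3 : (t₀ + 1) * (M * √(4 * β * e)) ≤ 8 * M * b * κ * (s₂ * q₀) := by
    calc (t₀ + 1) * (M * √(4 * β * e)) ≤ (2 * t₀) * (M * (4 * b * κ * s₂ / q₀)) := by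
          gcongr
          linarith
      _ = _ := by
          rw [← hqq₀]
          field_simp
          ring
  have hql : 1 ≤ q * l := one_le_mul_of_one_le_of_one_le hq1 hl1
  have hxt : t * x ≤ (4 * L₀ + 3 * c₁) * (q * l) + 8 * M * b * κ * (s₂ * q₀)
      + 2 * M ^ 2 * (β * (D * M * ν * cum)) := by
    have a1 : 4 * L₀ ≤ 4 * L₀ * (q * l) := le_mul_of_one_le_right (by positivity) hql
    have a2 : c₁ * √(2 * t * y) ≤ c₁ * (3 * q * l) := by gcongr
    linarith
  have hMDβ : 0 < M * D + β := by positivity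
  have hcx : 0 ≤ D * M * ν * cum := by positivity
  have hsq : 0 ≤ s₂ * q₀ := by positivity
  have C0 : 0 < C := by rw [hC]; positivity
  -- Each summand of `C` pays for one term: `C1` the martingale, `C2` and `C3` the switch to greedy
  -- play in the first and second bound, `C4` the later drift.
  have C1 : 4 * L₀ + 3 * c₁ ≤ C * (M * D + β) := by
    rw [← div_le_iff₀ hMDβ, hC]
    have : 0 ≤ 8 * M * κ / b + 8 * κ / (b * D) + 2 * M ^ 2 + 1 := by positivity
    linarith
  have C2 : 8 * M * b * κ ≤ C * β := by
    have : 8 * M * κ / b ≤ C := by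
      rw [hC]
      have : 0 ≤ (4 * L₀ + 3 * c₁) / (M * D + β) + 8 * κ / (b * D) + 2 * M ^ 2 + 1 := by positivity
      linarith
    calc 8 * M * b * κ = 8 * M * κ / b * β := by rw [← hbb]; field_simp
      _ ≤ C * β := by gcongr
  have C3 : 8 * M * b * κ ≤ C * (β * D * M) := by
    have : 8 * κ / (b * D) ≤ C := by
      rw [hC]
      have : 0 ≤ (4 * L₀ + 3 * c₁) / (M * D + β) + 8 * M * κ / b + 2 * M ^ 2 + 1 := by positivity
      linarith
    calc 8 * M * b * κ = 8 * κ / (b * D) * (β * D * M) := by rw [← hbb]; field_simp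
      _ ≤ C * (β * D * M) := by gcongr
  have C4 : 2 * M ^ 2 ≤ C := by
    rw [hC]
    have : 0 ≤ (4 * L₀ + 3 * c₁) / (M * D + β) + 8 * M * κ / b + 8 * κ / (b * D) + 1 := by
      positivity
    linarith
  have b1 : (4 * L₀ + 3 * c₁) * (q * l) ≤ C * (M * D + β) * (q * l) := by gcongr
  have b4 : 2 * M ^ 2 * (β * (D * M * ν * cum)) ≤ C * (β * (D * M * ν * cum)) := by gcongr
  constructor
  · refine le_of_mul_le_mul_left ?_ ht0
    have e1 : t * (C * (β / t * (M * D + s₁ * (M + l) * q₀ + D * M * ν * cum)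
        + (M * D + β) * l / q))
        = C * (β * (M * D + s₁ * (M + l) * q₀ + D * M * ν * cum)) + C * (M * D + β) * (q * l) := by
      rw [← hqq]
      field_simp
    rw [e1]
    -- The first bound has room to spare: `s₂ ≤ s₁` and `M + √Λ ≥ 1`.
    have b2 : 8 * M * b * κ * (s₂ * q₀) ≤ C * β * (s₁ * (M + l) * q₀) := by
      have : s₂ * q₀ ≤ s₁ * (M + l) * q₀ := by
        gcongr
        calc s₂ ≤ s₁ := hs
          _ ≤ s₁ * (M + l) := le_mul_of_one_le_right (hs₂.trans hs) (by linarith)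
      exact mul_le_mul C2 this hsq (by positivity)
    have b3 : 0 ≤ C * (β * (M * D)) := by positivity
    linarith
  · refine le_of_mul_le_mul_left ?_ ht0
    have e1 : t * (C * (l * ((M * D + β) / q + β * D * M / t * (s₂ * q₀ + ν * cum))))
        = C * (M * D + β) * (q * l) + l * (C * (β * D * M) * (s₂ * q₀)
          + C * (β * (D * M * ν * cum))) := by
      rw [← hqq]
      field_simp
    rw [e1]
    have b2 : 8 * M * b * κ * (s₂ * q₀) ≤ C * (β * D * M) * (s₂ * q₀) := by gcongr
    have b3 : C * (β * D * M) * (s₂ * q₀) + C * (β * (D * M * ν * cum))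
        ≤ l * (C * (β * D * M) * (s₂ * q₀) + C * (β * (D * M * ν * cum))) :=
      le_mul_of_one_le_left (by positivity) hl1
    linarith

end Constants

namespace GLMBandit

variable {d K : ℕ} {B : GLMBandit d K} {M D R L G : ℝ}

theorem GradLip.nonneg (hL : B.GradLip R L) (hB : B.Bounded M D) (hR : 0 ≤ R) (i : Fin K) :
    0 ≤ L := by
  obtain ⟨x, hx⟩ := hB.exists_ctx
  exact (norm_nonneg _).trans (hL _ (hB.param_mem i) x hx 0 (by simpa using hR))

theorem GradDev.nonneg {i : Fin K} (hG : B.GradDev i R G) (hB : B.Bounded M D) (hR : 0 ≤ R) :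
    0 ≤ G := by
  obtain ⟨x, hx⟩ := hB.exists_ctx
  exact (norm_nonneg _).trans (hG _ (hB.param_mem i) x hx 0 (by simpa using hR))

end GLMBandit

end PrivateBandit

/-! ### Assembly of the bound -/

theorem mainTheorem10 (M D β R : ℝ) (hM : 0 < M) (hD : 0 < D) (hβ : 0 < β) (hR : 0 ≤ R) :
    ∃ C : ℝ, 0 < C ∧
      ∀ (d K : ℕ) (B : PrivateBandit.GLMBandit d K) (Kopt : Finset (Fin K))
        (h u lam ell ν c m γ L G ε δ α : ℝ),
        0 < h → 0 < u → 0 < lam → 0 < ell → 0 < ν → 0 < m → 0 < γ → 0 < ε →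
        0 < δ → δ < 1 → 0 < α → α < 1 →
        B.Bounded M D → B.OptimalArms Kopt h u → B.Eigenvalue Kopt h lam →
        B.Margin Kopt ell ν → B.Link c m β → B.GradLip R L →
      ∀ (Ω : Type*) [MeasurableSpace Ω] (P : MeasureTheory.Measure Ω)
        [MeasureTheory.IsProbabilityMeasure P]
        (ℱ : MeasureTheory.Filtration ℕ (inferInstance : MeasurableSpace Ω))
        (S : PrivateBandit.Run B Ω) (T : ℕ),
        1 ≤ S.t0 →
        S.IsDPHDB P ℱ T h R (PrivateBandit.noiseScale D β L ε δ T) →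
      ∀ i ∈ Kopt, B.Interior i γ → B.GradDev i R G →
      ∀ t : ℕ, S.t0 < t → S.round i t ≤ T →
        P {ω | ¬ (S.Localized Kopt M β h ell t ω →
          S.gradError P ℱ i t ω ≤
            C * (β / t * (M * D
                + PrivateBandit.constSC D β
                    (PrivateBandit.constA D β G L ε δ d T (α / (2 * (d + S.t0)))) γ u m lam
                  * (M + √(Real.log ((d + T) / α))) * √(S.t0 : ℝ)
                + D * M * ν * S.cumError i t ω)
              + (M * D + β) * √(Real.log ((d + T) / α)) / √(t : ℝ)) ∧
          S.gradError P ℱ i t ω ≤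
            C * (√(Real.log ((d + T) / α)) *
              ((M * D + β) / √(t : ℝ)
                + β * D * M / t *
                  (PrivateBandit.constSC D β
                      (PrivateBandit.constA D β G L ε δ d T (α / (d + S.t0))) γ u m lam
                    * √(S.t0 : ℝ)
                  + ν * S.cumError i t ω))))} ≤ ENNReal.ofReal α := by
  -- `L₀` bounds the gradients, `c₁` the martingale differences, and `κ` compares the warm-up error
  -- with `β D² + A`.
  set L₀ := M * (β * M * D + 2 * R) with hL₀
  set c₁ := 2 * (β * M ^ 2 * D + L₀) with hc₁
  have hL₀0 : 0 ≤ L₀ := by positivity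
  have hc₁0 : 0 ≤ c₁ := by positivity
  set κ := 1 + (4 * L₀ + 2 * c₁) / (8 * β * D) + M ^ 2 with hκ
  have hκ0 : 0 ≤ κ := by positivity
  refine ⟨(4 * L₀ + 3 * c₁) / (M * D + β) + 8 * M * κ / √β + 8 * κ / (√β * D) + 2 * M ^ 2 + 1,
    by positivity, ?_⟩
  intro d K B Kopt h u lam ell ν c m γ L G ε δ α hh hu hlam hell hν hm hγ hε hδ hδ1 hα hα1 hB ho
    hE hmar hl hL Ω _ P _ ℱ S T ht0 hS i hi hI hG t htt hT
  have H : PrivateBandit.Setting S P ℱ T Kopt M D β R h u ell ν c m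
      (PrivateBandit.noiseScale D β L ε δ T) :=
    ⟨hM, hD, hβ, hR, hh, hν, hm, hB, ho, hmar, hl, ht0, hS⟩
  have hL0 : 0 ≤ L := hL.nonneg hB hR i
  have hG0 : 0 ≤ G := hG.nonneg hB hR
  have hd : 1 ≤ d := hB.dim_pos i
  have hTt : t ≤ T := by
    rw [S.round_of_lt htt] at hT
    omega
  have hT2 : 2 ≤ T := by omega
  have hd' : (1 : ℝ) ≤ d := by exact_mod_cast hd
  have ht0' : (1 : ℝ) ≤ S.t0 := by exact_mod_cast ht0
  have hT' : (2 : ℝ) ≤ T := by exact_mod_cast hT2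
  have ht' : (1 : ℝ) ≤ t := by exact_mod_cast (by omega : 1 ≤ t)
  set Q := 4 * D * (β * D + L) * √(Real.log T * Real.log (1 / δ)) / ε with hQ
  have hlogT : 0 < Real.log T := Real.log_pos (by linarith)
  have hlogδ : 0 < Real.log (1 / δ) := Real.log_pos (by rw [lt_div_iff₀ hδ]; linarith)
  have hQ0 : 0 < Q := by positivity
  have hb : ∀ n : ℕ, PrivateBandit.noiseScale D β L ε δ T n = Q / √(n : ℝ) :=
    PrivateBandit.noiseScale_eq D β L ε δ T
  have hσ0 : 0 < u * m * lam := by positivity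
  -- The strong convexity modulus: the arm's best region has mass above `u` and contributes
  -- eigenvalue `lam`; the link slope contributes `m`.
  have hσ : ∀ w : Fin d → ℝ, u * m * lam * (w ⬝ᵥ w) ≤ m * ∫ x, (x ⬝ᵥ w) ^ 2 ∂B.law := by
    intro w
    have := mul_le_mul_of_nonneg_left (hE.le_integral hB ho hu.le hlam.le hi w) hm.le
    linarith
  have hy0 : 0 ≤ Real.log (8 * d * S.t0 / α) := by
    refine Real.log_nonneg ?_
    rw [le_div_iff₀ hα]
    nlinarith
  have hα2 : 0 < α / (2 * (d + S.t0)) := by positivity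
  have hα12 : α / (2 * (d + S.t0)) ≤ α / (d + S.t0) := by
    gcongr
    linarith
  have hA2 : 0 ≤ PrivateBandit.constA D β G L ε δ d T (α / (d + S.t0)) :=
    PrivateBandit.constA_nonneg hD hβ hG0 hL0 hε
      (hy0.trans (PrivateBandit.log_le_log_div hd ht0 hT2 hα))
  have hA12 := PrivateBandit.constA_anti (δ := δ) hD hβ hG0 hL0 hε hd (by omega : 1 ≤ T) hα2 hα12
  have hW := PrivateBandit.warmup_error_le (δ := δ) (M := M) hD hβ hG0 hL0 hε hL₀0 hc₁0 hd ht0 hT2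
    hα hα1
  rw [← hκ, ← hQ] at hW
  have hsc₁ := PrivateBandit.constSC_eq (D := D) (β := β)
    (A := PrivateBandit.constA D β G L ε δ d T (α / (2 * (d + S.t0))))
    (add_nonneg (by positivity) (hA2.trans hA12)) hγ hσ0
  have hsc₂ := PrivateBandit.constSC_eq (D := D) (β := β)
    (A := PrivateBandit.constA D β G L ε δ d T (α / (d + S.t0)))
    (add_nonneg (by positivity) hA2) hγ hσ0
  set A₁ := PrivateBandit.constA D β G L ε δ d T (α / (2 * (d + S.t0)))
  set A₂ := PrivateBandit.constA D β G L ε δ d T (α / (d + S.t0))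
  have hΛ : 1 ≤ Real.log ((d + T) / α) := by
    refine PrivateBandit.one_le_log_of_three_le ?_
    rw [le_div_iff₀ hα]
    linarith
  -- With `X = (d + T)/α ≥ 3` one has `8 ≤ X³`, hence `8 d/α ≤ X⁴`.
  have hyΛ : Real.log (8 * d / α) ≤ 4 * Real.log ((d + T) / α) := by
    have h1 : Real.log (8 * d / α) ≤ Real.log (((d + T) / α) ^ 4) := by
      refine Real.log_le_log (by positivity) ?_
      have h2 : 3 ≤ ((d : ℝ) + T) / α := by
        rw [le_div_iff₀ hα]
        linarith
      have h3 : (d : ℝ) / α ≤ (d + T) / α := by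
        gcongr
        linarith
      rw [mul_div_assoc]
      set X := ((d : ℝ) + T) / α
      have h4 : 27 ≤ X ^ 3 := by
        calc (27 : ℝ) = 3 ^ 3 := by norm_num
          _ ≤ X ^ 3 := by gcongr
      calc 8 * ((d : ℝ) / α) ≤ X ^ 3 * X := by
            refine mul_le_mul (by linarith) h3 (by positivity) (by positivity)
        _ = X ^ 4 := by ring
    rwa [Real.log_pow] at h1
  obtain ⟨bad, hbad, hgood⟩ := H.exists_good_event hα hα1 htt hT fun n hn => by
    have hn' : (1 : ℝ) ≤ n := by exact_mod_cast hn
    rw [hb]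
    positivity
  refine (measure_mono_ae ?_).trans hbad
  filter_upwards [H.ae_excess_t0_le hI hγ hσ0 hσ hy0 hQ0.le hb (S.round_le_of_le htt.le hT),
    H.ae_abs_gradError_le hi htt hT] with ω hexc herr hω
  by_contra hωb
  refine hω fun hloc => ?_
  obtain ⟨hg1, hg2, hg3⟩ := hgood ω hωb
  have he := hexc hg1 hg2
  have hsc₂0 : 0 ≤ PrivateBandit.constSC D β A₂ γ u m lam := Real.sqrt_nonneg _
  have hcum : 0 ≤ S.cumError i t ω := Finset.sum_nonneg fun _ _ => PrivateBandit.l1_nonneg _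
  refine PrivateBandit.bounds_of_scaled_bound (L₀ := L₀) (c₁ := c₁) (κ := κ)
    (e := PrivateBandit.excess (PrivateBandit.clamp B.link c) B.law (B.param i) (S.est i S.t0 ω))
    (y := Real.log (8 * d / α)) hM hD hβ hL₀0 hc₁0 hκ0 (norm_nonneg _) hcum hν hsc₂0 ?_ hyΛ hΛ ht'
    ht0' rfl ?_ ?_
  · rw [hsc₁, hsc₂]
    gcongr
  · refine he.trans ?_
    -- The Frank-Wolfe rate carries the factor 6 and `C_sc` the factor 3, hence the 2.
    have e1 : 2 * κ * PrivateBandit.constSC D β A₂ γ u m lam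
        = 6 * (κ * (β * D ^ 2 + A₂)) / (γ * √(u * m * lam)) := by
      rw [hsc₂]
      ring
    rw [e1]
    gcongr
  · have h1 : S.gradError P ℱ i t ω ≤ (4 * L₀ + c₁ * √(2 * t * Real.log (8 * d / α))
        + ((S.t0 : ℝ) + 1) * (M * √(4 * β * PrivateBandit.excess (PrivateBandit.clamp B.link c)
          B.law (B.param i) (S.est i S.t0 ω)))
        + 2 * β * M ^ 3 * D * ν * S.cumError i t ω) / ((t : ℝ) + 1) := by
      rw [PrivateBandit.Run.gradError, pi_norm_le_iff_of_nonneg (by positivity)]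
      intro j
      rw [Pi.sub_apply, Real.norm_eq_abs, le_div_iff₀ (by positivity), mul_comm]
      refine (herr hloc j).trans ?_
      have := hg3 j
      linarith
    rwa [le_div_iff₀ (by positivity), mul_comm] at h1
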